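/- Let $X$ be a compact metric space, $\pi\colon\tilde X\to X$ a normal covering with covering group $\Gamma$ (that is, $\Gamma$ acts on $\tilde X$ by homeomorphisms so that every point has a neighbourhood whose translates are pairwise disjoint, and $X$ is the quotient), $H$ a complex Hilbert space and $\rho\colon C_0(X)\to\mathfrak B(H)$ a $*$-representation, not necessarily essential. *Local algebras.* For $U\subseteq X$ open let $P_UH=\overline{\rho(C_0(U))H}$. An operator $T$ on $P_UH$ is pseudolocal (resp. locally compact) if $T\rho(f)-\rho(f)T$ is compact (resp. $T\rho(f)$ and $\rho(f)T$ are compact) for all $f\in C_0(U)$. Let $\mathfrak D(U)$ and $\mathfrak C(U)$ be the sets of pseudolocal and of locally compact operators on $P_UH$, and $\mathfrak Q(U)=\mathfrak D(U)/\mathfrak C(U)$. *Equivariant algebras.* Let $\tilde H$ be the induced $(\tilde X,\Gamma)$-module, the completion of $C_c(\tilde X)\otimes H$ for $\langle f\otimes h,f'\otimes h'\rangle=\langle h,\rho(p(\bar f f'))h'\rangle$, where $p(f)(x)=\sum_{\pi(y)=x}f(y)$; here $C_0(\tilde X)$ acts by $g(f\otimes h)=gf\otimes h$ and $\Gamma$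 acts unitarily by $\gamma(f\otimes h)=f(\gamma^{-1}\,\cdot)\otimes h$. For $U\subseteq X$ open put $P_U\tilde H=\overline{C_0(\pi^{-1}(U))\tilde H}$. A subset of $\tilde X\times\tilde X$ is controlled if it is contained in $\bigcup_{\gamma\in\Gamma}\gamma L\times\gamma L$ for some compact $L\subseteq\tilde X$; an operator $T$ on $P_U\tilde H$ is controlled if there is a controlled set $S$ such that $fTg=0$ for all $f,g\in C_c(\pi^{-1}(U))$ with $(\operatorname{supp} f\times\operatorname{supp} g)\cap S=\emptyset$. Let $\mathfrak D_\Gamma(U)$ (resp. $\mathfrak C_\Gamma(U)$) be the norm closure of the set of controlled, $\Gamma$-invariant operators on $P_U\tilde H$ that are pseudolocal (resp. locally compact) with respect to $C_0(\pi^{-1}(U))$, and $\mathfrak Q_\Gamma(U)=\mathfrak D_\Gamma(U)/\mathfrak C_\Gamma(U)$. *Sheaves.* A presheaf $\mathfrak A$ of unital $C^*$-algebras on $X$ is a sheaf if $\mathfrak A(\emptyset)=0$ and, whenever $U=\bigcup_jU_j$ is a union of open sets, (i) $a\in\mathfrak A(U)$ vanishes if $a_{|U_j}=0$ for all $j$;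 (ii) each bounded family $a_j\in\mathfrak A(U_j)$ with $a_{i|U_i\cap U_j}=a_{j|U_i\cap U_j}$ for all $i,j$ is of the form $a_j=a_{|U_j}$ with $a\in\mathfrak A(U)$, $\|a\|\le\sup_j\|a_j\|$. It is special if each $\mathfrak A(U)$ is a unital module over the algebra $C_b(U)$ of bounded continuous functions, compatibly with the algebra structure, the involution and restrictions. **Theorem.** 1. For $U\subseteq V$ open, the compressions $T\mapsto P_UTP_U$ map $\mathfrak D_\Gamma(V)$ into $\mathfrak D_\Gamma(U)$ and $\mathfrak D(V)$ into $\mathfrak D(U)$, and they induce unital $*$-homomorphisms $\mathfrak Q_\Gamma(V)\to\mathfrak Q_\Gamma(U)$ and $\mathfrak Q(V)\to\mathfrak Q(U)$ which make $\mathfrak Q_\Gamma$ and $\mathfrak Q$ sheaves of unital $C^*$-algebras over $X$. The sheaf $\mathfrak Q_\Gamma$ is special, $f\in C_b(U)$ acting on $\mathfrak Q_\Gamma(U)$ as multiplication by the class of the operator of multiplication by $f\circ\pi$ on $P_U\tilde H$, which belongs to $\mathfrak D_\Gamma(U)$. 2. There is exactly one isomorphism of sheaves of unital $C^*$-algebras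 $\alpha\colon\mathfrak Q_\Gamma\to\mathfrak Q$ with the following property. Let $U\subseteq X$ be open and let $s\colon U\to\tilde X$ be a continuous section of $\pi$ over $U$ (for instance $s(u)=(u,\gamma)$ in a trivialization $\pi^{-1}(U)\cong U\times\Gamma$). There is an isometry $V\colon P_UH\to P_U\tilde H$ with $V\rho(a)h=(a\circ s^{-1})\otimes h$ for all $h\in H$ and all $a\in C_0(U)$ for which $a\circ s^{-1}$, extended by zero, is in $C_c(\tilde X)$ (in such a trivialization it is the inclusion of the summand of index $\gamma$ of $P_U\tilde H\cong P_UH\otimes\ell^2(\Gamma)$, so that $V^*TV$ is the diagonal matrix entry $T_{\gamma\gamma}$), and for every $T\in\mathfrak D_\Gamma(U)$ one has $V^*TV\in\mathfrak D(U)$ and $\alpha_U([T])=[V^*TV]$. In particular, $\alpha_X$ is an isomorphism $\mathfrak Q_\Gamma(X)\cong\mathfrak Q(X)$. -/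

import Mathlib

open Filter Topology TopologicalSpace
open scoped ZeroAtInfty BoundedContinuousFunction

/-- A norm-closed, self-adjoint, two-sided ideal of a unital C⋆-algebra. -/
structure CStarIdeal (A : Type*) [CStarAlgebra A] where
  toIdeal : Ideal A
  mul_mem_right' : ∀ {a : A} (b : A), a ∈ toIdeal → a * b ∈ toIdeal
  star_mem' : ∀ {a : A}, a ∈ toIdeal → star a ∈ toIdeal
  isClosed' : IsClosed (toIdeal : Set A)

namespace CStarIdeal

variable {A : Type*} [CStarAlgebra A] (I : CStarIdeal A)

instance : I.toIdeal.IsTwoSided := ⟨fun b ha => I.mul_mem_right' b ha⟩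

instance : IsClosed (I.toIdeal : Set A) := I.isClosed'

/-- The quotient C⋆-algebra `A / I`, with the quotient norm. -/
def Quot : Type _ := A ⧸ I.toIdeal

noncomputable section

instance : Ring I.Quot := inferInstanceAs (Ring (A ⧸ I.toIdeal))
instance : Algebra ℂ I.Quot := inferInstanceAs (Algebra ℂ (A ⧸ I.toIdeal))
instance : NormedAddCommGroup I.Quot := Submodule.Quotient.normedAddCommGroup I.toIdeal
instance : CompleteSpace I.Quot := Submodule.Quotient.completeSpace I.toIdeal

/-- The quotient map `A → A / I`. -/
def toQuot : A →ₐ[ℂ] I.Quot := Ideal.Quotient.mkₐ ℂ I.toIdeal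

theorem toQuot_surjective : Function.Surjective I.toQuot := Ideal.Quotient.mk_surjective

theorem toQuot_eq_zero {a : A} : I.toQuot a = 0 ↔ a ∈ I.toIdeal := Ideal.Quotient.eq_zero_iff_mem

theorem norm_toQuot_le (a : A) : ‖I.toQuot a‖ ≤ ‖a‖ := Submodule.Quotient.norm_mk_le I.toIdeal a

theorem exists_norm_lt (x : I.Quot) {ε : ℝ} (hε : 0 < ε) : ∃ a : A, I.toQuot a = x ∧ ‖a‖ < ‖x‖ + ε :=
  Submodule.Quotient.norm_mk_lt (S := I.toIdeal) x hε

instance : NormedRing I.Quot where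
  __ := (inferInstance : Ring I.Quot)
  __ := (inferInstance : NormedAddCommGroup I.Quot)
  norm_mul_le x y := by
    have key : ∀ ε : ℝ, 0 < ε → ‖x * y‖ ≤ (‖x‖ + ε) * (‖y‖ + ε) := by
      intro ε hε
      obtain ⟨a, rfl, ha⟩ := I.exists_norm_lt x hε
      obtain ⟨b, rfl, hb⟩ := I.exists_norm_lt y hε
      rw [← map_mul]
      refine (I.norm_toQuot_le _).trans ((norm_mul_le a b).trans ?_)
      gcongr
    have lim : Tendsto (fun ε : ℝ => (‖x‖ + ε) * (‖y‖ + ε)) (𝓝[>] 0) (𝓝 (‖x‖ * ‖y‖)) := by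
      have : Tendsto (fun ε : ℝ => (‖x‖ + ε) * (‖y‖ + ε)) (𝓝 0) (𝓝 ((‖x‖ + 0) * (‖y‖ + 0))) :=
        Continuous.tendsto (by fun_prop) 0
      simpa using this.mono_left nhdsWithin_le_nhds
    exact ge_of_tendsto lim (eventually_nhdsWithin_of_forall fun ε hε => key ε hε)

instance : NormedAlgebra ℂ I.Quot where
  __ := (inferInstance : Algebra ℂ I.Quot)
  norm_smul_le c x := by
    have key : ∀ ε : ℝ, 0 < ε → ‖c • x‖ ≤ ‖c‖ * (‖x‖ + ε) := by
      intro ε hε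
      obtain ⟨a, rfl, ha⟩ := I.exists_norm_lt x hε
      rw [← map_smul]
      refine (I.norm_toQuot_le _).trans ((norm_smul_le c a).trans ?_)
      gcongr
    have lim : Tendsto (fun ε : ℝ => ‖c‖ * (‖x‖ + ε)) (𝓝[>] 0) (𝓝 (‖c‖ * ‖x‖)) := by
      have : Tendsto (fun ε : ℝ => ‖c‖ * (‖x‖ + ε)) (𝓝 0) (𝓝 (‖c‖ * (‖x‖ + 0))) :=
        Continuous.tendsto (by fun_prop) 0
      simpa using this.mono_left nhdsWithin_le_nhds
    exact ge_of_tendsto lim (eventually_nhdsWithin_of_forall fun ε hε => key ε hε)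

instance : Star I.Quot where
  star := Quotient.lift (fun a => I.toQuot (star a)) fun a b hab => by
    have h : a - b ∈ I.toIdeal := (Submodule.quotientRel_def _).1 hab
    change I.toQuot (star a) = I.toQuot (star b)
    rw [← sub_eq_zero, ← map_sub, ← star_sub, toQuot_eq_zero]
    exact I.star_mem' h

theorem toQuot_star (a : A) : I.toQuot (star a) = star (I.toQuot a) := rfl

instance : StarRing I.Quot where
  star_involutive x := by
    obtain ⟨a, rfl⟩ := I.toQuot_surjective x
    rw [← toQuot_star, ← toQuot_star, star_star]
  star_mul x y := by
    obtain ⟨a, rfl⟩ := I.toQuot_surjective x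
    obtain ⟨b, rfl⟩ := I.toQuot_surjective y
    rw [← toQuot_star, ← toQuot_star, ← map_mul, ← toQuot_star, star_mul, map_mul]
  star_add x y := by
    obtain ⟨a, rfl⟩ := I.toQuot_surjective x
    obtain ⟨b, rfl⟩ := I.toQuot_surjective y
    rw [← toQuot_star, ← toQuot_star, ← map_add, ← toQuot_star, star_add, map_add]

instance : StarModule ℂ I.Quot where
  star_smul c x := by
    obtain ⟨a, rfl⟩ := I.toQuot_surjective x
    rw [← toQuot_star, ← map_smul, ← toQuot_star, star_smul, map_smul]

/-- `I` as a non-unital C⋆-subalgebra. -/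
def toSub : NonUnitalStarSubalgebra ℂ A where
  carrier := I.toIdeal
  add_mem' := I.toIdeal.add_mem
  zero_mem' := I.toIdeal.zero_mem
  mul_mem' {a b} _ hb := I.toIdeal.mul_mem_left a hb
  smul_mem' c a ha := by
    have := I.toIdeal.mul_mem_left (algebraMap ℂ A c) ha
    rwa [← Algebra.smul_def] at this
  star_mem' := I.star_mem'

instance : IsClosed (I.toSub : Set A) := I.isClosed'

theorem norm_toQuot_mul_self_le (a : A) : ‖I.toQuot a‖ * ‖I.toQuot a‖ ≤ ‖I.toQuot (star a * a)‖ := by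
  let _ : PartialOrder I.toSub := CStarAlgebra.spectralOrder _
  have _ : StarOrderedRing I.toSub := CStarAlgebra.spectralOrderedRing _
  let _ : PartialOrder A := CStarAlgebra.spectralOrder _
  have _ : StarOrderedRing A := CStarAlgebra.spectralOrderedRing _
  have hl := CStarAlgebra.increasingApproximateUnit I.toSub
  set l := CStarAlgebra.approximateUnit I.toSub
  have _ : l.NeBot := hl.neBot
  -- it suffices to bound by the norm of every representative of `star a * a`
  refine le_of_forall_pos_le_add fun ε hε => ?_
  obtain ⟨b, hb, hbn⟩ := I.exists_norm_lt (I.toQuot (star a * a)) hε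
  have hd : star a * a - b ∈ I.toIdeal := by
    rw [← toQuot_eq_zero, map_sub, hb, sub_self]
  let d : I.toSub := ⟨star a * a - b, hd⟩
  have hlim : Tendsto (fun e : I.toSub => ‖d - d * e‖) l (𝓝 0) := by
    have := (tendsto_const_nhds (x := d)).sub (hl.tendsto_mul_left d)
    simpa using this.norm
  have hle : ∀ᶠ e in l, ‖I.toQuot a‖ * ‖I.toQuot a‖ ≤ ‖b‖ + ‖d - d * e‖ := by
    filter_upwards [hl.eventually_nonneg, hl.eventually_norm] with e he0 he1
    set f : A := (e : A) with hf
    have hfI : f ∈ I.toIdeal := e.2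
    have hfs : star f = f := by
      have : star e = e := (IsSelfAdjoint.of_nonneg he0)
      exact congrArg Subtype.val this
    have hf0 : (0 : A) ≤ f := by
      have h2 : ∃ g : I.toSub, e = star g * g := by
        exact CStarAlgebra.nonneg_iff_eq_star_mul_self.mp he0
      obtain ⟨g, hg⟩ := h2
      rw [hf, hg]
      exact star_mul_self_nonneg (g : A)
    have hf1 : ‖f‖ ≤ 1 := he1
    have h1f : ‖(1 : A) - f‖ ≤ 1 := by
      have : (1 : A) - f ∈ Set.Icc (0 : A) 1 := by
        rw [Set.sub_mem_Icc_zero_iff_right]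
        exact CStarAlgebra.mem_Icc_iff_norm_le_one.mpr ⟨hf0, hf1⟩
      exact (CStarAlgebra.mem_Icc_iff_norm_le_one.mp this).2
    have e1 : I.toQuot (a * (1 - f)) = I.toQuot a := by
      rw [mul_sub, mul_one, map_sub, (I.toQuot_eq_zero).2 (I.toIdeal.mul_mem_left a hfI), sub_zero]
    have e2 : star (a * (1 - f)) * (a * (1 - f)) = (1 - f) * (b * (1 - f) + (d - d * e : I.toSub)) := by
      have : ((d - d * e : I.toSub) : A) = (star a * a - b) * (1 - f) := by
        simp [d, hf, mul_sub]
      rw [this, star_mul, star_sub, star_one, hfs]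
      noncomm_ring
    calc ‖I.toQuot a‖ * ‖I.toQuot a‖ ≤ ‖a * (1 - f)‖ * ‖a * (1 - f)‖ := by
          rw [← e1]; gcongr <;> exact I.norm_toQuot_le _
      _ = ‖(1 - f) * (b * (1 - f) + (d - d * e : I.toSub))‖ := by
          rw [← CStarRing.norm_star_mul_self, e2]
      _ ≤ ‖1 - f‖ * (‖b‖ * ‖1 - f‖ + ‖d - d * e‖) := by
          refine (norm_mul_le _ _).trans ?_
          gcongr
          refine (norm_add_le _ _).trans ?_
          gcongr
          · exact norm_mul_le _ _
          · exact le_rfl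
      _ ≤ 1 * (‖b‖ * 1 + ‖d - d * e‖) := by gcongr
      _ = _ := by ring
  have := ge_of_tendsto ((tendsto_const_nhds (x := ‖b‖)).add hlim) hle
  linarith

instance : CStarRing I.Quot where
  norm_mul_self_le x := by
    obtain ⟨a, rfl⟩ := I.toQuot_surjective x
    rw [← toQuot_star, ← map_mul]
    exact I.norm_toQuot_mul_self_le a

instance : CStarAlgebra I.Quot where

end
end CStarIdeal

section Sheaves

open TopologicalSpace BoundedContinuousFunction

/-- A presheaf of unital C⋆-algebras on `X` whose algebra of sections over `U` is `A U`. -/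
structure CStarPresheaf {X : Type*} [TopologicalSpace X] (A : Opens X → Type*)
    [∀ U, CStarAlgebra (A U)] where
  res : ∀ {U V : Opens X}, U ≤ V → (A V →⋆ₐ[ℂ] A U)
  res_refl : ∀ {U : Opens X} (a : A U), res (le_refl U) a = a
  res_res : ∀ {U V W : Opens X} (hUV : U ≤ V) (hVW : V ≤ W) (a : A W),
    res hUV (res hVW a) = res (hUV.trans hVW) a

namespace CStarPresheaf

variable {X : Type*} [TopologicalSpace X] {A : Opens X → Type*} [∀ U, CStarAlgebra (A U)]

/-- Sheaves in the category of C⋆-algebras: only *bounded* compatible families are glued. -/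
structure IsSheaf (F : CStarPresheaf A) : Prop where
  empty : Subsingleton (A ⊥)
  uniqueness : ∀ (𝒰 : Set (Opens X)) (a : A (sSup 𝒰)),
    (∀ U (hU : U ∈ 𝒰), F.res (le_sSup hU) a = 0) → a = 0
  gluing : ∀ (𝒰 : Set (Opens X)) (a : ∀ U : 𝒰, A U),
    BddAbove (Set.range fun U => ‖a U‖) →
    (∀ U V : 𝒰, F.res (inf_le_left : (U : Opens X) ⊓ V ≤ U) (a U)
      = F.res (inf_le_right : (U : Opens X) ⊓ V ≤ V) (a V)) →
    ∃ b : A (sSup 𝒰), (∀ U : 𝒰, F.res (le_sSup U.2) b = a U) ∧ ‖b‖ ≤ ⨆ U : 𝒰, ‖a U‖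

/-- The restriction `C_b(V) → C_b(U)` for open sets `U ⊆ V`. -/
noncomputable def restrictBounded {U V : Opens X} (h : U ≤ V) (f : V →ᵇ ℂ) : U →ᵇ ℂ :=
  f.compContinuous ⟨Set.inclusion h, continuous_inclusion h⟩

/-- The structure of a sheaf of unital modules over the sheaf `U ↦ C_b(U)` of bounded continuous
functions, compatible with the C⋆-algebra structure and with restrictions. -/
structure ModuleStructure (F : CStarPresheaf A) where
  act : ∀ U : Opens X, (U →ᵇ ℂ) → A U → A U
  one_act : ∀ U a, act U 1 a = a
  mul_act : ∀ U f g a, act U (f * g) a = act U f (act U g a)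
  add_act : ∀ U f g a, act U (f + g) a = act U f a + act U g a
  act_add : ∀ U f a b, act U f (a + b) = act U f a + act U f b
  const_act : ∀ U (c : ℂ) a, act U (BoundedContinuousFunction.const U c) a = c • a
  act_mul : ∀ U f a b, act U f (a * b) = act U f a * b
  mul_act_comm : ∀ U f a b, act U f (a * b) = a * act U f b
  star_act : ∀ U f a, star (act U f a) = act U (star f) (star a)
  res_act : ∀ {U V : Opens X} (h : U ≤ V) f a,
    F.res h (act V f a) = act U (restrictBounded h f) (F.res h a)

/-- An isomorphism of presheaves of unital C⋆-algebras. -/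
structure Iso {B : Opens X → Type*} [∀ U, CStarAlgebra (B U)] (F : CStarPresheaf A)
    (G : CStarPresheaf B) where
  toEquiv : ∀ U : Opens X, A U ≃⋆ₐ[ℂ] B U
  natural : ∀ {U V : Opens X} (h : U ≤ V) (a : A V),
    toEquiv U (F.res h a) = G.res h (toEquiv V a)

end CStarPresheaf

end Sheaves

section Modules

open TopologicalSpace ContinuousLinearMap
open scoped ZeroAtInfty InnerProduct

/-- Schauder's theorem for Hilbert spaces. -/
theorem IsCompactOperator.adjoint_of_hilbert {K : Type*} [NormedAddCommGroup K]
    [InnerProductSpace ℂ K] [CompleteSpace K] {T : K →L[ℂ] K} (hT : IsCompactOperator T) :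
    IsCompactOperator (adjoint T) := by
  have hTT : IsCompactOperator (T ∘L adjoint T) := hT.comp_clm (adjoint T)
  have hTT' := ((isCompactOperator_iff_isCompact_closure_image_ball
    (T ∘L adjoint T : K →L[ℂ] K).toLinearMap (one_pos : (0 : ℝ) < 1)).1 hTT)
  refine (isCompactOperator_iff_isCompact_closure_image_ball
    (adjoint T : K →L[ℂ] K).toLinearMap (one_pos : (0 : ℝ) < 1)).2 ?_
  have htb := hTT'.totallyBounded.subset subset_closure
  refine TotallyBounded.isCompact_of_isClosed (TotallyBounded.closure ?_) isClosed_closure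
  rw [Metric.totallyBounded_iff]
  intro ε hε
  obtain ⟨t, hts, htf, hcov⟩ := Metric.finite_approx_of_totallyBounded htb (ε ^ 2 / 4) (by positivity)
  have hts' : ∀ z ∈ t, ∃ x : K, x ∈ Metric.ball (0 : K) 1 ∧ (T ∘L adjoint T) x = z :=
    fun z hz => hts hz
  choose! g hg hgt using hts'
  refine ⟨(fun z => adjoint T (g z)) '' t, htf.image _, ?_⟩
  rintro _ ⟨x, hx, rfl⟩
  have hx' := hcov ⟨x, hx, rfl⟩
  simp only [Set.mem_iUnion] at hx' ⊢
  obtain ⟨z, hz, hxz⟩ := hx'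
  refine ⟨adjoint T (g z), ⟨z, hz, rfl⟩, ?_⟩
  have hgz := hg z hz
  have hgz' := hgt z hz
  simp only [Metric.mem_ball, dist_eq_norm, sub_zero] at hx hgz hxz ⊢
  change ‖(adjoint T) x - (adjoint T) (g z)‖ < ε
  rw [← hgz'] at hxz
  have hxz2 : ‖(T ∘L adjoint T) (x - g z)‖ < ε ^ 2 / 4 := by
    rw [map_sub]; exact hxz
  rw [← map_sub]
  have h1 := apply_norm_sq_eq_inner_adjoint_left (adjoint T) (x - g z)
  rw [adjoint_adjoint] at h1
  have h2 : ‖(adjoint T) (x - g z)‖ ^ 2 ≤ ‖(T ∘L adjoint T) (x - g z)‖ * ‖x - g z‖ := by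
    rw [h1]; exact (RCLike.re_le_norm _).trans (norm_inner_le_norm _ _)
  have h3 : ‖x - g z‖ ≤ 2 := (norm_sub_le _ _).trans (by linarith)
  have h4 : ‖(adjoint T) (x - g z)‖ ^ 2 < ε ^ 2 := by
    nlinarith [norm_nonneg ((T ∘L adjoint T) (x - g z)), norm_nonneg (x - g z)]
  exact lt_of_pow_lt_pow_left₀ 2 hε.le h4

variable {Y : Type*} [TopologicalSpace Y]
  {K : Type*} [NormedAddCommGroup K] [InnerProductSpace ℂ K] [CompleteSpace K]

/-- `f ∈ C₀(Y)` vanishes outside the open set `W`. The map `f ↦ f|_W` identifies these functions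
with `C₀(W)`, the inverse being extension by zero. -/
def VanishesOff (W : Opens Y) (f : C₀(Y, ℂ)) : Prop := ∀ y, y ∉ W → f y = 0

/-- The subspace `P_W K` of the `Y`-module `K`, the closure of `ρ(C₀(W)) K`. (Here `P_W` is the
projection assigned to the characteristic function of `W` by the Borel extension of `ρ`; since that
function is the increasing limit of functions in `C₀(W)`, this is its range.) -/
def localSpace (ρ : C₀(Y, ℂ) →⋆ₙₐ[ℂ] (K →L[ℂ] K)) (W : Opens Y) : Submodule ℂ K :=
  (Submodule.span ℂ {v | ∃ f, VanishesOff W f ∧ ∃ ξ, v = ρ f ξ}).topologicalClosure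

noncomputable section

/-- The closed subspace `P_W K` as a Hilbert space in its own right. -/
def LocalModule (ρ : C₀(Y, ℂ) →⋆ₙₐ[ℂ] (K →L[ℂ] K)) (W : Opens Y) : Type _ := localSpace ρ W

instance (ρ : C₀(Y, ℂ) →⋆ₙₐ[ℂ] (K →L[ℂ] K)) (W : Opens Y) :
    NormedAddCommGroup (LocalModule ρ W) :=
  inferInstanceAs (NormedAddCommGroup (localSpace ρ W))

instance (ρ : C₀(Y, ℂ) →⋆ₙₐ[ℂ] (K →L[ℂ] K)) (W : Opens Y) :
    InnerProductSpace ℂ (LocalModule ρ W) :=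
  inferInstanceAs (InnerProductSpace ℂ (localSpace ρ W))

instance (ρ : C₀(Y, ℂ) →⋆ₙₐ[ℂ] (K →L[ℂ] K)) (W : Opens Y) : CompleteSpace (LocalModule ρ W) :=
  inferInstanceAs (CompleteSpace (Submodule.topologicalClosure _))

/-- The inclusion of `P_W K` in `K`. Its adjoint is the projection `P_W`. -/
def localIncl (ρ : C₀(Y, ℂ) →⋆ₙₐ[ℂ] (K →L[ℂ] K)) (W : Opens Y) : LocalModule ρ W →ₗᵢ[ℂ] K :=
  (localSpace ρ W).subtypeₗᵢ

/-- The operator `J⋆ T J` on `M`, where `J : M → N` is an isometry of Hilbert spaces. -/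
def compress {M N : Type*} [NormedAddCommGroup M] [InnerProductSpace ℂ M] [CompleteSpace M]
    [NormedAddCommGroup N] [InnerProductSpace ℂ N] [CompleteSpace N] (J : M →ₗᵢ[ℂ] N)
    (T : N →L[ℂ] N) : M →L[ℂ] M :=
  adjoint J.toContinuousLinearMap ∘L T ∘L J.toContinuousLinearMap

variable (ρ : C₀(Y, ℂ) →⋆ₙₐ[ℂ] (K →L[ℂ] K)) (W : Opens Y)

/-- For `f ∈ C₀(W)`, the operator `ρ(f)` on the `W`-module `P_W K`. -/
def localRep (f : C₀(Y, ℂ)) : LocalModule ρ W →L[ℂ] LocalModule ρ W :=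
  compress (localIncl ρ W) (ρ f)

/-- The restriction `T ↦ P_W T P_W` of operators on `P_V K` to operators on `P_W K`. -/
def restrictOp (V W : Opens Y) (T : LocalModule ρ V →L[ℂ] LocalModule ρ V) :
    LocalModule ρ W →L[ℂ] LocalModule ρ W :=
  compress (localIncl ρ W)
    ((localIncl ρ V).toContinuousLinearMap ∘L T ∘L
      adjoint (localIncl ρ V).toContinuousLinearMap)

/-- Pseudolocal operators on the `W`-module `P_W K`. -/
def IsPseudolocal (T : LocalModule ρ W →L[ℂ] LocalModule ρ W) : Prop :=
  ∀ f, VanishesOff W f → IsCompactOperator (T * localRep ρ W f - localRep ρ W f * T)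

/-- Locally compact operators on the `W`-module `P_W K`. -/
def IsLocallyCompactOp (T : LocalModule ρ W →L[ℂ] LocalModule ρ W) : Prop :=
  ∀ f, VanishesOff W f → IsCompactOperator (T * localRep ρ W f) ∧
    IsCompactOperator (localRep ρ W f * T)

variable {ρ W}

theorem compress_adjoint {M N : Type*} [NormedAddCommGroup M] [InnerProductSpace ℂ M]
    [CompleteSpace M] [NormedAddCommGroup N] [InnerProductSpace ℂ N] [CompleteSpace N]
    (J : M →ₗᵢ[ℂ] N) (T : N →L[ℂ] N) : star (compress J T) = compress J (star T) := by
  simp only [compress, star_eq_adjoint, adjoint_comp, adjoint_adjoint,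
    ContinuousLinearMap.comp_assoc]

theorem localRep_star (f : C₀(Y, ℂ)) : star (localRep ρ W f) = localRep ρ W (star f) := by
  rw [localRep, compress_adjoint, localRep, map_star]

theorem VanishesOff.star {f : C₀(Y, ℂ)} (hf : VanishesOff W f) : VanishesOff W (star f) :=
  fun y hy => by simp [hf y hy]

theorem IsPseudolocal.mul {S T : LocalModule ρ W →L[ℂ] LocalModule ρ W} (hS : IsPseudolocal ρ W S)
    (hT : IsPseudolocal ρ W T) : IsPseudolocal ρ W (S * T) := fun f hf => by
  have h1 : IsCompactOperator (S * (T * localRep ρ W f - localRep ρ W f * T)) :=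
    (hT f hf).clm_comp S
  have h2 : IsCompactOperator ((S * localRep ρ W f - localRep ρ W f * S) * T) :=
    (hS f hf).comp_clm T
  have e : S * T * localRep ρ W f - localRep ρ W f * (S * T) =
    S * (T * localRep ρ W f - localRep ρ W f * T) +
      (S * localRep ρ W f - localRep ρ W f * S) * T := by
      simp only [mul_sub, sub_mul, mul_assoc]; abel
  rw [e]; exact h1.add h2

theorem IsPseudolocal.add {S T : LocalModule ρ W →L[ℂ] LocalModule ρ W} (hS : IsPseudolocal ρ W S)
    (hT : IsPseudolocal ρ W T) : IsPseudolocal ρ W (S + T) := fun f hf => by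
  have e : (S + T) * localRep ρ W f - localRep ρ W f * (S + T) =
    (S * localRep ρ W f - localRep ρ W f * S) + (T * localRep ρ W f - localRep ρ W f * T) := by
    simp only [add_mul, mul_add]; abel
  rw [e]; exact (hS f hf).add (hT f hf)

theorem IsPseudolocal.scalar (c : ℂ) :
    IsPseudolocal ρ W (algebraMap ℂ (LocalModule ρ W →L[ℂ] LocalModule ρ W) c) := fun f _ => by
  have e : algebraMap ℂ (LocalModule ρ W →L[ℂ] LocalModule ρ W) c * localRep ρ W f -
      localRep ρ W f * algebraMap ℂ _ c = 0 := by
    rw [Algebra.commutes, sub_self]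
  rw [e]; exact isCompactOperator_zero

theorem IsPseudolocal.star {T : LocalModule ρ W →L[ℂ] LocalModule ρ W} (hT : IsPseudolocal ρ W T) :
    IsPseudolocal ρ W (star T) := fun f hf => by
  have h := ((hT _ hf.star).adjoint_of_hilbert).neg
  have e : Star.star T * localRep ρ W f - localRep ρ W f * Star.star T =
      -adjoint (T * localRep ρ W (Star.star f) - localRep ρ W (Star.star f) * T) := by
    rw [← star_eq_adjoint, star_sub, star_mul, star_mul, localRep_star, star_star]
    abel
  rw [e]; exact h

theorem isClosed_isPseudolocal : IsClosed {T | IsPseudolocal ρ W T} := by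
  simp only [IsPseudolocal, Set.ofPred_forall]
  refine isClosed_iInter fun f => isClosed_iInter fun _ => ?_
  exact isClosed_setOfPred_isCompactOperator.preimage
    ((continuous_id.mul continuous_const).sub (continuous_const.mul continuous_id))

theorem IsLocallyCompactOp.add {S T : LocalModule ρ W →L[ℂ] LocalModule ρ W}
    (hS : IsLocallyCompactOp ρ W S) (hT : IsLocallyCompactOp ρ W T) :
    IsLocallyCompactOp ρ W (S + T) := fun f hf => by
  rw [add_mul, mul_add]
  exact ⟨(hS f hf).1.add (hT f hf).1, (hS f hf).2.add (hT f hf).2⟩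

theorem IsLocallyCompactOp.zero : IsLocallyCompactOp ρ W 0 := fun f _ => by
  rw [zero_mul, mul_zero]
  exact ⟨isCompactOperator_zero, isCompactOperator_zero⟩

theorem IsLocallyCompactOp.mul_left {S T : LocalModule ρ W →L[ℂ] LocalModule ρ W}
    (hS : IsPseudolocal ρ W S) (hT : IsLocallyCompactOp ρ W T) :
    IsLocallyCompactOp ρ W (S * T) := fun f hf => by
  refine ⟨?_, ?_⟩
  · rw [mul_assoc]; exact (hT f hf).1.clm_comp S
  · have e : localRep ρ W f * (S * T) = S * (localRep ρ W f * T) -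
      (S * localRep ρ W f - localRep ρ W f * S) * T := by
      simp only [mul_sub, sub_mul, mul_assoc]; abel
    rw [e]
    exact ((hT f hf).2.clm_comp S).sub ((hS f hf).comp_clm T)

theorem IsLocallyCompactOp.mul_right {S T : LocalModule ρ W →L[ℂ] LocalModule ρ W}
    (hS : IsLocallyCompactOp ρ W S) (hT : IsPseudolocal ρ W T) :
    IsLocallyCompactOp ρ W (S * T) := fun f hf => by
  refine ⟨?_, ?_⟩
  · have e : S * T * localRep ρ W f = S * (T * localRep ρ W f - localRep ρ W f * T) +
      S * localRep ρ W f * T := by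
      simp only [mul_sub, sub_mul, mul_assoc]; abel
    rw [e]
    exact ((hT f hf).clm_comp S).add ((hS f hf).1.comp_clm T)
  · rw [← mul_assoc]; exact (hS f hf).2.comp_clm T

theorem IsLocallyCompactOp.star {T : LocalModule ρ W →L[ℂ] LocalModule ρ W}
    (hT : IsLocallyCompactOp ρ W T) : IsLocallyCompactOp ρ W (star T) := fun f hf => by
  have h := hT _ hf.star
  refine ⟨?_, ?_⟩
  · have := h.2.adjoint_of_hilbert
    rwa [← star_eq_adjoint, star_mul, localRep_star, star_star] at this
  · have := h.1.adjoint_of_hilbert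
    rwa [← star_eq_adjoint, star_mul, localRep_star, star_star] at this

theorem isClosed_isLocallyCompactOp : IsClosed {T | IsLocallyCompactOp ρ W T} := by
  simp only [IsLocallyCompactOp, Set.ofPred_forall, Set.ofPred_and]
  refine isClosed_iInter fun f => isClosed_iInter fun _ => IsClosed.inter ?_ ?_
  · exact isClosed_setOfPred_isCompactOperator.preimage (continuous_id.mul continuous_const)
  · exact isClosed_setOfPred_isCompactOperator.preimage (continuous_const.mul continuous_id)

theorem IsLocallyCompactOp.isPseudolocal {T : LocalModule ρ W →L[ℂ] LocalModule ρ W}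
    (hT : IsLocallyCompactOp ρ W T) : IsPseudolocal ρ W T :=
  fun f hf => (hT f hf).1.sub (hT f hf).2

variable (ρ W)

/-- The C⋆-algebra `𝔇(W)` of pseudolocal operators on the `W`-module `P_W K`. -/
def algD : StarSubalgebra ℂ (LocalModule ρ W →L[ℂ] LocalModule ρ W) where
  carrier := {T | IsPseudolocal ρ W T}
  mul_mem' := IsPseudolocal.mul
  add_mem' := IsPseudolocal.add
  algebraMap_mem' := IsPseudolocal.scalar
  star_mem' := IsPseudolocal.star

instance : IsClosed (algD ρ W : Set (LocalModule ρ W →L[ℂ] LocalModule ρ W)) :=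
  isClosed_isPseudolocal

/-- The ideal `ℭ(W)` of locally compact operators in `𝔇(W)`. -/
def idealC : CStarIdeal (algD ρ W) where
  toIdeal :=
    { carrier := {T | IsLocallyCompactOp ρ W T.1}
      add_mem' := IsLocallyCompactOp.add
      zero_mem' := IsLocallyCompactOp.zero
      smul_mem' := fun S _ hT => IsLocallyCompactOp.mul_left S.2 hT }
  mul_mem_right' := fun T hS => IsLocallyCompactOp.mul_right hS T.2
  star_mem' := IsLocallyCompactOp.star
  isClosed' := isClosed_isLocallyCompactOp.preimage continuous_subtype_val

/-- The C⋆-algebra `𝔔(W) = 𝔇(W) / ℭ(W)`. -/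
abbrev algQ : Type _ := (idealC ρ W).Quot

end
end Modules

section Coverings

open TopologicalSpace ContinuousLinearMap
open scoped ZeroAtInfty InnerProduct

/-- A normal covering `Y → X` with covering group `Γ`: a quotient map by a free action of the
discrete group `Γ` such that each point has a neighbourhood with pairwise disjoint translates. -/
structure NormalCovering (Γ Y X : Type*) [Group Γ] [TopologicalSpace Y] [TopologicalSpace X]
    [MulAction Γ Y] where
  proj : Y → X
  isQuotientCoveringMap : IsQuotientCoveringMap proj Γ

namespace NormalCovering

variable {Γ Y X : Type*} [Group Γ] [TopologicalSpace Y] [TopologicalSpace X] [MulAction Γ Y]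

theorem continuous_proj (π : NormalCovering Γ Y X) : Continuous π.proj := π.isQuotientCoveringMap.continuous

theorem continuous_smul (π : NormalCovering Γ Y X) (γ : Γ) : Continuous fun y : Y => γ • y :=
  π.isQuotientCoveringMap.continuous_const_smul γ

theorem smul_injective (π : NormalCovering Γ Y X) (y : Y) {γ δ : Γ} (h : γ • y = δ • y) : γ = δ := by
  have := π.isQuotientCoveringMap.isCancelSMul
  exact IsCancelSMul.right_cancel _ _ _ h

/-- The preimage in `Y` of an open subset of `X`. -/
def preimage (π : NormalCovering Γ Y X) (U : Opens X) : Opens Y := ⟨π.proj ⁻¹' U, U.2.preimage π.continuous_proj⟩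

theorem t2Space (π : NormalCovering Γ Y X) [T2Space X] : T2Space Y := by
  refine ⟨fun a b hab => ?_⟩
  by_cases h : π.proj a = π.proj b
  · exact π.isQuotientCoveringMap.isCoveringMap.isSeparatedMap a b h hab
  · obtain ⟨u, v, hu, hv, ha, hb, huv⟩ := t2_separation h
    exact ⟨_, _, hu.preimage π.continuous_proj, hv.preimage π.continuous_proj, ha, hb,
      huv.preimage _⟩

theorem locallyCompactSpace (π : NormalCovering Γ Y X) [T2Space X] [CompactSpace X] : LocallyCompactSpace Y := by
  have := π.t2Space
  have : WeaklyLocallyCompactSpace Y := ⟨fun y => by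
    obtain ⟨e, hy, he⟩ := π.isQuotientCoveringMap.isCoveringMap.isLocalHomeomorph y
    obtain ⟨K, hK, hKe, hKc⟩ := local_compact_nhds (e.open_target.mem_nhds (e.map_source hy))
    refine ⟨e.symm '' K, hKc.image_of_continuousOn (e.continuousOn_symm.mono hKe), ?_⟩
    have := e.symm.image_mem_nhds (x := e y) (e.map_source hy) hK
    rwa [e.left_inv hy] at this⟩
  infer_instance

/-- The action of `Γ` on `Y` is properly discontinuous. -/
theorem finite_meet (π : NormalCovering Γ Y X) [T2Space X] {L L' : Set Y} (hL : IsCompact L) (hL' : IsCompact L') :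
    {γ : Γ | ∃ a ∈ L, γ • a ∈ L'}.Finite := by
  have := π.t2Space
  have := π.isQuotientCoveringMap.toContinuousConstSMul
  -- locally, at most one element of `Γ` moves a neighbourhood of `a` to meet one of `b`
  have loc : ∀ a b : Y, ∃ A ∈ 𝓝 a, ∃ B ∈ 𝓝 b, {γ : Γ | ∃ x ∈ A, γ • x ∈ B}.Finite := by
    intro a b
    by_cases h : π.proj a = π.proj b
    · obtain ⟨δ, hδ⟩ := π.isQuotientCoveringMap.apply_eq_iff_mem_orbit.1 h
      obtain ⟨N, hN, hNd⟩ := π.isQuotientCoveringMap.disjoint b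
      have hδ' : δ • b = a := hδ
      refine ⟨(fun x => δ⁻¹ • x) ⁻¹' N, ?_, N, hN, ?_⟩
      · refine (π.continuous_smul δ⁻¹).continuousAt.preimage_mem_nhds ?_
        rwa [← hδ', inv_smul_smul]
      · refine (Set.finite_singleton δ⁻¹).subset ?_
        rintro γ ⟨x, hx, hγ⟩
        have := hNd (γ * δ) ⟨γ • x, ⟨δ⁻¹ • x, hx, by simp [mul_smul]⟩, hγ⟩
        exact eq_inv_of_mul_eq_one_left this
    · obtain ⟨u, v, hu, hv, ha, hb, huv⟩ := t2_separation h
      refine ⟨π.proj ⁻¹' u, (hu.preimage π.continuous_proj).mem_nhds ha, π.proj ⁻¹' v,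
        (hv.preimage π.continuous_proj).mem_nhds hb, ?_⟩
      refine Set.finite_empty.subset ?_
      rintro γ ⟨x, hx, hγ⟩
      have : π.proj (γ • x) = π.proj x := π.isQuotientCoveringMap.map_smul γ
      exact (Set.disjoint_left.1 huv hx (this ▸ hγ)).elim
  -- first globalise in `a`, then in `b`
  have step : ∀ b : Y, ∃ B ∈ 𝓝 b, {γ : Γ | ∃ a ∈ L, γ • a ∈ B}.Finite := by
    intro b
    refine hL.induction_on (p := fun s => ∃ B ∈ 𝓝 b, {γ : Γ | ∃ a ∈ s, γ • a ∈ B}.Finite)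
      ⟨Set.univ, univ_mem, by simp⟩ ?_ ?_ ?_
    · rintro s t hst ⟨B, hB, hf⟩
      exact ⟨B, hB, hf.subset fun γ ⟨a, ha, h⟩ => ⟨a, hst ha, h⟩⟩
    · rintro s t ⟨B, hB, hf⟩ ⟨B', hB', hf'⟩
      refine ⟨B ∩ B', inter_mem hB hB', (hf.union hf').subset ?_⟩
      rintro γ ⟨a, ha | ha, h⟩
      · exact Or.inl ⟨a, ha, h.1⟩
      · exact Or.inr ⟨a, ha, h.2⟩
    · intro a _
      obtain ⟨A, hA, B, hB, hf⟩ := loc a b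
      exact ⟨A, mem_nhdsWithin_of_mem_nhds hA, B, hB, hf⟩
  refine hL'.induction_on (p := fun s => {γ : Γ | ∃ a ∈ L, γ • a ∈ s}.Finite) (by simp) ?_ ?_ ?_
  · rintro s t hst hf
    exact hf.subset fun γ ⟨a, ha, h⟩ => ⟨a, ha, hst h⟩
  · rintro s t hf hf'
    refine (hf.union hf').subset ?_
    rintro γ ⟨a, ha, h | h⟩
    · exact Or.inl ⟨a, ha, h⟩
    · exact Or.inr ⟨a, ha, h⟩
  · intro b _
    obtain ⟨B, hB, hf⟩ := step b
    exact ⟨B, mem_nhdsWithin_of_mem_nhds hB, hf⟩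

/-- `Γ` acts cocompactly. -/
theorem exists_compact_cover (π : NormalCovering Γ Y X) [T2Space X] [CompactSpace X] :
    ∃ L : Set Y, IsCompact L ∧ ∀ y, ∃ γ : Γ, ∃ a ∈ L, y = γ • a := by
  have := π.t2Space
  have := π.locallyCompactSpace
  have hsurj := π.isQuotientCoveringMap.surjective
  have h : ∃ L : Set Y, IsCompact L ∧ (Set.univ : Set X) ⊆ π.proj '' L := by
    refine (isCompact_univ (X := X)).induction_on
      (p := fun s => ∃ L : Set Y, IsCompact L ∧ s ⊆ π.proj '' L) ⟨∅, isCompact_empty, by simp⟩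
      ?_ ?_ ?_
    · rintro s t hst ⟨L, hL, h⟩
      exact ⟨L, hL, hst.trans h⟩
    · rintro s t ⟨L, hL, h⟩ ⟨L', hL', h'⟩
      refine ⟨L ∪ L', hL.union hL', ?_⟩
      rw [Set.image_union]
      exact Set.union_subset_union h h'
    · intro x _
      obtain ⟨y, rfl⟩ := hsurj x
      obtain ⟨L, hL, hy⟩ := exists_compact_mem_nhds y
      exact ⟨_, mem_nhdsWithin_of_mem_nhds
        (π.isQuotientCoveringMap.isOpenQuotientMap.isOpenMap.image_mem_nhds hy), L, hL, subset_rfl⟩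
  obtain ⟨L, hL, h⟩ := h
  refine ⟨L, hL, fun y => ?_⟩
  obtain ⟨a, ha, hay⟩ := h (Set.mem_univ (π.proj y))
  obtain ⟨γ, hγ⟩ := π.isQuotientCoveringMap.apply_eq_iff_mem_orbit.1 hay.symm
  exact ⟨γ, a, ha, hγ.symm⟩

end NormalCovering

end Coverings

section EquivariantModules

open TopologicalSpace ContinuousLinearMap
open scoped ZeroAtInfty InnerProduct

/-- Controlled subsets of `Y × Y` for the canonical `Γ`-invariant coarse structure: those contained
in `⋃ γ, γL × γL` for some compact `L`. -/
def IsControlledSet (Γ : Type*) {Y : Type*} [Group Γ] [TopologicalSpace Y] [MulAction Γ Y]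
    (S : Set (Y × Y)) : Prop :=
  ∃ L : Set Y, IsCompact L ∧ ∀ p ∈ S, ∃ γ : Γ, ∃ a ∈ L, ∃ b ∈ L, p = (γ • a, γ • b)

variable {Γ Y X : Type*} [Group Γ] [TopologicalSpace Y] [TopologicalSpace X] [MulAction Γ Y]
  {K : Type*} [NormedAddCommGroup K] [InnerProductSpace ℂ K] [CompleteSpace K]

noncomputable section

section

variable (Γ) (ρ : C₀(Y, ℂ) →⋆ₙₐ[ℂ] (K →L[ℂ] K)) (W : Opens Y)

/-- Controlled operators on the `W`-module `P_W K`, for the restriction to `W` of the canonical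
coarse structure of `Y`. The test functions are those in `C_c(W)`, so that supports in `W` and in
`Y` are the same. -/
def IsControlledOp (T : LocalModule ρ W →L[ℂ] LocalModule ρ W) : Prop :=
  ∃ S : Set (Y × Y), IsControlledSet Γ S ∧ ∀ f g : C₀(Y, ℂ),
    HasCompactSupport f → tsupport f ⊆ W → HasCompactSupport g → tsupport g ⊆ W →
    Disjoint (tsupport f ×ˢ tsupport g) S → localRep ρ W f * T * localRep ρ W g = 0

end

variable (ρ : C₀(Y, ℂ) →⋆ₙₐ[ℂ] (K →L[ℂ] K)) (W : Opens Y)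

set_option linter.unusedSectionVars false

/-- Operators on `P_W K` commuting with the unitary action of `Γ` (which leaves `P_W K` invariant
when `W` is `Γ`-invariant and `K` is a `(Y, Γ)`-module). -/
def IsInvariantOp (u : Γ →* unitary (K →L[ℂ] K)) (T : LocalModule ρ W →L[ℂ] LocalModule ρ W) :
    Prop :=
  ∀ γ : Γ, T * compress (localIncl ρ W) (u γ : K →L[ℂ] K) =
    compress (localIncl ρ W) (u γ : K →L[ℂ] K) * T

variable {ρ W}

theorem IsInvariantOp.mul {u : Γ →* unitary (K →L[ℂ] K)}
    {S T : LocalModule ρ W →L[ℂ] LocalModule ρ W} (hS : IsInvariantOp ρ W u S)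
    (hT : IsInvariantOp ρ W u T) : IsInvariantOp ρ W u (S * T) := fun γ => by
  rw [mul_assoc, hT γ, ← mul_assoc, hS γ, mul_assoc]

theorem IsInvariantOp.add {u : Γ →* unitary (K →L[ℂ] K)}
    {S T : LocalModule ρ W →L[ℂ] LocalModule ρ W} (hS : IsInvariantOp ρ W u S)
    (hT : IsInvariantOp ρ W u T) : IsInvariantOp ρ W u (S + T) := fun γ => by
  rw [add_mul, mul_add, hS γ, hT γ]

theorem IsInvariantOp.scalar {u : Γ →* unitary (K →L[ℂ] K)} (c : ℂ) :
    IsInvariantOp ρ W u (algebraMap ℂ (LocalModule ρ W →L[ℂ] LocalModule ρ W) c) := fun _ => 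
  Algebra.commutes _ _

theorem IsInvariantOp.star {u : Γ →* unitary (K →L[ℂ] K)}
    {T : LocalModule ρ W →L[ℂ] LocalModule ρ W} (hT : IsInvariantOp ρ W u T) :
    IsInvariantOp ρ W u (star T) := fun γ => by
  have h : Star.star (T * compress (localIncl ρ W) (u γ⁻¹ : K →L[ℂ] K)) =
      Star.star (compress (localIncl ρ W) (u γ⁻¹ : K →L[ℂ] K) * T) := by rw [hT γ⁻¹]
  rw [star_mul, star_mul, compress_adjoint] at h
  have e : Star.star ((u γ⁻¹ : unitary (K →L[ℂ] K)) : K →L[ℂ] K) = u γ := by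
    rw [map_inv, ← Unitary.coe_star, Unitary.star_eq_inv, inv_inv]
  rw [e] at h
  exact h.symm

theorem IsControlledSet.union {S S' : Set (Y × Y)}
    (h : IsControlledSet Γ S) (h' : IsControlledSet Γ S') : IsControlledSet Γ (S ∪ S') := by
  obtain ⟨L, hL, hS⟩ := h
  obtain ⟨L', hL', hS'⟩ := h'
  refine ⟨L ∪ L', hL.union hL', ?_⟩
  rintro p (hp | hp)
  · obtain ⟨γ, a, ha, b, hb, rfl⟩ := hS p hp
    exact ⟨γ, a, Or.inl ha, b, Or.inl hb, rfl⟩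
  · obtain ⟨γ, a, ha, b, hb, rfl⟩ := hS' p hp
    exact ⟨γ, a, Or.inr ha, b, Or.inr hb, rfl⟩

theorem localIncl_mem (v : LocalModule ρ W) : localIncl ρ W v ∈ localSpace ρ W :=
  (show localSpace ρ W from v).2

theorem localRep_apply_coe {f : C₀(Y, ℂ)} (hf : VanishesOff W f) (v : LocalModule ρ W) :
    localIncl ρ W (localRep ρ W f v) = ρ f (localIncl ρ W v) := by
  have hm : ρ f (localIncl ρ W v) ∈ localSpace ρ W :=
    Submodule.le_topologicalClosure _ (Submodule.subset_span ⟨f, hf, _, rfl⟩)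
  obtain ⟨z, hz⟩ : ∃ z : LocalModule ρ W, localIncl ρ W z = ρ f (localIncl ρ W v) :=
    ⟨(⟨_, hm⟩ : localSpace ρ W), rfl⟩
  suffices h : localRep ρ W f v = z by rw [h, hz]
  refine ext_inner_left ℂ fun x => ?_
  change inner ℂ x (adjoint (localIncl ρ W).toContinuousLinearMap (ρ f (localIncl ρ W v))) = _
  rw [adjoint_inner_right, ← hz]
  exact LinearIsometry.inner_map_map _ _ _

theorem localRep_mul {f g : C₀(Y, ℂ)} (hf : VanishesOff W f) (hg : VanishesOff W g) :
    localRep ρ W (f * g) = localRep ρ W f * localRep ρ W g := by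
  ext1 v
  refine (localIncl ρ W).injective ?_
  have hfg : VanishesOff W (f * g) := fun y hy => by simp [hf y hy]
  rw [localRep_apply_coe hfg]
  change _ = localIncl ρ W (localRep ρ W f (localRep ρ W g v))
  rw [localRep_apply_coe hf, localRep_apply_coe hg, map_mul]
  rfl

theorem localRep_add (f g : C₀(Y, ℂ)) :
    localRep ρ W (f + g) = localRep ρ W f + localRep ρ W g := by
  ext v
  simp [localRep, compress]

theorem vanishesOff_of_tsupport {f : C₀(Y, ℂ)} (hf : tsupport f ⊆ W) : VanishesOff W f :=
  fun _ hy => image_eq_zero_of_notMem_tsupport fun h => hy (hf h)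

/-- The closure of `ρ(C_c(W)) K` is all of `P_W K`. -/
theorem inner_eq_zero_of_compactSupport (π : NormalCovering Γ Y X) [T2Space X] [CompactSpace X]
    {w : K} (h : ∀ f : C₀(Y, ℂ), HasCompactSupport f → tsupport f ⊆ W → ∀ ξ, inner ℂ w (ρ f ξ) = 0)
    {v : K} (hv : v ∈ localSpace ρ W) : inner ℂ w v = 0 := by
  have := π.t2Space
  have := π.locallyCompactSpace
  have hcl : localSpace ρ W ≤ (ℂ ∙ w)ᗮ := by
    refine Submodule.topologicalClosure_minimal _ (Submodule.span_le.2 ?_)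
      (Submodule.isClosed_orthogonal _)
    rintro _ ⟨f, hf, ξ, rfl⟩
    rw [SetLike.mem_coe, Submodule.mem_orthogonal_singleton_iff_inner_right]
    -- approximate `f` by functions with compact support in `W`
    have key : ∀ ε : ℝ, 0 < ε → ‖inner ℂ w (ρ f ξ)‖ ≤ ‖w‖ * (ε * ‖ξ‖) := by
      intro ε hε
      have hfc : Continuous fun y => ‖f y‖ := by fun_prop
      have hK : IsCompact {y | ε ≤ ‖f y‖} := by
        have h1 := (f.zero_at_infty'.norm).eventually (gt_mem_nhds (show ‖(0 : ℂ)‖ < ε by simpa))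
        obtain ⟨C, hC, hCs⟩ := Filter.mem_cocompact.1 h1
        refine hC.of_isClosed_subset (isClosed_le continuous_const hfc) fun y hy => ?_
        by_contra hyC
        have h2 : ‖f y‖ < ε := hCs hyC
        exact absurd h2 (not_lt.2 hy)
      have hKW : {y | ε ≤ ‖f y‖} ⊆ W := fun y hy => by
        by_contra hyW
        have : ε ≤ ‖f y‖ := hy
        rw [hf y hyW, norm_zero] at this
        linarith
      obtain ⟨O, hO, hKO, hOW, hOc⟩ := exists_open_between_and_isCompact_closure hK W.2 hKW
      obtain ⟨χ, hχO, hχ1, hχ01⟩ :=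
        exists_tsupport_one_of_isOpen_isClosed hO hOc hK.isClosed hKO
      have hχc : HasCompactSupport χ :=
        hOc.of_isClosed_subset (isClosed_tsupport _) (hχO.trans subset_closure)
      have hgs : tsupport (fun y => (χ y : ℂ) * f y) ⊆ tsupport χ := by
        refine closure_mono fun y hy => ?_
        contrapose! hy
        have : χ y = 0 := by simpa using hy
        simp [this]
      have hgc : HasCompactSupport fun y => (χ y : ℂ) * f y :=
        hχc.of_isClosed_subset (isClosed_tsupport _) hgs
      let g : C₀(Y, ℂ) := ⟨⟨fun y => (χ y : ℂ) * f y, by fun_prop⟩,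
        hgc.is_zero_at_infty⟩
      have hg0 := h g hgc (hgs.trans (hχO.trans (subset_closure.trans hOW))) ξ
      have hfg : ‖f - g‖ ≤ ε := by
        refine (BoundedContinuousFunction.norm_le hε.le (f := (f - g).toBCF)).2 fun y => ?_
        change ‖f y - (χ y : ℂ) * f y‖ ≤ ε
        by_cases hy : ε ≤ ‖f y‖
        · have : χ y = 1 := hχ1 hy
          simp [this, hε.le]
        · have e : f y - (χ y : ℂ) * f y = ((1 - χ y : ℝ) : ℂ) * f y := by push_cast; ring
          have h01 := hχ01 y
          rw [e, norm_mul, Complex.norm_real, Real.norm_of_nonneg (by linarith [h01.2])]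
          nlinarith [norm_nonneg (f y), h01.1, h01.2]
      have e : inner ℂ w (ρ f ξ) = inner ℂ w (ρ (f - g) ξ) := by
        rw [map_sub, _root_.sub_apply, inner_sub_right, hg0, sub_zero]
      rw [e]
      refine (norm_inner_le_norm _ _).trans ?_
      gcongr
      refine (ContinuousLinearMap.le_opNorm _ _).trans ?_
      gcongr
      exact (NonUnitalStarAlgHom.norm_apply_le ρ _).trans hfg
    have lim : Tendsto (fun ε : ℝ => ‖w‖ * (ε * ‖ξ‖)) (𝓝[>] 0) (𝓝 0) := by
      have : Tendsto (fun ε : ℝ => ‖w‖ * (ε * ‖ξ‖)) (𝓝 0) (𝓝 (‖w‖ * (0 * ‖ξ‖))) :=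
        Continuous.tendsto (by fun_prop) 0
      simpa using this.mono_left nhdsWithin_le_nhds
    exact norm_le_zero_iff.1
      (ge_of_tendsto lim (eventually_nhdsWithin_of_forall fun ε hε => key ε hε))
  exact Submodule.mem_orthogonal_singleton_iff_inner_right.1 (hcl hv)

/-- If `⟪w, ρ(h) v⟫ = 0` for all `h ∈ C_c(W)` then `⟪w, v⟫ = 0`. -/
theorem inner_eq_zero_of_localRep (π : NormalCovering Γ Y X) [T2Space X] [CompactSpace X]
    {w v : LocalModule ρ W} (h : ∀ f : C₀(Y, ℂ), HasCompactSupport f → tsupport f ⊆ W →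
      inner ℂ w (localRep ρ W f v) = 0) : inner ℂ w v = 0 := by
  let N : Submodule ℂ K := (Submodule.span ℂ {x | ∃ f : C₀(Y, ℂ), HasCompactSupport f ∧
    tsupport f ⊆ W ∧ x = ρ f (localIncl ρ W v)}).topologicalClosure
  have hNc : CompleteSpace N := inferInstanceAs (CompleteSpace (Submodule.topologicalClosure _))
  have hgen : ∀ f : C₀(Y, ℂ), HasCompactSupport f → tsupport f ⊆ W → ρ f (localIncl ρ W v) ∈ N :=
    fun f hf hfW => Submodule.le_topologicalClosure _ (Submodule.subset_span ⟨f, hf, hfW, rfl⟩)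
  have hNW : N ≤ localSpace ρ W := by
    refine Submodule.topologicalClosure_minimal _ (Submodule.span_le.2 ?_)
      (Submodule.isClosed_topologicalClosure _)
    rintro _ ⟨f, hf, hfW, rfl⟩
    exact Submodule.le_topologicalClosure _
      (Submodule.subset_span ⟨f, vanishesOff_of_tsupport hfW, _, rfl⟩)
  have hNρ : ∀ g : C₀(Y, ℂ), ∀ x ∈ N, ρ g x ∈ N := by
    intro g
    have : N ≤ N.comap (ρ g).toLinearMap := by
      refine Submodule.topologicalClosure_minimal _ (Submodule.span_le.2 ?_)
        ((Submodule.isClosed_topologicalClosure _).preimage (ρ g).continuous)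
      rintro _ ⟨f, hf, hfW, rfl⟩
      have e : ρ (g * f) (localIncl ρ W v) = ρ g (ρ f (localIncl ρ W v)) := by rw [map_mul]; rfl
      have hs : tsupport (g * f : C₀(Y, ℂ)) ⊆ tsupport f := closure_mono fun y hy => by
        contrapose! hy
        have : f y = 0 := by simpa using hy
        simp [this]
      change ρ g (ρ f (localIncl ρ W v)) ∈ N
      rw [← e]
      exact hgen _ (hf.of_isClosed_subset (isClosed_tsupport _) hs) (hs.trans hfW)
    exact this
  have hNo : ∀ g : C₀(Y, ℂ), ∀ x ∈ Nᗮ, ρ g x ∈ Nᗮ := by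
    intro g x hx
    rw [Submodule.mem_orthogonal] at hx ⊢
    intro z hz
    have e : inner ℂ z (ρ g x) = inner ℂ (ρ (star g) z) x := by
      rw [map_star, ContinuousLinearMap.star_eq_adjoint, ContinuousLinearMap.adjoint_inner_left]
    rw [e]; exact hx _ (hNρ _ _ hz)
  obtain ⟨n, hn, m, hm, hv⟩ := N.exists_add_mem_mem_orthogonal (localIncl ρ W v)
  have hm0 : inner ℂ m m = 0 := by
    have hmW : m ∈ localSpace ρ W := by
      have : m = (localIncl ρ W v) - n := by rw [hv]; abel
      rw [this]; exact Submodule.sub_mem _ (localIncl_mem v) (hNW hn)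
    refine inner_eq_zero_of_compactSupport π (ρ := ρ) (W := W) (fun f hf hfW ξ => ?_) hmW
    have e : inner ℂ m (ρ f ξ) = inner ℂ (ρ (star f) m) ξ := by
      rw [map_star, ContinuousLinearMap.star_eq_adjoint, ContinuousLinearMap.adjoint_inner_left]
    have hs : tsupport (star f : C₀(Y, ℂ)) ⊆ tsupport f := closure_mono fun y hy => by
      contrapose! hy
      have : f y = 0 := by simpa using hy
      simp [this]
    have h1 : ρ (star f) m ∈ N := by
      have : ρ (star f) m = ρ (star f) (localIncl ρ W v) - ρ (star f) n := by rw [hv, map_add]; abel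
      rw [this]
      exact Submodule.sub_mem _ (hgen _ (hf.of_isClosed_subset (isClosed_tsupport _) hs)
        (hs.trans hfW)) (hNρ _ _ hn)
    have h2 : ρ (star f) m = 0 := by
      have := hNo (star f) m hm
      exact inner_self_eq_zero.1 (Submodule.inner_right_of_mem_orthogonal h1 this)
    rw [e, h2, inner_zero_left]
  rw [inner_self_eq_zero] at hm0
  rw [hm0, add_zero] at hv
  have hle : N ≤ (ℂ ∙ (localIncl ρ W w))ᗮ := by
    refine Submodule.topologicalClosure_minimal _ (Submodule.span_le.2 ?_)
      (Submodule.isClosed_orthogonal _)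
    rintro _ ⟨f, hf, hfW, rfl⟩
    rw [SetLike.mem_coe, Submodule.mem_orthogonal_singleton_iff_inner_right]
    have := h f hf hfW
    rwa [← (localIncl ρ W).inner_map_map, localRep_apply_coe (vanishesOff_of_tsupport hfW)] at this
  rw [← (localIncl ρ W).inner_map_map, hv]
  exact Submodule.mem_orthogonal_singleton_iff_inner_right.1 (hle hn)

theorem IsControlledOp.mul (π : NormalCovering Γ Y X) [T2Space X] [CompactSpace X]
    {T T' : LocalModule ρ W →L[ℂ] LocalModule ρ W} (hT : IsControlledOp Γ ρ W T)
    (hT' : IsControlledOp Γ ρ W T') : IsControlledOp Γ ρ W (T * T') := by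
  have := π.t2Space
  have := π.locallyCompactSpace
  obtain ⟨S, ⟨L, hL, hS⟩, h⟩ := hT
  obtain ⟨S', ⟨L', hL', hS'⟩, h'⟩ := hT'
  have hF := π.finite_meet hL' hL
  set F := {γ : Γ | ∃ a ∈ L', γ • a ∈ L} with hFdef
  let M : Set Y := L ∪ ⋃ γ ∈ F, (fun y => γ • y) '' L'
  have hM : IsCompact M := hL.union (hF.isCompact_biUnion fun γ _ => hL'.image (π.continuous_smul γ))
  refine ⟨{p | ∃ γ : Γ, ∃ a ∈ M, ∃ b ∈ M, p = (γ • a, γ • b)}, ⟨M, hM, fun p hp => hp⟩,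
    fun f g hf hfW hg hgW hd => ?_⟩
  -- the translates of `L` meeting the support of `f`, and of `L'` meeting the support of `g`
  let A : Set Y := ⋃ γ ∈ {γ : Γ | ∃ a ∈ L, γ • a ∈ tsupport f}, (fun y => γ • y) '' L
  let B : Set Y := ⋃ γ ∈ {γ : Γ | ∃ a ∈ L', γ • a ∈ tsupport g}, (fun y => γ • y) '' L'
  have hA : IsCompact A :=
    (π.finite_meet hL hf).isCompact_biUnion fun γ _ => hL.image (π.continuous_smul γ)
  have hB : IsCompact B :=
    (π.finite_meet hL' hg).isCompact_biUnion fun γ _ => hL'.image (π.continuous_smul γ)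
  have hAB : Disjoint A B := by
    rw [Set.disjoint_left]
    rintro y hyA hyB
    simp only [A, B, Set.mem_iUnion, Set.mem_ofPred_eq] at hyA hyB
    obtain ⟨γ, ⟨a, ha, haf⟩, l, hl, rfl⟩ := hyA
    obtain ⟨δ, ⟨b, hb, hbg⟩, l', hl', e⟩ := hyB
    have e' : δ • l' = γ • l := e
    refine Set.disjoint_left.1 hd (show (γ • a, δ • b) ∈ _ from ⟨haf, hbg⟩) ?_
    refine ⟨γ, a, Or.inl ha, (γ⁻¹ * δ) • b, Or.inr ?_, ?_⟩
    · refine Set.mem_biUnion (x := γ⁻¹ * δ) ⟨l', hl', ?_⟩ ⟨b, hb, rfl⟩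
      rwa [mul_smul, e', inv_smul_smul]
    · rw [mul_smul, smul_inv_smul]
  obtain ⟨O, hO, hAO, hOB, hOc⟩ := exists_open_between_and_isCompact_closure hA
    hB.isClosed.isOpen_compl (Set.disjoint_left.1 hAB)
  obtain ⟨O', hO', hAO', hOO', -⟩ := exists_open_between_and_isCompact_closure hA hO hAO
  obtain ⟨χ, hχO, hχ1, -⟩ :=
    exists_tsupport_one_of_isOpen_isClosed hO hOc isClosed_closure hOO'
  have hχc : HasCompactSupport χ :=
    hOc.of_isClosed_subset (isClosed_tsupport _) (hχO.trans subset_closure)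
  ext1 ξ
  refine ext_inner_left ℂ fun η => ?_
  have e : inner ℂ η ((localRep ρ W f * (T * T') * localRep ρ W g) ξ) =
      inner ℂ (adjoint (localRep ρ W f * T) η) ((T' * localRep ρ W g) ξ) := by
    rw [adjoint_inner_left]; rfl
  rw [e, zero_apply, inner_zero_right]
  refine inner_eq_zero_of_localRep π fun k hk hkW => ?_
  have hks : ∀ c : Y → ℂ, tsupport (fun y => c y * k y) ⊆ tsupport k := fun c =>
    closure_mono fun y hy => by
      contrapose! hy
      have : k y = 0 := by simpa using hy
      simp [this]
  have hkc : ∀ c : Y → ℂ, HasCompactSupport fun y => c y * k y := fun c =>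
    hk.of_isClosed_subset (isClosed_tsupport _) (hks c)
  let k₁ : C₀(Y, ℂ) := ⟨⟨fun y => (χ y : ℂ) * k y, by fun_prop⟩, (hkc _).is_zero_at_infty⟩
  let k₂ : C₀(Y, ℂ) := ⟨⟨fun y => (1 - χ y : ℂ) * k y, by fun_prop⟩, (hkc _).is_zero_at_infty⟩
  have hk12 : k = k₁ + k₂ := by
    ext y
    change k y = (χ y : ℂ) * k y + (1 - χ y : ℂ) * k y
    ring
  have h1 : localRep ρ W k₁ * T' * localRep ρ W g = 0 := by
    refine h' k₁ g (hkc _) ((hks _).trans hkW) hg hgW (Set.disjoint_left.2 ?_)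
    rintro ⟨y, z⟩ ⟨hy, hz⟩ hp
    obtain ⟨γ, a, ha, b, hb, e⟩ := hS' _ hp
    obtain ⟨rfl, rfl⟩ := Prod.mk.inj e
    have hyB : γ • a ∈ B := Set.mem_biUnion (x := γ) ⟨b, hb, hz⟩ ⟨a, ha, rfl⟩
    have hyO : γ • a ∈ O := hχO (closure_mono (fun x hx => by
      contrapose! hx
      have : χ x = 0 := by simpa using hx
      simp [k₁, this]) hy)
    exact hOB (subset_closure hyO) hyB
  have h2 : localRep ρ W f * T * localRep ρ W k₂ = 0 := by
    refine h f k₂ hf hfW (hkc _) ((hks _).trans hkW) (Set.disjoint_left.2 ?_)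
    rintro ⟨y, z⟩ ⟨hy, hz⟩ hp
    obtain ⟨γ, a, ha, b, hb, e⟩ := hS _ hp
    obtain ⟨rfl, rfl⟩ := Prod.mk.inj e
    have hzA : γ • b ∈ A := Set.mem_biUnion (x := γ) ⟨a, ha, hy⟩ ⟨b, hb, rfl⟩
    refine (mem_closure_iff.1 hz O' hO' (hAO' hzA)).elim fun x hx => hx.2 ?_
    have : χ x = 1 := hχ1 (subset_closure hx.1)
    simp [k₂, this]
  have h1' : inner ℂ (adjoint (localRep ρ W f * T) η)
      (localRep ρ W k₁ ((T' * localRep ρ W g) ξ)) = 0 := by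
    have : localRep ρ W k₁ ((T' * localRep ρ W g) ξ) = (localRep ρ W k₁ * T' * localRep ρ W g) ξ := rfl
    rw [this, h1, zero_apply, inner_zero_right]
  have h2' : inner ℂ (adjoint (localRep ρ W f * T) η)
      (localRep ρ W k₂ ((T' * localRep ρ W g) ξ)) = 0 := by
    rw [adjoint_inner_left]
    have : (localRep ρ W f * T) (localRep ρ W k₂ ((T' * localRep ρ W g) ξ)) =
      (localRep ρ W f * T * localRep ρ W k₂) ((T' * localRep ρ W g) ξ) := rfl
    rw [this, h2, zero_apply, inner_zero_right]
  rw [hk12, localRep_add, add_apply, inner_add_right, h1', h2', add_zero]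

theorem IsControlledOp.add
    {T T' : LocalModule ρ W →L[ℂ] LocalModule ρ W} (hT : IsControlledOp Γ ρ W T)
    (hT' : IsControlledOp Γ ρ W T') : IsControlledOp Γ ρ W (T + T') := by
  obtain ⟨S, hS, h⟩ := hT
  obtain ⟨S', hS', h'⟩ := hT'
  refine ⟨S ∪ S', hS.union hS', fun f g hf hfW hg hgW hd => ?_⟩
  rw [Set.disjoint_union_right] at hd
  rw [mul_add, add_mul, h f g hf hfW hg hgW hd.1, h' f g hf hfW hg hgW hd.2, add_zero]

theorem IsControlledOp.scalar (π : NormalCovering Γ Y X) [T2Space X] [CompactSpace X] (c : ℂ) :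
    IsControlledOp Γ ρ W (algebraMap ℂ (LocalModule ρ W →L[ℂ] LocalModule ρ W) c) := by
  obtain ⟨L, hL, hcov⟩ := π.exists_compact_cover
  refine ⟨{p | p.1 = p.2}, ⟨L, hL, ?_⟩, fun f g hf hfW hg hgW hd => ?_⟩
  · rintro ⟨y, z⟩ (rfl : y = z)
    obtain ⟨γ, a, ha, rfl⟩ := hcov y
    exact ⟨γ, a, ha, a, ha, rfl⟩
  · have hfg : f * g = 0 := by
      ext y
      by_contra hne
      have hne' : f y ≠ 0 ∧ g y ≠ 0 := by
        constructor <;> intro h0 <;> exact hne (by simp [h0])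
      exact Set.disjoint_left.1 hd (show (y, y) ∈ _ from
        ⟨subset_tsupport _ hne'.1, subset_tsupport _ hne'.2⟩) rfl
    rw [← Algebra.commutes, mul_assoc, ← localRep_mul (vanishesOff_of_tsupport hfW)
      (vanishesOff_of_tsupport hgW), hfg]
    have : localRep ρ W (0 : C₀(Y, ℂ)) = 0 := by ext v; simp [localRep, compress]
    rw [this, mul_zero]

theorem IsControlledOp.star {T : LocalModule ρ W →L[ℂ] LocalModule ρ W}
    (hT : IsControlledOp Γ ρ W T) : IsControlledOp Γ ρ W (star T) := by
  obtain ⟨S, ⟨L, hL, hS⟩, h⟩ := hT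
  have hst : ∀ f : C₀(Y, ℂ), tsupport (Star.star f : C₀(Y, ℂ)) = tsupport f := fun f => by
    simp only [tsupport]
    congr 1
    ext y
    simp
  refine ⟨Prod.swap ⁻¹' S, ⟨L, hL, fun p hp => ?_⟩, fun f g hf hfW hg hgW hd => ?_⟩
  · obtain ⟨γ, a, ha, b, hb, e⟩ := hS _ hp
    exact ⟨γ, b, hb, a, ha, by rw [← Prod.swap_swap p, e]; rfl⟩
  · have := h (Star.star g) (Star.star f) (by rw [HasCompactSupport, hst]; exact hg)
      (by rwa [hst]) (by rw [HasCompactSupport, hst]; exact hf) (by rwa [hst]) ?_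
    · have h2 : Star.star (localRep ρ W (Star.star g) * T * localRep ρ W (Star.star f)) =
          0 := by 
            rw [this]; exact star_zero (LocalModule ρ W →L[ℂ] LocalModule ρ W)
      rwa [star_mul, star_mul, localRep_star, localRep_star, star_star, star_star,
        ← mul_assoc] at h2
    · rw [hst, hst]
      refine Set.disjoint_left.2 fun p hp hpS => Set.disjoint_left.1 hd
        (show p.swap ∈ _ from ⟨hp.2, hp.1⟩) ?_
      simpa using hpS

variable (ρ W) [T2Space X] [CompactSpace X] (π : NormalCovering Γ Y X)
  (u : Γ →* unitary (K →L[ℂ] K))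

/-- The ⋆-algebra of controlled, pseudolocal, `Γ`-invariant operators on `P_W K`. (The covering is
an argument because it provides the properness of the action.) -/
def preAlgDΓ : StarSubalgebra ℂ (LocalModule ρ W →L[ℂ] LocalModule ρ W) where
  carrier := {T | IsControlledOp Γ ρ W T ∧ IsPseudolocal ρ W T ∧ IsInvariantOp ρ W u T}
  mul_mem' hS hT := ⟨hS.1.mul π hT.1, hS.2.1.mul hT.2.1, hS.2.2.mul hT.2.2⟩
  add_mem' hS hT := ⟨hS.1.add hT.1, hS.2.1.add hT.2.1, hS.2.2.add hT.2.2⟩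
  algebraMap_mem' c := ⟨.scalar π c, .scalar c, .scalar c⟩
  star_mem' hT := ⟨hT.1.star, hT.2.1.star, hT.2.2.star⟩

/-- The C⋆-algebra `𝔇_Γ(W)`, the norm closure of the controlled, pseudolocal, `Γ`-invariant
operators on `P_W K`. -/
def algDΓ : StarSubalgebra ℂ (LocalModule ρ W →L[ℂ] LocalModule ρ W) :=
  (preAlgDΓ ρ W π u).topologicalClosure

/-- The controlled, locally compact, `Γ`-invariant operators on `P_W K`. -/
def preIdealCΓ : Set (LocalModule ρ W →L[ℂ] LocalModule ρ W) :=
  {T | IsControlledOp Γ ρ W T ∧ IsLocallyCompactOp ρ W T ∧ IsInvariantOp ρ W u T}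

instance : IsClosed (algDΓ ρ W π u : Set (LocalModule ρ W →L[ℂ] LocalModule ρ W)) :=
  isClosed_closure

/-- The ideal `ℭ_Γ(W)` of `𝔇_Γ(W)`, the norm closure of the controlled, locally compact,
`Γ`-invariant operators on `P_W K`. -/
def idealCΓ : CStarIdeal (algDΓ ρ W π u) where
  toIdeal :=
    { carrier := {T | T.1 ∈ closure (preIdealCΓ (Γ := Γ) ρ W u)}
      add_mem' := fun {S T} hS hT => map_mem_closure₂ continuous_add hS hT
        fun S hS T hT => ⟨hS.1.add hT.1, hS.2.1.add hT.2.1, hS.2.2.add hT.2.2⟩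
      zero_mem' := subset_closure (by
        have h := IsControlledOp.scalar (ρ := ρ) (W := W) π 0
        have h' := IsInvariantOp.scalar (ρ := ρ) (W := W) (u := u) 0
        rw [map_zero] at h h'
        exact ⟨h, .zero, h'⟩)
      smul_mem' := fun S T hT => map_mem_closure₂ continuous_mul S.2 hT
        fun S hS T hT => ⟨hS.1.mul π hT.1, .mul_left hS.2.1 hT.2.1, hS.2.2.mul hT.2.2⟩ }
  mul_mem_right' := fun T hS => map_mem_closure₂ continuous_mul hS T.2
    fun S hS T hT => ⟨hS.1.mul π hT.1, .mul_right hS.2.1 hT.2.1, hS.2.2.mul hT.2.2⟩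
  star_mem' := fun {T} hT => map_mem_closure (f := Star.star) (x := T.1) continuous_star hT
    fun T hT => ⟨hT.1.star, hT.2.1.star, hT.2.2.star⟩
  isClosed' := isClosed_closure.preimage continuous_subtype_val

/-- The C⋆-algebra `𝔔_Γ(W) = 𝔇_Γ(W) / ℭ_Γ(W)`. -/
abbrev algQΓ : Type _ := (idealCΓ ρ W π u).Quot

end
end EquivariantModules

section Induction

open TopologicalSpace ContinuousLinearMap
open scoped ZeroAtInfty InnerProduct CompactlySupported BoundedContinuousFunction

namespace NormalCovering

variable {Γ Y X : Type*} [Group Γ] [TopologicalSpace Y] [TopologicalSpace X] [MulAction Γ Y]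

noncomputable section

/-- `x ↦ ∑_{π y = x} f y`, the sum over the fibres of the covering. -/
def fiberSum (π : NormalCovering Γ Y X) (f : Y → ℂ) (x : X) : ℂ :=
  ∑ᶠ y ∈ π.proj ⁻¹' {x}, f y

theorem fiberSum_proj (π : NormalCovering Γ Y X) (f : Y → ℂ) (y : Y) :
    π.fiberSum f (π.proj y) = ∑ᶠ γ : Γ, f (γ • y) := by
  have h : π.proj ⁻¹' {π.proj y} = Set.range fun γ : Γ => γ • y := by
    ext z
    exact π.isQuotientCoveringMap.apply_eq_iff_mem_orbit
  rw [fiberSum, h, finsum_mem_range]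
  exact fun γ δ h => π.smul_injective y h

variable [T2Space X]

theorem finite_support (π : NormalCovering Γ Y X) (f : C_c(Y, ℂ)) (y : Y) :
    (Function.support fun γ : Γ => f (γ • y)).Finite := by
  refine (π.finite_meet (isCompact_singleton (x := y)) f.hasCompactSupport).subset fun γ hγ => ?_
  exact ⟨y, rfl, subset_tsupport _ hγ⟩

theorem continuous_fiberSum [CompactSpace X] (π : NormalCovering Γ Y X) (f : C_c(Y, ℂ)) :
    Continuous (π.fiberSum f) := by
  have := π.locallyCompactSpace
  rw [π.isQuotientCoveringMap.isOpenQuotientMap.isQuotientMap.continuous_iff]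
  have e : π.fiberSum f ∘ π.proj = fun y => ∑ᶠ γ : Γ, f (γ • y) := funext (π.fiberSum_proj f)
  rw [e]
  refine continuous_finsum (fun γ => f.continuous.comp (π.continuous_smul γ)) fun y => ?_
  obtain ⟨L, hL, hy⟩ := exists_compact_mem_nhds y
  refine ⟨L, hy, (π.finite_meet hL f.hasCompactSupport).subset ?_⟩
  rintro γ ⟨z, hz, hzL⟩
  exact ⟨z, hzL, subset_tsupport _ hz⟩

variable [CompactSpace X]

/-- Summation over the fibres, as a map `C_c(Y) → C(X) = C₀(X)`. -/
def push (π : NormalCovering Γ Y X) : C_c(Y, ℂ) →ₗ[ℂ] C₀(X, ℂ) where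
  toFun f := ⟨⟨π.fiberSum f, π.continuous_fiberSum f⟩, by simp⟩
  map_add' f g := by
    ext x
    obtain ⟨y, rfl⟩ := π.isQuotientCoveringMap.surjective x
    change π.fiberSum _ _ = π.fiberSum _ _ + π.fiberSum _ _
    simp only [fiberSum_proj]
    exact finsum_add_distrib (π.finite_support f y) (π.finite_support g y)
  map_smul' c f := by
    ext x
    obtain ⟨y, rfl⟩ := π.isQuotientCoveringMap.surjective x
    change π.fiberSum _ _ = c • π.fiberSum _ _
    simp only [fiberSum_proj]
    exact (smul_finsum c _).symm

theorem push_apply (π : NormalCovering Γ Y X) (f : C_c(Y, ℂ)) (y : Y) :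
    π.push f (π.proj y) = ∑ᶠ γ : Γ, f (γ • y) := π.fiberSum_proj f y

theorem push_star (π : NormalCovering Γ Y X) (f : C_c(Y, ℂ)) : π.push (star f) = star (π.push f) := by
  ext x
  obtain ⟨y, rfl⟩ := π.isQuotientCoveringMap.surjective x
  change _ = star (π.push f (π.proj y))
  rw [push_apply, push_apply]
  exact ((starRingEnd ℂ : ℂ →+* ℂ).toAddMonoidHom.map_finsum (π.finite_support f y)).symm

theorem push_mul (π : NormalCovering Γ Y X) (f g : C_c(Y, ℂ)) {N : Set Y}
    (hN : ∀ γ : Γ, ∀ y ∈ N, γ • y ∈ N → γ = 1) (hf : ∀ y, y ∉ N → f y = 0)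
    (hg : ∀ y, y ∉ N → g y = 0) : π.push (f * g) = π.push f * π.push g := by
  ext x
  obtain ⟨y, rfl⟩ := π.isQuotientCoveringMap.surjective x
  change _ = π.push f (π.proj y) * π.push g (π.proj y)
  simp only [push_apply]
  by_cases h : ∃ γ₀ : Γ, γ₀ • y ∈ N
  · obtain ⟨γ₀, h₀⟩ := h
    have key : ∀ γ, γ ≠ γ₀ → γ • y ∉ N := fun γ hγ hy => by
      refine hγ (mul_inv_eq_one.1 (hN (γ * γ₀⁻¹) (γ₀ • y) h₀ ?_))
      rwa [mul_smul, inv_smul_smul]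
    rw [finsum_eq_single _ γ₀ fun γ hγ => hf _ (key γ hγ),
      finsum_eq_single _ γ₀ fun γ hγ => hg _ (key γ hγ),
      finsum_eq_single _ γ₀ fun γ hγ => by
        rw [CompactlySupportedContinuousMap.mul_apply, hf _ (key γ hγ), zero_mul]]
    rfl
  · push Not at h
    simp [hf _ (h _)]

/-- The action of `Γ` on `C_c(Y)`. -/
def translate (π : NormalCovering Γ Y X) (γ : Γ) (f : C_c(Y, ℂ)) : C_c(Y, ℂ) where
  toFun y := f (γ⁻¹ • y)
  continuous_toFun := f.continuous.comp (π.continuous_smul γ⁻¹)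
  hasCompactSupport' := by
    have := π.isQuotientCoveringMap.toContinuousConstSMul
    exact f.hasCompactSupport.comp_homeomorph (Homeomorph.smul γ⁻¹)

theorem push_translate (π : NormalCovering Γ Y X) (γ : Γ) (f : C_c(Y, ℂ)) :
    π.push (π.translate γ f) = π.push f := by
  ext x
  obtain ⟨y, rfl⟩ := π.isQuotientCoveringMap.surjective x
  simp only [push_apply]
  refine finsum_eq_of_bijective (fun δ => γ⁻¹ * δ) (Group.mulLeft_bijective γ⁻¹) fun δ => ?_
  change f (γ⁻¹ • δ • y) = _
  rw [mul_smul]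

variable {H : Type*} [NormedAddCommGroup H] [InnerProductSpace ℂ H] [CompleteSpace H]

/-- The kernel `(f, f') ↦ ρ(p(f⋆ f'))`, where `p` is summation over the fibres. -/
def kernel (π : NormalCovering Γ Y X) (ρ : C₀(X, ℂ) →⋆ₙₐ[ℂ] (H →L[ℂ] H)) :
    Matrix C_c(Y, ℂ) C_c(Y, ℂ) (H →L[ℂ] H) :=
  .of fun f f' => ρ (π.push (star f * f'))

/-- The product of a continuous function and a compactly supported function. -/
def bmul (g : C(Y, ℂ)) (f : C_c(Y, ℂ)) : C_c(Y, ℂ) where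
  toFun y := g y * f y
  continuous_toFun := by fun_prop
  hasCompactSupport' := f.hasCompactSupport.mul_left

instance kernel_posSemidef (π : NormalCovering Γ Y X) (ρ : C₀(X, ℂ) →⋆ₙₐ[ℂ] (H →L[ℂ] H)) :
    Fact (π.kernel ρ).PosSemidef := by
  have := π.t2Space
  have := π.locallyCompactSpace
  refine ⟨((RKHS.posSemidef_tfae (K := π.kernel ρ)).out 0 2).2 (And.intro ?_ fun vv => ?_)⟩
  · ext1 f g
    simp only [Matrix.conjTranspose_apply, kernel, Matrix.of_apply]
    rw [← map_star ρ, ← push_star]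
    congr 2
    ext y
    simp [mul_comm]
  -- a partition of unity on the union of the supports
  have hL : IsCompact (⋃ f ∈ vv.support, tsupport f) :=
    vv.support.finite_toSet.isCompact_biUnion fun f _ => f.hasCompactSupport
  have hN : ∀ y : Y, ∃ N : Set Y, IsOpen N ∧ y ∈ N ∧
      ∀ γ : Γ, ∀ z ∈ N, γ • z ∈ N → γ = 1 := fun y => by
    obtain ⟨N, hN, hd⟩ := π.isQuotientCoveringMap.disjoint y
    obtain ⟨N', hN', ho, hy⟩ := mem_nhds_iff.1 hN
    exact ⟨N', ho, hy, fun γ z hz hγ => hd γ ⟨γ • z, ⟨z, hN' hz, rfl⟩, hN' hγ⟩⟩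
  choose N hNo hyN hNd using hN
  obtain ⟨t, ht⟩ := hL.elim_finite_subcover N hNo
    fun y _ => Set.mem_iUnion.2 ⟨y, hyN y⟩
  let s : Fin t.card → Set Y := fun i => N (t.equivFin.symm i)
  have hst : (⋃ f ∈ vv.support, tsupport f) ⊆ ⋃ i, s i := fun y hy => by
    obtain ⟨i, hi, hyi⟩ := Set.mem_iUnion₂.1 (ht hy)
    exact Set.mem_iUnion.2 ⟨t.equivFin ⟨i, hi⟩, by simpa [s] using hyi⟩
  obtain ⟨θ, hθs, hθ1, hθ01, -⟩ :=
    exists_continuous_sum_one_of_isOpen_isCompact (fun i => hNo (t.equivFin.symm i)) hL hst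
  let r : Fin t.card → C(Y, ℂ) := fun i => ⟨fun y => (Real.sqrt (θ i y) : ℂ), by fun_prop⟩
  have hr : ∀ i y, r i y * r i y = (θ i y : ℂ) := fun i y => by
    change (Real.sqrt (θ i y) : ℂ) * (Real.sqrt (θ i y) : ℂ) = _
    rw [← Complex.ofReal_mul, Real.mul_self_sqrt (hθ01 i y).1]
  have hrs : ∀ i y, star (r i y) = r i y := fun i y => Complex.conj_ofReal _
  have hr0 : ∀ i y, y ∉ s i → r i y = 0 := fun i y hy => by
    have : θ i y = 0 := image_eq_zero_of_notMem_tsupport fun h => hy (hθs i h)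
    change (Real.sqrt (θ i y) : ℂ) = 0
    rw [this]; simp
  -- the kernel on the support of `vv`
  have hK : ∀ f ∈ vv.support, ∀ g ∈ vv.support, π.kernel ρ g f =
      ∑ i, adjoint (ρ (π.push (bmul (r i) g))) ∘L ρ (π.push (bmul (r i) f)) := by
    intro f hf g _
    have e : star g * f = ∑ i, star (bmul (r i) g) * bmul (r i) f := by
      ext y
      rw [CompactlySupportedContinuousMap.sum_apply]
      have : ∀ i, (star (bmul (r i) g) * bmul (r i) f) y = (θ i y : ℂ) * (star (g y) * f y) := by
        intro i
        change star (r i y * g y) * (r i y * f y) = _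
        rw [star_mul, hrs, ← hr i y]; ring
      simp only [this, ← Finset.sum_mul]
      change star (g y) * f y = _
      by_cases hy : f y = 0
      · simp [hy]
      · have h1 := hθ1 (Set.mem_biUnion (x := f) hf (subset_tsupport _ hy))
        have h2 : ∑ i, (θ i y : ℂ) = 1 := by
          rw [← Complex.ofReal_sum]
          exact congrArg _ (by simpa using h1)
        rw [h2, one_mul]
    change ρ (π.push (star g * f)) = _
    rw [e, map_sum, map_sum]
    refine Finset.sum_congr rfl fun i _ => ?_
    rw [π.push_mul (N := s i) _ _ (fun γ z hz hγ => hNd _ γ z hz hγ), push_star, map_mul, map_star]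
    · rfl
    · intro y hy
      change star (r i y * g y) = 0
      rw [hr0 i y hy]; simp
    · intro y hy
      change r i y * f y = 0
      rw [hr0 i y hy]; simp
  have e : (vv.sum fun x w => vv.sum fun x' w' => inner ℂ (π.kernel ρ x' x w) w') =
      ∑ i, inner ℂ (∑ x ∈ vv.support, ρ (π.push (bmul (r i) x)) (vv x))
        (∑ x ∈ vv.support, ρ (π.push (bmul (r i) x)) (vv x)) := by
    simp only [Finsupp.sum, sum_inner, inner_sum]
    simp_rw [Finset.sum_comm (s := Finset.univ) (t := vv.support)]
    rw [Finset.sum_comm]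
    refine Finset.sum_congr rfl fun g hg => Finset.sum_congr rfl fun f hf => ?_
    rw [hK f hf g hg, _root_.sum_apply, sum_inner]
    refine Finset.sum_congr rfl fun i _ => ?_
    rw [ContinuousLinearMap.comp_apply, adjoint_inner_left]
  rw [e, map_sum]
  exact Finset.sum_nonneg fun i _ => inner_self_nonneg

end
end NormalCovering

end Induction

section InducedModules

open TopologicalSpace ContinuousLinearMap
open scoped ZeroAtInfty InnerProduct CompactlySupported BoundedContinuousFunction

/-- An inequality of Gram matrices gives a norm inequality for linear combinations. -/
theorem norm_linearCombination_le_of_gram {ι E : Type*} [NormedAddCommGroup E]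
    [InnerProductSpace ℂ E] (s s' t : ι → E) {C : ℝ} (hC : 0 ≤ C)
    (h : ∀ i j, (C : ℂ) ^ 2 * inner ℂ (t i) (t j) = inner ℂ (s i) (s j) + inner ℂ (s' i) (s' j))
    (c : ι →₀ ℂ) :
    ‖Finsupp.linearCombination ℂ s c‖ ≤ C * ‖Finsupp.linearCombination ℂ t c‖ := by
  have key : (C : ℂ) ^ 2 * inner ℂ (Finsupp.linearCombination ℂ t c)
      (Finsupp.linearCombination ℂ t c) =
      inner ℂ (Finsupp.linearCombination ℂ s c) (Finsupp.linearCombination ℂ s c) +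
      inner ℂ (Finsupp.linearCombination ℂ s' c) (Finsupp.linearCombination ℂ s' c) := by
    simp only [Finsupp.linearCombination_apply, Finsupp.sum, sum_inner, inner_sum, inner_smul_left,
      inner_smul_right, Finset.mul_sum, ← Finset.sum_add_distrib]
    refine Finset.sum_congr rfl fun i _ => Finset.sum_congr rfl fun j _ => ?_
    linear_combination (starRingEnd ℂ (c j) * c i) * h j i
  simp only [inner_self_eq_norm_sq_to_K] at key
  have key' : C ^ 2 * ‖Finsupp.linearCombination ℂ t c‖ ^ 2 =
      ‖Finsupp.linearCombination ℂ s c‖ ^ 2 + ‖Finsupp.linearCombination ℂ s' c‖ ^ 2 := by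
    apply Complex.ofReal_injective
    push_cast
    simpa using key
  refine le_of_sq_le_sq ?_ (by positivity)
  rw [mul_pow, key']
  linarith [sq_nonneg ‖Finsupp.linearCombination ℂ s' c‖]

namespace NormalCovering

variable {Γ Y X : Type*} [Group Γ] [TopologicalSpace Y] [TopologicalSpace X] [MulAction Γ Y]
  [T2Space X] [CompactSpace X]
  {H : Type*} [NormedAddCommGroup H] [InnerProductSpace ℂ H] [CompleteSpace H]

noncomputable section

/-- The `Y`-module induced from the `X`-module `H`: the completion of the algebraic tensor product
`C_c(Y) ⊗ H` for the inner product `⟪f ⊗ h, f' ⊗ h'⟫ = ⟪h, ρ(p(f⋆ f')) h'⟫`, where `p` is summation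
over the fibres. This is the interior tensor product `E ⊗_{C(X)} H` in which `E` is the completion
of `C_c(Y)` for the `C(X)`-valued inner product `p(f⋆ f')`, that is, the module of continuous
sections of the bundle over `X` with fibres `ℓ²(π⁻¹(x))`. -/
def InducedModule (π : NormalCovering Γ Y X) (ρ : C₀(X, ℂ) →⋆ₙₐ[ℂ] (H →L[ℂ] H)) : Type _ :=
  RKHS.OfKernel (π.kernel ρ)

variable (π : NormalCovering Γ Y X) (ρ : C₀(X, ℂ) →⋆ₙₐ[ℂ] (H →L[ℂ] H))

instance : NormedAddCommGroup (π.InducedModule ρ) :=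
  inferInstanceAs (NormedAddCommGroup (RKHS.OfKernel (π.kernel ρ)))

instance : InnerProductSpace ℂ (π.InducedModule ρ) :=
  inferInstanceAs (InnerProductSpace ℂ (RKHS.OfKernel (π.kernel ρ)))

instance : CompleteSpace (π.InducedModule ρ) :=
  inferInstanceAs (CompleteSpace (RKHS.OfKernel (π.kernel ρ)))

/-- The elementary tensor `f ⊗ h`. -/
def tensor (f : C_c(Y, ℂ)) : H →L[ℂ] π.InducedModule ρ :=
  RKHS.kerFun (RKHS.OfKernel (π.kernel ρ)) f

theorem inner_tensor (f f' : C_c(Y, ℂ)) (h h' : H) :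
    inner ℂ (π.tensor ρ f h) (π.tensor ρ f' h') = inner ℂ h (ρ (π.push (star f * f')) h') := by
  have := RKHS.kernel_inner (RKHS.OfKernel (π.kernel ρ)) f' f h h'
  rw [RKHS.OfKernel.kernel_ofKernel] at this
  refine this.symm.trans ?_
  change inner ℂ (ρ (π.push (star f' * f)) h) h' = _
  rw [← adjoint_inner_right, ← star_eq_adjoint, ← map_star, ← push_star]
  congr 5
  ext y
  simp [mul_comm]

theorem tensor_dense :
    (Submodule.span ℂ {v | ∃ f h, π.tensor ρ f h = v}).topologicalClosure = ⊤ :=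
  RKHS.kerFun_dense (RKHS.OfKernel (π.kernel ρ))

theorem ext_tensor {S T : π.InducedModule ρ →L[ℂ] π.InducedModule ρ}
    (h : ∀ f v, S (π.tensor ρ f v) = T (π.tensor ρ f v)) : S = T := by
  refine ContinuousLinearMap.ext_on
    (Submodule.dense_iff_topologicalClosure_eq_top.2 (π.tensor_dense ρ)) ?_
  rintro _ ⟨f, v, rfl⟩
  exact h f v

theorem ext_inner_tensor {v w : π.InducedModule ρ}
    (h : ∀ f x, inner ℂ (π.tensor ρ f x) v = inner ℂ (π.tensor ρ f x) w) : v = w := by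
  have hd := Submodule.dense_iff_topologicalClosure_eq_top.2 (π.tensor_dense ρ)
  have : innerSL ℂ v = innerSL ℂ w := by
    refine ContinuousLinearMap.ext_on hd ?_
    rintro _ ⟨f, x, rfl⟩
    simp only [innerSL_apply_apply]
    rw [← inner_conj_symm, h, inner_conj_symm]
  exact ext_inner_right ℂ fun z => by simpa using congrArg (fun l => l z) this

theorem tensor_add (f g : C_c(Y, ℂ)) : π.tensor ρ (f + g) = π.tensor ρ f + π.tensor ρ g := by
  ext1 h
  refine π.ext_inner_tensor ρ fun k x => ?_
  simp only [_root_.add_apply, inner_add_right, inner_tensor, mul_add, map_add]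

theorem tensor_smul (c : ℂ) (f : C_c(Y, ℂ)) : π.tensor ρ (c • f) = c • π.tensor ρ f := by
  ext1 h
  refine π.ext_inner_tensor ρ fun k x => ?_
  simp only [_root_.smul_apply, inner_smul_right, inner_tensor, mul_smul_comm, map_smul]

/-- The operator taking `f ⊗ h` to `s (f, h)`, if there is one. -/
def extendTensor (s : C_c(Y, ℂ) × H → π.InducedModule ρ) :
    π.InducedModule ρ →L[ℂ] π.InducedModule ρ :=
  (Finsupp.linearCombination ℂ s).extendOfNorm
    (Finsupp.linearCombination ℂ fun i : C_c(Y, ℂ) × H => π.tensor ρ i.1 i.2)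

theorem extendTensor_tensor (s s' : C_c(Y, ℂ) × H → π.InducedModule ρ) {C : ℝ} (hC : 0 ≤ C)
    (h : ∀ i j, (C : ℂ) ^ 2 * inner ℂ (π.tensor ρ i.1 i.2) (π.tensor ρ j.1 j.2) =
      inner ℂ (s i) (s j) + inner ℂ (s' i) (s' j)) (f : C_c(Y, ℂ)) (v : H) :
    π.extendTensor ρ s (π.tensor ρ f v) = s (f, v) := by
  have hd : DenseRange (Finsupp.linearCombination ℂ
      fun i : C_c(Y, ℂ) × H => π.tensor ρ i.1 i.2) := by
    have := Submodule.dense_iff_topologicalClosure_eq_top.2 (π.tensor_dense ρ)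
    have e : {v | ∃ f h, π.tensor ρ f h = v} =
        Set.range fun i : C_c(Y, ℂ) × H => π.tensor ρ i.1 i.2 := by
      ext v; simp
    rw [e, ← Finsupp.range_linearCombination] at this
    exact this
  have := LinearMap.extendOfNorm_eq hd ⟨C, fun c =>
    norm_linearCombination_le_of_gram s s' _ hC h c⟩ (Finsupp.single (f, v) 1)
  simpa [extendTensor] using this

/-- Multiplication by a bounded continuous function on the induced module: `g (f ⊗ h) = gf ⊗ h`. -/
def inducedMul (g : Y →ᵇ ℂ) : π.InducedModule ρ →L[ℂ] π.InducedModule ρ :=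
  π.extendTensor ρ fun i => π.tensor ρ (bmul g i.1) i.2

theorem inducedMul_tensor (g : Y →ᵇ ℂ) (f : C_c(Y, ℂ)) (h : H) :
    π.inducedMul ρ g (π.tensor ρ f h) = π.tensor ρ (bmul g f) h := by
  let k : C(Y, ℂ) := ⟨fun y => (Real.sqrt (‖g‖ ^ 2 - ‖g y‖ ^ 2) : ℂ), by fun_prop⟩
  refine π.extendTensor_tensor ρ _ (fun i => π.tensor ρ (bmul k i.1) i.2) (norm_nonneg g) ?_ f h
  rintro ⟨f, h⟩ ⟨f', h'⟩
  simp only [inner_tensor]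
  rw [← inner_add_right, ← _root_.add_apply, ← map_add, ← map_add]
  have e : star (bmul (g : C(Y, ℂ)) f) * bmul (g : C(Y, ℂ)) f' + star (bmul k f) * bmul k f' =
      ((‖g‖ : ℂ) ^ 2) • (star f * f') := by
    ext y
    have hk : star (k y) * k y = (‖g‖ : ℂ) ^ 2 - star (g y) * g y := by
      have h1 : star (k y) = k y := Complex.conj_ofReal _
      have h2 : k y * k y = ((‖g‖ ^ 2 - ‖g y‖ ^ 2 : ℝ) : ℂ) := by
        change (Real.sqrt _ : ℂ) * (Real.sqrt _ : ℂ) = _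
        rw [← Complex.ofReal_mul, Real.mul_self_sqrt]
        have := g.norm_coe_le_norm y
        nlinarith [norm_nonneg (g y)]
      have h3 : star (g y) * g y = ((‖g y‖ ^ 2 : ℝ) : ℂ) := by
        have := Complex.conj_mul' (g y)
        push_cast
        exact this
      rw [h1, h2, h3]; push_cast; ring
    change star (g y * f y) * (g y * f' y) + star (k y * f y) * (k y * f' y) =
      (‖g‖ : ℂ) ^ 2 * (star (f y) * f' y)
    rw [star_mul, star_mul]
    linear_combination (star (f y) * f' y) * hk
  rw [e, map_smul, map_smul, _root_.smul_apply, inner_smul_right]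

/-- The representation of `C₀(Y)` on the induced module. -/
def inducedRep : C₀(Y, ℂ) →⋆ₙₐ[ℂ] (π.InducedModule ρ →L[ℂ] π.InducedModule ρ) where
  toFun g := π.inducedMul ρ g.toBCF
  map_smul' c g := π.ext_tensor ρ fun f h => by
    change _ = c • π.inducedMul ρ g.toBCF (π.tensor ρ f h)
    rw [inducedMul_tensor, inducedMul_tensor, ← _root_.smul_apply, ← tensor_smul]
    congr 2
    ext y
    exact mul_assoc c (g y) (f y)
  map_zero' := π.ext_tensor ρ fun f h => by
    rw [inducedMul_tensor]
    have : bmul ((0 : C₀(Y, ℂ)).toBCF : C(Y, ℂ)) f = (0 : ℂ) • f := by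
      ext y
      change (0 : ℂ) * f y = 0 * f y
      rfl
    rw [this, tensor_smul, zero_smul]
    rfl
  map_add' g g' := π.ext_tensor ρ fun f h => by
    change _ = π.inducedMul ρ g.toBCF (π.tensor ρ f h) + π.inducedMul ρ g'.toBCF (π.tensor ρ f h)
    rw [inducedMul_tensor, inducedMul_tensor, inducedMul_tensor, ← _root_.add_apply, ← tensor_add]
    congr 2
    ext y
    exact add_mul (g y) (g' y) (f y)
  map_mul' g g' := π.ext_tensor ρ fun f h => by
    change _ = π.inducedMul ρ g.toBCF (π.inducedMul ρ g'.toBCF (π.tensor ρ f h))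
    rw [inducedMul_tensor, inducedMul_tensor, inducedMul_tensor]
    congr 2
    ext y
    exact mul_assoc (g y) (g' y) (f y)
  map_star' g := π.ext_tensor ρ fun f h => π.ext_inner_tensor ρ fun f' h' => by
    rw [star_eq_adjoint, adjoint_inner_right, inducedMul_tensor, inducedMul_tensor, inner_tensor,
      inner_tensor]
    congr 4
    ext y
    change star (f' y) * (star (g y) * f y) = star (g y * f' y) * f y
    rw [star_mul]; ring

theorem inducedRep_tensor (g : C₀(Y, ℂ)) (f : C_c(Y, ℂ)) (h : H) :
    π.inducedRep ρ g (π.tensor ρ f h) = π.tensor ρ (bmul g f) h :=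
  π.inducedMul_tensor ρ _ f h

/-- Translation by `γ` on the induced module: `γ (f ⊗ h) = γf ⊗ h`. -/
def inducedTranslation (γ : Γ) : π.InducedModule ρ →L[ℂ] π.InducedModule ρ :=
  π.extendTensor ρ fun i => π.tensor ρ (π.translate γ i.1) i.2

theorem inner_translate (γ : Γ) (f f' : C_c(Y, ℂ)) (h h' : H) :
    inner ℂ (π.tensor ρ (π.translate γ f) h) (π.tensor ρ (π.translate γ f') h') =
      inner ℂ (π.tensor ρ f h) (π.tensor ρ f' h') := by
  rw [inner_tensor, inner_tensor, ← π.push_translate γ (star f * f')]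
  rfl

theorem inducedTranslation_tensor (γ : Γ) (f : C_c(Y, ℂ)) (h : H) :
    π.inducedTranslation ρ γ (π.tensor ρ f h) = π.tensor ρ (π.translate γ f) h := by
  refine π.extendTensor_tensor ρ _ (fun _ => 0) zero_le_one ?_ f h
  rintro ⟨f, h⟩ ⟨f', h'⟩
  simp [inner_translate]

theorem inducedTranslation_mul (γ δ : Γ) :
    π.inducedTranslation ρ (γ * δ) = π.inducedTranslation ρ γ * π.inducedTranslation ρ δ :=
  π.ext_tensor ρ fun f h => by
    change _ = π.inducedTranslation ρ γ (π.inducedTranslation ρ δ (π.tensor ρ f h))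
    rw [inducedTranslation_tensor, inducedTranslation_tensor, inducedTranslation_tensor]
    congr 2
    ext y
    change f ((γ * δ)⁻¹ • y) = f (δ⁻¹ • γ⁻¹ • y)
    rw [mul_inv_rev, mul_smul]

theorem inducedTranslation_one : π.inducedTranslation ρ 1 = 1 :=
  π.ext_tensor ρ fun f h => by
    rw [inducedTranslation_tensor]
    change _ = π.tensor ρ f h
    congr 2
    ext y
    change f ((1 : Γ)⁻¹ • y) = f y
    rw [inv_one, one_smul]

theorem inducedTranslation_star (γ : Γ) :
    star (π.inducedTranslation ρ γ) = π.inducedTranslation ρ γ⁻¹ :=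
  π.ext_tensor ρ fun f h => π.ext_inner_tensor ρ fun f' h' => by
    rw [star_eq_adjoint, adjoint_inner_right, inducedTranslation_tensor, inducedTranslation_tensor]
    rw [← π.inner_translate ρ γ⁻¹ (π.translate γ f')]
    congr 3
    ext y
    change f' (γ⁻¹ • γ⁻¹⁻¹ • y) = f' y
    rw [inv_inv, inv_smul_smul]

/-- The unitary representation of `Γ` on the induced module. -/
def inducedAction : Γ →* unitary (π.InducedModule ρ →L[ℂ] π.InducedModule ρ) where
  toFun γ := ⟨π.inducedTranslation ρ γ, by
    rw [Unitary.mem_iff, inducedTranslation_star, ← inducedTranslation_mul,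
      ← inducedTranslation_mul, inv_mul_cancel, mul_inv_cancel, inducedTranslation_one]
    exact ⟨rfl, rfl⟩⟩
  map_one' := Subtype.ext (π.inducedTranslation_one ρ)
  map_mul' γ δ := Subtype.ext (π.inducedTranslation_mul ρ γ δ)

theorem inducedAction_tensor (γ : Γ) (f : C_c(Y, ℂ)) (h : H) :
    (π.inducedAction ρ γ : π.InducedModule ρ →L[ℂ] π.InducedModule ρ) (π.tensor ρ f h) =
      π.tensor ρ (π.translate γ f) h :=
  π.inducedTranslation_tensor ρ γ f h

end
end NormalCovering

end InducedModules

section SymbolSheaves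

open TopologicalSpace ContinuousLinearMap
open scoped ZeroAtInfty CompactlySupported BoundedContinuousFunction

namespace NormalCovering

variable {Γ Y X : Type*} [Group Γ] [TopologicalSpace Y] [TopologicalSpace X] [MulAction Γ Y]
  [T2Space X] [CompactSpace X]
  {H : Type*} [NormedAddCommGroup H] [InnerProductSpace ℂ H] [CompleteSpace H]
  (π : NormalCovering Γ Y X) (ρ : C₀(X, ℂ) →⋆ₙₐ[ℂ] (H →L[ℂ] H)) (U : Opens X)

noncomputable section

/-- The Hilbert space `P_U H̃`, where `H̃` is the induced module; it is the `π⁻¹(U)`-module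
`P_{π⁻¹(U)} H̃`. -/
abbrev LocalInduced : Type _ := LocalModule (π.inducedRep ρ) (π.preimage U)

/-- The C⋆-algebra `𝔇_Γ(U)` of operators on `P_U H̃`. -/
abbrev 𝔇Γ : StarSubalgebra ℂ (π.LocalInduced ρ U →L[ℂ] π.LocalInduced ρ U) :=
  algDΓ (π.inducedRep ρ) (π.preimage U) π (π.inducedAction ρ)

/-- The ideal `ℭ_Γ(U)` of `𝔇_Γ(U)`. -/
abbrev ℭΓ : CStarIdeal (π.𝔇Γ ρ U) :=
  idealCΓ (π.inducedRep ρ) (π.preimage U) π (π.inducedAction ρ)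

/-- The C⋆-algebra `𝔔_Γ(U) = 𝔇_Γ(U) / ℭ_Γ(U)`. -/
abbrev 𝔔Γ : Type _ := (π.ℭΓ ρ U).Quot

variable {ρ U}

/-- `T` is the operator of multiplication by `f ∘ π` on `P_U H̃`, for `f ∈ C_b(U)`: one has
`T ρ(g) = ρ((f ∘ π) g)` for `g ∈ C₀(π⁻¹(U))`. -/
def IsMultiplication (f : U →ᵇ ℂ) (T : π.LocalInduced ρ U →L[ℂ] π.LocalInduced ρ U) : Prop :=
  ∀ g g' : C₀(Y, ℂ), VanishesOff (π.preimage U) g → VanishesOff (π.preimage U) g' →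
    (∀ (y : Y) (hy : π.proj y ∈ U), g' y = f ⟨π.proj y, hy⟩ * g y) →
    T * localRep (π.inducedRep ρ) (π.preimage U) g = localRep (π.inducedRep ρ) (π.preimage U) g'

/-- `V` is the isometry `P_U H → P_U H̃` determined by a continuous section `s` of the covering over
`U`. It takes `ρ(a) h`, where `a ∈ C₀(U)`, to `(a ∘ s⁻¹) ⊗ h`, where `a ∘ s⁻¹` is extended by zero,
if this function has compact support. In a trivialization `π⁻¹(U) ≅ U × Γ` in which `s` is the
section `u ↦ (u, γ)`, it is the inclusion of `P_U H` in `P_U H̃ ≅ P_U H ⊗ ℓ²(Γ)` as the summand of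
index `γ`, so that `V⋆ T V` is the diagonal matrix entry `T_{γγ}` of an operator `T` on `P_U H̃`. -/
def IsSectionIsometry (s : C(U, Y)) (V : LocalModule ρ U →ₗᵢ[ℂ] π.LocalInduced ρ U) : Prop :=
  ∀ (a : C₀(X, ℂ)) (f : C_c(Y, ℂ)) (h : H) (v : LocalModule ρ U), VanishesOff U a →
    (∀ u : U, f (s u) = a u) → (∀ y, y ∉ Set.range s → f y = 0) →
    localIncl ρ U v = ρ a h →
    localIncl (π.inducedRep ρ) (π.preimage U) (V v) = π.tensor ρ f h

end
end NormalCovering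

end SymbolSheaves

/-! The isomorphism comes from a relation between operators on the two modules. For f ∈ C_c(X̃) let
t_f : H → H̃ be the map h ↦ f ⊗ h (`tensor`), so that t_f⋆ t_g = ρ(p(f̄ g)). An operator R on H̃ is
a lift of an operator S on H over U (`IsLift`) if t_f⋆ R t_g and ρ(p(f̄ g)) S differ by a compact
operator for all f, g ∈ C_c(π⁻¹(U)). For pseudolocal operators this relation respects differences,
products (`IsLift.comp`) and restriction, and R is locally compact over U exactly when S is
(`IsLift.locCompactOn`, `IsLift.locCompactOn_lift`). Modulo locally compact operators each of R and
S therefore determines the other.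

Partners exist because of a frame (`CoveringFrame`): finitely many f_k ∈ C_c(X̃), each living on a
set disjoint from its translates, with ∑ p(|f_k|²) = 1. For their translates e_i one has ∑ |e_i|² =
1, and t_{e_i} t_{e_i}⋆ is multiplication by |e_i|². Hence φ(S) = ∑ t_{e_i} S t_{e_i}⋆ converges
weakly; it is invariant, controlled, and a lift of S where S is pseudolocal (`phi`, `phi_isLift`).
Conversely, an invariant pseudolocal R is a lift of ψ(R) = ∑ t_{f_k}⋆ R t_{f_k} (`psi`,
`isLift_psi`).

Both 𝔇_Γ(U) and ℭ_Γ(U) are norm closures, so it has to be shown that a locally compact element T of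
𝔇_Γ(U) lies in ℭ_Γ(U). Write T = (T − φψT) + φψT. The second summand is controlled, invariant and
locally compact. The first depends continuously on T, and for controlled T it is controlled,
invariant and a lift of 0, hence locally compact (`mem_closure_preIdealCΓ_iff`). This already enters
in the restriction maps of 𝔔_Γ, because compression is multiplicative only up to locally compact
operators.

That 𝔔 is a sheaf rests on two facts: local compactness of a pseudolocal operator is a local
property (`LocCompactOn.of_sSup`), and a bounded compatible family E is glued to ∑ g_i E_{j(i)} g_i
by a partition of unity ∑ g_i² = 1, without increase of the norm bound (`exists_glued_operator`).
The sheaf property of 𝔔_Γ follows through the isomorphism. The sheaf 𝔔_Γ is special because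
pseudolocal operators commute with bounded continuous functions up to locally compact operators
(`IsPseudolocal.commutator_mulOp`).

Given a section s, the isometry V satisfies Vρ(a) = t_f with f = a ∘ s⁻¹. If R is a lift of S, then
ρ(a) V⋆RV ρ(b) agrees with ρ(ab) S up to compact operators, so V⋆RV and S have the same class
(`IsSectionIsometry.locCompactOn_sub`). Continuous sections exist near every point, and 𝔔 is
separated; hence the formula on their domains determines the isomorphism. -/

/-! ### Operators modulo compact operators -/

section CompactPerturbations

open ContinuousLinearMap

variable {E F G : Type*} [NormedAddCommGroup E] [NormedSpace ℂ E] [NormedAddCommGroup F]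
  [NormedSpace ℂ F] [NormedAddCommGroup G] [NormedSpace ℂ G]

/-- Equality of operators up to a compact operator. -/
def CompactEq (S T : E →L[ℂ] F) : Prop := IsCompactOperator (S - T)

infix:50 " ≈ₖ " => CompactEq

theorem compactEq_zero {S : E →L[ℂ] F} : S ≈ₖ 0 ↔ IsCompactOperator S := by
  rw [CompactEq, sub_zero]

namespace CompactEq

theorem refl (S : E →L[ℂ] F) : S ≈ₖ S := by
  rw [CompactEq, sub_self]; exact isCompactOperator_zero

theorem of_eq {S T : E →L[ℂ] F} (h : S = T) : S ≈ₖ T := h ▸ refl S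

theorem symm {S T : E →L[ℂ] F} (h : S ≈ₖ T) : T ≈ₖ S := by
  rw [CompactEq, ← neg_sub]; exact h.neg

theorem trans {S T R : E →L[ℂ] F} (h : S ≈ₖ T) (h' : T ≈ₖ R) : S ≈ₖ R := by
  rw [CompactEq, ← sub_add_sub_cancel S T R]; exact IsCompactOperator.add h h'

theorem add {S T S' T' : E →L[ℂ] F} (h : S ≈ₖ T) (h' : S' ≈ₖ T') : S + S' ≈ₖ T + T' := by
  rw [CompactEq, add_sub_add_comm]; exact IsCompactOperator.add h h'

theorem sub {S T S' T' : E →L[ℂ] F} (h : S ≈ₖ T) (h' : S' ≈ₖ T') : S - S' ≈ₖ T - T' := by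
  rw [CompactEq, sub_sub_sub_comm]; exact IsCompactOperator.sub h h'

theorem sum {ι : Type*} (s : Finset ι) {S T : ι → E →L[ℂ] F} (h : ∀ i ∈ s, S i ≈ₖ T i) :
    ∑ i ∈ s, S i ≈ₖ ∑ i ∈ s, T i := by
  classical
  induction s using Finset.induction_on with
  | empty => exact refl _
  | insert a s ha ih =>
    rw [Finset.sum_insert ha, Finset.sum_insert ha]
    exact (h a (Finset.mem_insert_self a s)).add
      (ih fun i hi => h i (Finset.mem_insert_of_mem hi))

theorem sum_zero {ι : Type*} (s : Finset ι) {S : ι → E →L[ℂ] F} (h : ∀ i ∈ s, S i ≈ₖ 0) :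
    ∑ i ∈ s, S i ≈ₖ 0 := by
  simpa using CompactEq.sum s h

theorem comp_left {S T : E →L[ℂ] F} (A : F →L[ℂ] G) (h : S ≈ₖ T) : A ∘L S ≈ₖ A ∘L T := by
  rw [CompactEq, ← comp_sub]; exact IsCompactOperator.clm_comp h A

theorem comp_right {S T : F →L[ℂ] G} (A : E →L[ℂ] F) (h : S ≈ₖ T) : S ∘L A ≈ₖ T ∘L A := by
  rw [CompactEq, ← sub_comp]; exact IsCompactOperator.comp_clm h A

theorem zero_of_comp_left {S : E →L[ℂ] F} (A : F →L[ℂ] G) (h : S ≈ₖ 0) : A ∘L S ≈ₖ 0 := by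
  simpa using h.comp_left A

theorem zero_of_comp_right {S : F →L[ℂ] G} (A : E →L[ℂ] F) (h : S ≈ₖ 0) : S ∘L A ≈ₖ 0 := by
  simpa using h.comp_right A

theorem sub_zero_iff {S T : E →L[ℂ] F} : S - T ≈ₖ 0 ↔ S ≈ₖ T := by
  rw [compactEq_zero]; rfl

end CompactEq

theorem isClosed_compactEq_zero [CompleteSpace F] : IsClosed {S : E →L[ℂ] F | S ≈ₖ 0} := by
  simp only [compactEq_zero]
  exact isClosed_setOfPred_isCompactOperator

end CompactPerturbations

/-! ### Weakly convergent sums over Bessel families -/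

section WeakSums

open ContinuousLinearMap

variable {ι K H : Type*} [NormedAddCommGroup K] [InnerProductSpace ℂ K] [CompleteSpace K]
  [NormedAddCommGroup H] [InnerProductSpace ℂ H] [CompleteSpace H]

/-- Bessel's inequality for a family of operators. -/
def IsBesselFamily (B : ι → K →L[ℂ] H) : Prop :=
  ∀ (s : Finset ι) (ξ : K), ∑ i ∈ s, ‖B i ξ‖ ^ 2 ≤ ‖ξ‖ ^ 2

/-- The analysis operator `ξ ↦ (B i ξ)` of a Bessel family. -/
theorem IsBesselFamily.exists_analysis {B : ι → K →L[ℂ] H} (hB : IsBesselFamily B) :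
    ∃ W : K →L[ℂ] lp (fun _ : ι => H) 2, ‖W‖ ≤ 1 ∧ ∀ ξ i, W ξ i = B i ξ := by
  have h2 : (0 : ℝ) < (2 : ENNReal).toReal := by norm_num
  have hmem : ∀ ξ, Memℓp (fun i => B i ξ) 2 := fun ξ =>
    memℓp_gen' (C := ‖ξ‖ ^ 2) fun s => by simpa using hB s ξ
  let W₀ : K →ₗ[ℂ] lp (fun _ : ι => H) 2 :=
    { toFun := fun ξ => ⟨fun i => B i ξ, hmem ξ⟩
      map_add' := fun ξ η => by ext i; exact map_add (B i) ξ η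
      map_smul' := fun c ξ => by ext i; exact map_smul (B i) c ξ }
  refine ⟨W₀.mkContinuous 1 fun ξ => ?_, LinearMap.mkContinuous_norm_le _ zero_le_one _,
    fun ξ i => rfl⟩
  rw [one_mul]
  refine lp.norm_le_of_forall_sum_le h2 (norm_nonneg ξ) fun s => ?_
  simpa [W₀] using hB s ξ

/-- Diagonal operators on `ℓ²`. -/
theorem exists_lp_diagonal (T : ι → H →L[ℂ] H) {C : ℝ} (hC : 0 ≤ C) (hT : ∀ i, ‖T i‖ ≤ C) :
    ∃ D : lp (fun _ : ι => H) 2 →L[ℂ] lp (fun _ : ι => H) 2,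
      ‖D‖ ≤ C ∧ ∀ x i, D x i = T i (x i) := by
  have h2 : (0 : ℝ) < (2 : ENNReal).toReal := by norm_num
  have hle : ∀ (x : lp (fun _ : ι => H) 2) (s : Finset ι),
      ∑ i ∈ s, ‖T i (x i)‖ ^ 2 ≤ (C * ‖x‖) ^ 2 := fun x s => by
    have h1 := lp.sum_rpow_le_norm_rpow h2 x s
    norm_num at h1
    calc ∑ i ∈ s, ‖T i (x i)‖ ^ 2 ≤ ∑ i ∈ s, C ^ 2 * ‖x i‖ ^ 2 := by
          refine Finset.sum_le_sum fun i _ => ?_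
          rw [← mul_pow]
          gcongr
          exact (T i).le_of_opNorm_le (hT i) _
      _ ≤ (C * ‖x‖) ^ 2 := by rw [← Finset.mul_sum, mul_pow]; gcongr
  have hmem : ∀ x : lp (fun _ : ι => H) 2, Memℓp (fun i => T i (x i)) 2 := fun x =>
    memℓp_gen' (C := (C * ‖x‖) ^ 2) fun s => by simpa using hle x s
  let D₀ : lp (fun _ : ι => H) 2 →ₗ[ℂ] lp (fun _ : ι => H) 2 :=
    { toFun := fun x => ⟨fun i => T i (x i), hmem x⟩
      map_add' := fun x y => by ext i; exact map_add (T i) (x i) (y i)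
      map_smul' := fun c x => by ext i; exact map_smul (T i) c (x i) }
  refine ⟨D₀.mkContinuous C fun x => ?_, LinearMap.mkContinuous_norm_le _ hC _, fun x i => rfl⟩
  refine lp.norm_le_of_forall_sum_le h2 (by positivity) fun s => ?_
  simpa [D₀] using hle x s

/-- The weakly convergent sum `∑ (B i)⋆ (T i) (B i)`, for a Bessel family `B` and a bounded
family `T`. -/
theorem IsBesselFamily.exists_sum {B : ι → K →L[ℂ] H} (hB : IsBesselFamily B)
    (T : ι → H →L[ℂ] H) {C : ℝ} (hC : 0 ≤ C) (hT : ∀ i, ‖T i‖ ≤ C) :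
    ∃ R : K →L[ℂ] K, ‖R‖ ≤ C ∧
      ∀ ξ η, HasSum (fun i => inner ℂ (B i η) (T i (B i ξ))) (inner ℂ η (R ξ)) := by
  obtain ⟨W, hW, hWB⟩ := hB.exists_analysis
  obtain ⟨D, hD, hDT⟩ := exists_lp_diagonal T hC hT
  -- R = W⋆DW, with W the contraction ξ ↦ (B i ξ) into ℓ² and D the diagonal operator with entries T
  -- i. The bound for R is thus the one for D.
  refine ⟨adjoint W ∘L D ∘L W, ?_, fun ξ η => ?_⟩
  · calc ‖adjoint W ∘L D ∘L W‖ ≤ ‖adjoint W‖ * (‖D‖ * ‖W‖) :=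
          (opNorm_comp_le _ _).trans (by gcongr; exact opNorm_comp_le _ _)
      _ ≤ 1 * (C * 1) := by
          rw [LinearIsometryEquiv.norm_map]; gcongr
      _ = C := by ring
  · have := lp.hasSum_inner (𝕜 := ℂ) (W η) (D (W ξ))
    rw [comp_apply, comp_apply, adjoint_inner_right]
    simpa only [hDT, hWB] using this

variable {B : ι → K →L[ℂ] H} {T : ι → H →L[ℂ] H} {R : K →L[ℂ] K}

/-- Composition with an operator killed by all but finitely many B i turns the weak sum into a
finite one. This is how cutoffs of compact support reduce weak sums to algebra modulo compact
operators, where weak limits would be of no use. -/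
theorem comp_eq_sum_of_hasSum
    (hR : ∀ ξ η, HasSum (fun i => inner ℂ (B i η) (T i (B i ξ))) (inner ℂ η (R ξ)))
    {L : Type*} [NormedAddCommGroup L] [NormedSpace ℂ L] (X : L →L[ℂ] K) (s : Finset ι)
    (hs : ∀ i, i ∉ s → B i ∘L X = 0) :
    R ∘L X = ∑ i ∈ s, adjoint (B i) ∘L T i ∘L B i ∘L X := by
  ext1 ξ
  refine ext_inner_left ℂ fun η => ?_
  refine (hR (X ξ) η).unique ?_
  rw [_root_.sum_apply, inner_sum]
  simp only [comp_apply, adjoint_inner_right]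
  refine hasSum_sum_of_ne_finset_zero fun i hi => ?_
  have : B i (X ξ) = 0 := congrArg (fun A : L →L[ℂ] H => A ξ) (hs i hi)
  rw [this, map_zero, inner_zero_right]

/-- The mirror image of `comp_eq_sum_of_hasSum`, with the cutoff on the left; the vanishing
hypothesis is used in adjoint form. -/
theorem eq_comp_sum_of_hasSum
    (hR : ∀ ξ η, HasSum (fun i => inner ℂ (B i η) (T i (B i ξ))) (inner ℂ η (R ξ)))
    {L : Type*} [NormedAddCommGroup L] [InnerProductSpace ℂ L] [CompleteSpace L] (X : K →L[ℂ] L)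
    (s : Finset ι) (hs : ∀ i, i ∉ s → X ∘L adjoint (B i) = 0) :
    X ∘L R = ∑ i ∈ s, X ∘L adjoint (B i) ∘L T i ∘L B i := by
  ext1 ξ
  refine ext_inner_left ℂ fun η => ?_
  rw [comp_apply, ← adjoint_inner_left]
  refine (hR ξ (adjoint X η)).unique ?_
  rw [_root_.sum_apply, inner_sum]
  have e : ∀ i, inner ℂ η ((X ∘L adjoint (B i) ∘L T i ∘L B i) ξ) =
      inner ℂ (B i (adjoint X η)) (T i (B i ξ)) := fun i => by
    simp only [comp_apply]
    rw [← adjoint_inner_left, adjoint_inner_right]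
  simp only [e]
  refine hasSum_sum_of_ne_finset_zero fun i hi => ?_
  have h := congrArg adjoint (hs i hi)
  rw [adjoint_comp, adjoint_adjoint, map_zero] at h
  have : B i (adjoint X η) = 0 := congrArg (fun A : L →L[ℂ] H => A η) h
  rw [this, inner_zero_left]

end WeakSums

/-! ### Operators prescribed on total families through Gram matrices -/

section GramExtension

variable {ι E F : Type*} [NormedAddCommGroup E] [InnerProductSpace ℂ E]
  [NormedAddCommGroup F] [InnerProductSpace ℂ F]

/-- The family s' exhibits C² Gram(t) − Gram(s) as a Gram matrix, hence as positive; evaluating the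
quadratic forms at c gives the inequality. For multiplication by F, the family s' will come from
multiplication by √(‖F‖² − |F|²). -/
theorem norm_linearCombination_le_of_gram_le (t : ι → E) (s s' : ι → F) {C : ℝ} (hC : 0 ≤ C)
    (h : ∀ i j, (C : ℂ) ^ 2 * inner ℂ (t i) (t j) = inner ℂ (s i) (s j) + inner ℂ (s' i) (s' j))
    (c : ι →₀ ℂ) :
    ‖Finsupp.linearCombination ℂ s c‖ ≤ C * ‖Finsupp.linearCombination ℂ t c‖ := by
  have key : (C : ℂ) ^ 2 * inner ℂ (Finsupp.linearCombination ℂ t c)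
      (Finsupp.linearCombination ℂ t c) =
      inner ℂ (Finsupp.linearCombination ℂ s c) (Finsupp.linearCombination ℂ s c) +
      inner ℂ (Finsupp.linearCombination ℂ s' c) (Finsupp.linearCombination ℂ s' c) := by
    simp only [Finsupp.linearCombination_apply, Finsupp.sum, sum_inner, inner_sum, inner_smul_left,
      inner_smul_right, Finset.mul_sum, ← Finset.sum_add_distrib]
    refine Finset.sum_congr rfl fun i _ => Finset.sum_congr rfl fun j _ => ?_
    linear_combination (starRingEnd ℂ (c j) * c i) * h j i
  simp only [inner_self_eq_norm_sq_to_K] at key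
  have key' : C ^ 2 * ‖Finsupp.linearCombination ℂ t c‖ ^ 2 =
      ‖Finsupp.linearCombination ℂ s c‖ ^ 2 + ‖Finsupp.linearCombination ℂ s' c‖ ^ 2 := by
    apply Complex.ofReal_injective
    push_cast
    simpa using key
  refine le_of_sq_le_sq ?_ (by positivity)
  rw [mul_pow, key']
  linarith [sq_nonneg ‖Finsupp.linearCombination ℂ s' c‖]

theorem denseRange_linearCombination {t : ι → E}
    (ht : (Submodule.span ℂ (Set.range t)).topologicalClosure = ⊤) :
    DenseRange (Finsupp.linearCombination ℂ t) := by
  have := Submodule.dense_iff_topologicalClosure_eq_top.2 ht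
  rwa [← Finsupp.range_linearCombination] at this

variable [CompleteSpace F]

/-- A bounded operator with prescribed values on a total family exists if the Gram matrix of the
values is dominated by that of the family. -/
theorem exists_clm_of_gram (t : ι → E) (s s' : ι → F)
    (ht : (Submodule.span ℂ (Set.range t)).topologicalClosure = ⊤) {C : ℝ} (hC : 0 ≤ C)
    (h : ∀ i j, (C : ℂ) ^ 2 * inner ℂ (t i) (t j) = inner ℂ (s i) (s j) + inner ℂ (s' i) (s' j)) :
    ∃ L : E →L[ℂ] F, ∀ i, L (t i) = s i := by
  refine ⟨(Finsupp.linearCombination ℂ s).extendOfNorm (Finsupp.linearCombination ℂ t),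
    fun i => ?_⟩
  have := LinearMap.extendOfNorm_eq (denseRange_linearCombination ht)
    ⟨C, norm_linearCombination_le_of_gram_le t s s' hC h⟩ (Finsupp.single i 1)
  simpa using this

/-- An isometry with prescribed values on a total family exists if the Gram matrices agree. -/
theorem exists_isometry_of_gram (t : ι → E) (s : ι → F)
    (ht : (Submodule.span ℂ (Set.range t)).topologicalClosure = ⊤)
    (h : ∀ i j, inner ℂ (t i) (t j) = inner ℂ (s i) (s j)) :
    ∃ L : E →ₗᵢ[ℂ] F, ∀ i, L (t i) = s i := by
  -- Equal Gram matrices give the inequality in both directions, with C = 1 and zero defect, so the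
  -- extension preserves norms on a dense set.
  have h1 := norm_linearCombination_le_of_gram_le t s (fun _ => (0 : F)) zero_le_one
    fun i j => by simp [h]
  have h2 := norm_linearCombination_le_of_gram_le s t (fun _ => (0 : E)) zero_le_one
    fun i j => by simp [h]
  have hd := denseRange_linearCombination ht
  have heq := LinearMap.extendOfNorm_eq hd ⟨1, h1⟩
  set L := (Finsupp.linearCombination ℂ s).extendOfNorm (Finsupp.linearCombination ℂ t)
  refine ⟨⟨L, fun x => ?_⟩, fun i => ?_⟩
  · refine hd.induction_on (p := fun x => ‖L x‖ = ‖x‖) x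
      (isClosed_eq L.continuous.norm continuous_norm) fun c => ?_
    rw [heq]
    have h1 := h1 c
    have h2 := h2 c
    rw [one_mul] at h1 h2
    exact le_antisymm h1 h2
  · simpa using heq (Finsupp.single i 1)

end GramExtension

/-! ### Homomorphisms of quotient C⋆-algebras -/

section QuotientMaps

variable {A B : Type*} [CStarAlgebra A] [CStarAlgebra B]

namespace CStarIdeal

/-- The ⋆-homomorphism of quotients induced by a linear map which is a unital ⋆-homomorphism up to
elements of the ideal. -/
noncomputable def quotMap (I : CStarIdeal A) (J : CStarIdeal B) (φ : A →ₗ[ℂ] B)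
    (hI : ∀ a ∈ I.toIdeal, φ a ∈ J.toIdeal) (h1 : φ 1 - 1 ∈ J.toIdeal)
    (hmul : ∀ a b, φ (a * b) - φ a * φ b ∈ J.toIdeal) (hstar : ∀ a, φ (star a) = star (φ a)) :
    I.Quot →⋆ₐ[ℂ] J.Quot :=
  -- The value is taken at a chosen representative; by `hI` and linearity it does not depend on the
  -- choice.
  let f : I.Quot → J.Quot := fun x => J.toQuot (φ (Classical.choose (I.toQuot_surjective x)))
  have hf : ∀ a, f (I.toQuot a) = J.toQuot (φ a) := fun a => by
    rw [← sub_eq_zero, ← map_sub, ← map_sub, J.toQuot_eq_zero]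
    refine hI _ (I.toQuot_eq_zero.1 ?_)
    rw [map_sub, Classical.choose_spec (I.toQuot_surjective (I.toQuot a)), sub_self]
  { toFun := f
    map_one' := by
      rw [← map_one I.toQuot, hf, ← map_one J.toQuot, ← sub_eq_zero, ← map_sub, J.toQuot_eq_zero]
      exact h1
    map_mul' := fun x y => by
      obtain ⟨a, rfl⟩ := I.toQuot_surjective x
      obtain ⟨b, rfl⟩ := I.toQuot_surjective y
      rw [← map_mul, hf, hf, hf, ← map_mul, ← sub_eq_zero, ← map_sub, J.toQuot_eq_zero]
      exact hmul a b
    map_zero' := by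
      rw [← map_zero I.toQuot, hf, map_zero, map_zero]
    map_add' := fun x y => by
      obtain ⟨a, rfl⟩ := I.toQuot_surjective x
      obtain ⟨b, rfl⟩ := I.toQuot_surjective y
      rw [← map_add, hf, hf, hf, map_add, map_add]
    commutes' := fun c => by
      have e : φ (algebraMap ℂ A c) - algebraMap ℂ B c = c • (φ 1 - 1) := by
        rw [Algebra.algebraMap_eq_smul_one, Algebra.algebraMap_eq_smul_one, map_smul, smul_sub]
      rw [← I.toQuot.commutes, hf, ← J.toQuot.commutes, ← sub_eq_zero, ← map_sub,
        J.toQuot_eq_zero, e]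
      exact J.toSub.smul_mem c h1
    map_star' := fun x => by
      obtain ⟨a, rfl⟩ := I.toQuot_surjective x
      rw [← I.toQuot_star, hf, hf, hstar, J.toQuot_star] }

theorem quotMap_toQuot (I : CStarIdeal A) (J : CStarIdeal B) (φ : A →ₗ[ℂ] B)
    (hI : ∀ a ∈ I.toIdeal, φ a ∈ J.toIdeal) (h1 : φ 1 - 1 ∈ J.toIdeal)
    (hmul : ∀ a b, φ (a * b) - φ a * φ b ∈ J.toIdeal) (hstar : ∀ a, φ (star a) = star (φ a))
    (a : A) : I.quotMap J φ hI h1 hmul hstar (I.toQuot a) = J.toQuot (φ a) := by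
  change J.toQuot _ = _
  rw [← sub_eq_zero, ← map_sub, ← map_sub, J.toQuot_eq_zero]
  refine hI _ (I.toQuot_eq_zero.1 ?_)
  rw [map_sub, Classical.choose_spec (I.toQuot_surjective (I.toQuot a)), sub_self]

theorem toQuot_eq_iff (I : CStarIdeal A) {a b : A} : I.toQuot a = I.toQuot b ↔ a - b ∈ I.toIdeal := by
  rw [← sub_eq_zero, ← map_sub, I.toQuot_eq_zero]

end CStarIdeal

end QuotientMaps

/-! ### Cutoffs and approximation in C_c and C₀ -/

section TestFunctions

open scoped CompactlySupported

variable {Y : Type*} [TopologicalSpace Y]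

/-- The inclusion of `C_c(Y)` in `C₀(Y)`. -/
def CompactlySupportedContinuousMap.toC₀ (f : C_c(Y, ℂ)) : C₀(Y, ℂ) :=
  ⟨f.toContinuousMap, f.hasCompactSupport.is_zero_at_infty⟩

namespace CompactlySupportedContinuousMap

@[simp]
theorem toC₀_apply (f : C_c(Y, ℂ)) (y : Y) : f.toC₀ y = f y := rfl

theorem toC₀_mul (f g : C_c(Y, ℂ)) : (f * g).toC₀ = f.toC₀ * g.toC₀ := rfl

theorem toC₀_star (f : C_c(Y, ℂ)) : (star f).toC₀ = star f.toC₀ := rfl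

theorem toC₀_add (f g : C_c(Y, ℂ)) : (f + g).toC₀ = f.toC₀ + g.toC₀ := rfl

theorem toC₀_sum {ι : Type*} (s : Finset ι) (f : ι → C_c(Y, ℂ)) :
    (∑ i ∈ s, f i).toC₀ = ∑ i ∈ s, (f i).toC₀ :=
  map_sum (⟨⟨toC₀, rfl⟩, toC₀_add⟩ : C_c(Y, ℂ) →+ C₀(Y, ℂ)) f s

theorem tsupport_mul_left (f g : C_c(Y, ℂ)) : tsupport (f * g) ⊆ tsupport f :=
  tsupport_mul_subset_left

theorem tsupport_mul_right (f g : C_c(Y, ℂ)) : tsupport (f * g) ⊆ tsupport g :=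
  tsupport_mul_subset_right

theorem tsupport_star (f : C_c(Y, ℂ)) : tsupport (star f) = tsupport f := by
  simp only [tsupport]
  congr 1
  ext y
  simp

theorem mul_eq_right_of_one {k f : C_c(Y, ℂ)} (h : ∀ y ∈ tsupport f, k y = 1) : k * f = f := by
  ext y
  by_cases hy : y ∈ tsupport f
  · rw [mul_apply, h y hy, one_mul]
  · rw [mul_apply, image_eq_zero_of_notMem_tsupport hy, mul_zero]

theorem vanishesOff {W : Opens Y} {f : C_c(Y, ℂ)} (hf : tsupport f ⊆ W) :
    VanishesOff W f.toC₀ :=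
  fun _ hy => image_eq_zero_of_notMem_tsupport fun h => hy (hf h)

variable [LocallyCompactSpace Y] [T2Space Y]

theorem exists_real_cutoff {L : Set Y} (hL : IsCompact L) {W : Opens Y} (hLW : L ⊆ W) :
    ∃ χ : C(Y, ℝ), HasCompactSupport χ ∧ tsupport χ ⊆ W ∧ (∀ y ∈ L, χ y = 1) ∧
      ∀ y, χ y ∈ Set.Icc (0 : ℝ) 1 := by
  obtain ⟨O, hO, hLO, hOW, hOc⟩ := exists_open_between_and_isCompact_closure hL W.2 hLW
  obtain ⟨χ, hχO, hχ1, hχ01⟩ :=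
    exists_tsupport_one_of_isOpen_isClosed hO hOc hL.isClosed hLO
  exact ⟨χ, hOc.of_isClosed_subset (isClosed_tsupport _) (hχO.trans subset_closure),
    hχO.trans (subset_closure.trans hOW), hχ1, hχ01⟩

/-- The bound on 1 − k is needed for approximation: multiplying f by k moves f by at most |f| at
each point. Self-adjointness of k lets it pass through adjoints. -/
theorem exists_cutoff {L : Set Y} (hL : IsCompact L) {W : Opens Y} (hLW : L ⊆ W) :
    ∃ k : C_c(Y, ℂ), tsupport k ⊆ W ∧ (∀ y ∈ L, k y = 1) ∧ star k = k ∧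
      ∀ y, ‖1 - k y‖ ≤ 1 := by
  obtain ⟨χ, hχc, hχW, hχ1, hχ01⟩ := exists_real_cutoff hL hLW
  have hs : Function.support (fun y => (χ y : ℂ)) = Function.support χ := by ext y; simp
  have hts : tsupport (fun y => (χ y : ℂ)) = tsupport χ := by simp only [tsupport, hs]
  refine ⟨⟨⟨fun y => (χ y : ℂ), by fun_prop⟩, ?_⟩, ?_, fun y hy => ?_, ?_, fun y => ?_⟩
  · rw [HasCompactSupport]
    change IsCompact (tsupport fun y => (χ y : ℂ))
    rw [hts]; exact hχc
  · change tsupport (fun y => (χ y : ℂ)) ⊆ _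
    rw [hts]; exact hχW
  · change (χ y : ℂ) = 1
    rw [hχ1 y hy, Complex.ofReal_one]
  · ext y
    exact Complex.conj_ofReal _
  · change ‖1 - (χ y : ℂ)‖ ≤ 1
    obtain ⟨h0, h1⟩ := hχ01 y
    rw [← Complex.ofReal_one, ← Complex.ofReal_sub, Complex.norm_real, Real.norm_eq_abs, abs_le]
    constructor <;> linarith

/-- The set where |f| ≥ ε is compact and contained in W. With k a cutoff equal to 1 there, kf equals
f on this set, and elsewhere |f − kf| ≤ |f| < ε. -/
theorem exists_norm_sub_toC₀_le {W : Opens Y} {f : C₀(Y, ℂ)} (hf : VanishesOff W f) {ε : ℝ}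
    (hε : 0 < ε) : ∃ g : C_c(Y, ℂ), tsupport g ⊆ W ∧ ‖f - g.toC₀‖ ≤ ε := by
  have hfc : Continuous fun y => ‖f y‖ := by fun_prop
  have hK : IsCompact {y | ε ≤ ‖f y‖} := by
    have h1 := (f.zero_at_infty'.norm).eventually (gt_mem_nhds (show ‖(0 : ℂ)‖ < ε by simpa))
    obtain ⟨C, hC, hCs⟩ := Filter.mem_cocompact.1 h1
    refine hC.of_isClosed_subset (isClosed_le continuous_const hfc) fun y hy => ?_
    by_contra hyC
    have h2 : ‖f y‖ < ε := hCs hyC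
    exact absurd h2 (not_lt.2 hy)
  have hKW : {y | ε ≤ ‖f y‖} ⊆ W := fun y hy => by
    by_contra hyW
    have : ε ≤ ‖f y‖ := hy
    rw [hf y hyW, norm_zero] at this
    linarith
  obtain ⟨k, hkW, hk1, -, hk⟩ := exists_cutoff hK hKW
  let g : C_c(Y, ℂ) := ⟨⟨fun y => k y * f y, by fun_prop⟩, k.hasCompactSupport.mul_right⟩
  have hg : tsupport g ⊆ tsupport k := tsupport_mul_subset_left (f := k) (g := f)
  refine ⟨g, hg.trans hkW, ?_⟩
  refine (BoundedContinuousFunction.norm_le hε.le (f := (f - g.toC₀).toBCF)).2 fun y => ?_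
  change ‖f y - k y * f y‖ ≤ ε
  by_cases hy : ε ≤ ‖f y‖
  · simp [hk1 y hy, hε.le]
  · have e : f y - k y * f y = (1 - k y) * f y := by ring
    rw [e, norm_mul]
    nlinarith [norm_nonneg (f y), hk y, norm_nonneg (1 - k y)]

end CompactlySupportedContinuousMap

/-- A closed property of functions in `C₀(W)` may be checked on `C_c(W)`. -/
theorem VanishesOff.induction_of_compactSupport [LocallyCompactSpace Y] [T2Space Y] {W : Opens Y}
    {p : C₀(Y, ℂ) → Prop} (hp : IsClosed {f | p f})
    (h : ∀ g : C_c(Y, ℂ), tsupport g ⊆ W → p g.toC₀) {f : C₀(Y, ℂ)} (hf : VanishesOff W f) :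
    p f := by
  have : f ∈ closure {f | p f} := Metric.mem_closure_iff.2 fun ε hε => by
    obtain ⟨g, hg, hfg⟩ :=
      CompactlySupportedContinuousMap.exists_norm_sub_toC₀_le hf (half_pos hε)
    exact ⟨g.toC₀, h g hg, by rw [dist_eq_norm]; linarith⟩
  rwa [hp.closure_eq] at this

theorem VanishesOff.mono {V W : Opens Y} (h : W ≤ V) {f : C₀(Y, ℂ)} (hf : VanishesOff W f) :
    VanishesOff V f := fun y hy => hf y fun hyW => hy (h hyW)

theorem VanishesOff.mul_right {W : Opens Y} {f : C₀(Y, ℂ)} (hf : VanishesOff W f) (g : C₀(Y, ℂ)) :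
    VanishesOff W (f * g) := fun y hy => by simp [hf y hy]

end TestFunctions

/-! ### Pseudolocality and local compactness over an open set -/

section LocalProperties

open ContinuousLinearMap
open scoped CompactlySupported

variable {Y : Type*} [TopologicalSpace Y]
  {K : Type*} [NormedAddCommGroup K] [InnerProductSpace ℂ K] [CompleteSpace K]
  (ρ : C₀(Y, ℂ) →⋆ₙₐ[ℂ] (K →L[ℂ] K)) (W : Opens Y)

/-- Operators on the whole module which commute with `C₀(W)` up to compact operators. -/
def PseudolocalOn (T : K →L[ℂ] K) : Prop := ∀ f, VanishesOff W f → T ∘L ρ f ≈ₖ ρ f ∘L T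

/-- Operators on the whole module whose products with elements of `C₀(W)` are compact. -/
def LocCompactOn (T : K →L[ℂ] K) : Prop :=
  ∀ f, VanishesOff W f → T ∘L ρ f ≈ₖ 0 ∧ ρ f ∘L T ≈ₖ 0

variable {ρ W}

theorem map_mul_comp (f g : C₀(Y, ℂ)) : ρ (f * g) = ρ f ∘L ρ g := map_mul ρ f g

theorem adjoint_map (f : C₀(Y, ℂ)) : adjoint (ρ f) = ρ (star f) := (map_star ρ f).symm

theorem map_toC₀_mul (f g : C_c(Y, ℂ)) : ρ (f * g).toC₀ = ρ f.toC₀ ∘L ρ g.toC₀ :=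
  map_mul_comp f.toC₀ g.toC₀

theorem adjoint_map_toC₀ (f : C_c(Y, ℂ)) : adjoint (ρ f.toC₀) = ρ (star f).toC₀ :=
  adjoint_map _

theorem continuous_rep : Continuous ρ :=
  (AddMonoidHomClass.lipschitz_of_bound ρ 1 fun f => by
    rw [one_mul]; exact NonUnitalStarAlgHom.norm_apply_le ρ f).continuous

namespace PseudolocalOn

theorem mono {V : Opens Y} (h : W ≤ V) {T : K →L[ℂ] K} (hT : PseudolocalOn ρ V T) :
    PseudolocalOn ρ W T := fun f hf => hT f (hf.mono h)

theorem sub {S T : K →L[ℂ] K} (hS : PseudolocalOn ρ W S) (hT : PseudolocalOn ρ W T) :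
    PseudolocalOn ρ W (S - T) := fun f hf => by
  rw [sub_comp, comp_sub]; exact (hS f hf).sub (hT f hf)

theorem id : PseudolocalOn ρ W (ContinuousLinearMap.id ℂ K) := fun f _ => by
  rw [id_comp, comp_id]; exact CompactEq.refl _

theorem of_compactSupport [LocallyCompactSpace Y] [T2Space Y] {T : K →L[ℂ] K}
    (h : ∀ f : C_c(Y, ℂ), tsupport f ⊆ W → T ∘L ρ f.toC₀ ≈ₖ ρ f.toC₀ ∘L T) :
    PseudolocalOn ρ W T := fun f hf => by
  refine hf.induction_of_compactSupport (p := fun f => T ∘L ρ f ≈ₖ ρ f ∘L T) ?_ h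
  simp only [← CompactEq.sub_zero_iff (S := T ∘L _)]
  exact isClosed_compactEq_zero.preimage
    ((continuous_const.clm_comp continuous_rep).sub (continuous_rep.clm_comp continuous_const))

end PseudolocalOn

namespace LocCompactOn

theorem mono {V : Opens Y} (h : W ≤ V) {T : K →L[ℂ] K} (hT : LocCompactOn ρ V T) :
    LocCompactOn ρ W T := fun f hf => hT f (hf.mono h)

theorem zero : LocCompactOn ρ W 0 := fun f _ => by
  rw [zero_comp, comp_zero]; exact ⟨CompactEq.refl _, CompactEq.refl _⟩

theorem add {S T : K →L[ℂ] K} (hS : LocCompactOn ρ W S) (hT : LocCompactOn ρ W T) :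
    LocCompactOn ρ W (S + T) := fun f hf => by
  rw [add_comp, comp_add, ← add_zero (0 : K →L[ℂ] K)]
  exact ⟨(hS f hf).1.add (hT f hf).1, (hS f hf).2.add (hT f hf).2⟩

theorem sub {S T : K →L[ℂ] K} (hS : LocCompactOn ρ W S) (hT : LocCompactOn ρ W T) :
    LocCompactOn ρ W (S - T) := fun f hf => by
  rw [sub_comp, comp_sub, ← sub_zero (0 : K →L[ℂ] K)]
  exact ⟨(hS f hf).1.sub (hT f hf).1, (hS f hf).2.sub (hT f hf).2⟩

theorem neg {T : K →L[ℂ] K} (hT : LocCompactOn ρ W T) : LocCompactOn ρ W (-T) := by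
  rw [← zero_sub]; exact zero.sub hT

theorem pseudolocalOn {T : K →L[ℂ] K} (hT : LocCompactOn ρ W T) : PseudolocalOn ρ W T :=
  fun f hf => (hT f hf).1.trans (hT f hf).2.symm

theorem comp_left {S T : K →L[ℂ] K} (hS : PseudolocalOn ρ W S) (hT : LocCompactOn ρ W T) :
    LocCompactOn ρ W (S ∘L T) := fun f hf => by
  refine ⟨?_, ?_⟩
  · rw [comp_assoc]; exact (hT f hf).1.zero_of_comp_left S
  · refine (((hS f hf).comp_right T).symm).trans ?_
    rw [comp_assoc]; exact (hT f hf).2.zero_of_comp_left S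

variable [LocallyCompactSpace Y] [T2Space Y]

/-- The commutator with ρ(f) is compact, so one of the two products suffices; a closed condition on
f ∈ C₀(W) need only be tested on C_c(W). -/
theorem of_comp_left {T : K →L[ℂ] K} (hT : PseudolocalOn ρ W T)
    (h : ∀ f : C_c(Y, ℂ), tsupport f ⊆ W → ρ f.toC₀ ∘L T ≈ₖ 0) : LocCompactOn ρ W T := fun f hf => by
  have h2 : ρ f ∘L T ≈ₖ 0 := by
    refine hf.induction_of_compactSupport (p := fun f => ρ f ∘L T ≈ₖ 0) ?_ h
    exact isClosed_compactEq_zero.preimage (continuous_rep.clm_comp continuous_const)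
  exact ⟨(hT f hf).trans h2, h2⟩

/-- Local compactness of a pseudolocal operator may be checked by cutting off on both sides. -/
theorem of_comp_comp {T : K →L[ℂ] K} (hT : PseudolocalOn ρ W T)
    (h : ∀ f g : C_c(Y, ℂ), tsupport f ⊆ W → tsupport g ⊆ W →
      ρ f.toC₀ ∘L T ∘L ρ g.toC₀ ≈ₖ 0) : LocCompactOn ρ W T := by
  refine of_comp_left hT fun f hf => ?_
  obtain ⟨k, hkW, hk1, -⟩ :=
    CompactlySupportedContinuousMap.exists_cutoff f.hasCompactSupport hf
  -- Since kf = f, pseudolocality moves ρ(f) to the other side of T while ρ(k) stays, which produces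
  -- a two-sided cutoff.
  have e : ρ f.toC₀ = ρ k.toC₀ ∘L ρ f.toC₀ := by
    rw [← map_toC₀_mul, CompactlySupportedContinuousMap.mul_eq_right_of_one hk1]
  rw [e, comp_assoc]
  exact ((hT _ (CompactlySupportedContinuousMap.vanishesOff hf)).symm.comp_left _).trans
    (h k f hkW hf)

/-- Local compactness is a local property. -/
theorem of_sSup {𝒰 : Set (Opens Y)} {T : K →L[ℂ] K} (hT : PseudolocalOn ρ (sSup 𝒰) T)
    (h : ∀ U ∈ 𝒰, LocCompactOn ρ U T) : LocCompactOn ρ (sSup 𝒰) T := by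
  refine of_comp_left hT fun f hf => ?_
  -- A finite partition of unity on the compact support of f writes f as a finite sum of functions,
  -- each supported in one member of the cover.
  obtain ⟨t, ht⟩ := IsCompact.elim_finite_subcover (s := tsupport f) f.hasCompactSupport
    (fun U : 𝒰 => (U : Set Y)) (fun U => U.1.2) (by
      intro y hy
      obtain ⟨U, hU, hyU⟩ := Opens.mem_sSup.1 (hf hy)
      exact Set.mem_iUnion.2 ⟨⟨U, hU⟩, hyU⟩)
  let s : Fin t.card → Set Y := fun i => ((t.equivFin.symm i).1 : Opens Y)
  have hst : tsupport f ⊆ ⋃ i, s i := fun y hy => by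
    obtain ⟨i, hi, hyi⟩ := Set.mem_iUnion₂.1 (ht hy)
    exact Set.mem_iUnion.2 ⟨t.equivFin ⟨i, hi⟩, by simpa [s] using hyi⟩
  obtain ⟨θ, hθs, hθ1, hθ01, -⟩ := exists_continuous_sum_one_of_isOpen_isCompact
    (fun i => (t.equivFin.symm i).1.1.2) f.hasCompactSupport hst
  let g : Fin t.card → C_c(Y, ℂ) := fun i =>
    ⟨⟨fun y => (θ i y : ℂ) * f y, by fun_prop⟩, f.hasCompactSupport.mul_left⟩
  have hfg : f = ∑ i, g i := by
    ext y
    rw [CompactlySupportedContinuousMap.sum_apply]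
    change f y = ∑ i, (θ i y : ℂ) * f y
    rw [← Finset.sum_mul, ← Complex.ofReal_sum]
    by_cases hy : y ∈ tsupport f
    · have : ∑ i, θ i y = 1 := by simpa using hθ1 hy
      rw [this, Complex.ofReal_one, one_mul]
    · rw [image_eq_zero_of_notMem_tsupport hy, mul_zero]
  rw [hfg, CompactlySupportedContinuousMap.toC₀_sum, map_sum, finsetSum_comp]
  refine CompactEq.sum_zero _ fun i _ => ?_
  refine (h _ (t.equivFin.symm i).1.2 _ (CompactlySupportedContinuousMap.vanishesOff ?_)).2
  refine subset_trans ?_ (hθs i)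
  refine closure_mono fun y hy => ?_
  contrapose! hy
  have : θ i y = 0 := by simpa using hy
  simp [g, this]

end LocCompactOn

end LocalProperties

/-! ### Compression to P_W K and extension by zero -/

section LocalModules

open ContinuousLinearMap
open scoped CompactlySupported

variable {Y : Type*} [TopologicalSpace Y]
  {K : Type*} [NormedAddCommGroup K] [InnerProductSpace ℂ K] [CompleteSpace K]
  (ρ : C₀(Y, ℂ) →⋆ₙₐ[ℂ] (K →L[ℂ] K)) (W : Opens Y)

/-- The inclusion of `P_W K` in `K`, as a bounded operator. -/
noncomputable def inclL : LocalModule ρ W →L[ℂ] K := (localIncl ρ W).toContinuousLinearMap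

/-- Extension by zero of an operator on `P_W K`. -/
noncomputable def extendOp (T : LocalModule ρ W →L[ℂ] LocalModule ρ W) : K →L[ℂ] K :=
  inclL ρ W ∘L T ∘L adjoint (inclL ρ W)

/-- Compression of an operator to `P_W K`. -/
noncomputable def compressOp (T : K →L[ℂ] K) : LocalModule ρ W →L[ℂ] LocalModule ρ W :=
  adjoint (inclL ρ W) ∘L T ∘L inclL ρ W

theorem localRep_eq (f : C₀(Y, ℂ)) : localRep ρ W f = compressOp ρ W (ρ f) := rfl

theorem restrictOp_eq (V : Opens Y) (T : LocalModule ρ V →L[ℂ] LocalModule ρ V) :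
    restrictOp ρ V W T = compressOp ρ W (extendOp ρ V T) := rfl

theorem adjoint_inclL_comp : adjoint (inclL ρ W) ∘L inclL ρ W = ContinuousLinearMap.id ℂ _ :=
  (localIncl ρ W).adjoint_comp_self

theorem adjoint_inclL_comp_assoc {E : Type*} [NormedAddCommGroup E] [NormedSpace ℂ E]
    (X : E →L[ℂ] LocalModule ρ W) : adjoint (inclL ρ W) ∘L inclL ρ W ∘L X = X := by
  rw [← comp_assoc, adjoint_inclL_comp, id_comp]

variable {ρ W}

theorem inclL_comp_adjoint_apply {v : K} (hv : v ∈ localSpace ρ W) :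
    inclL ρ W (adjoint (inclL ρ W) v) = v := by
  obtain ⟨z, rfl⟩ : ∃ z : LocalModule ρ W, inclL ρ W z = v := ⟨(⟨v, hv⟩ : localSpace ρ W), rfl⟩
  have := congrArg (fun A : LocalModule ρ W →L[ℂ] LocalModule ρ W => A z) (adjoint_inclL_comp ρ W)
  exact congrArg _ this

theorem rep_mem_localSpace {f : C₀(Y, ℂ)} (hf : VanishesOff W f) (ξ : K) :
    ρ f ξ ∈ localSpace ρ W :=
  Submodule.le_topologicalClosure _ (Submodule.subset_span ⟨f, hf, ξ, rfl⟩)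

theorem inclL_adjoint_comp_rep {f : C₀(Y, ℂ)} (hf : VanishesOff W f) :
    inclL ρ W ∘L adjoint (inclL ρ W) ∘L ρ f = ρ f := by
  ext1 ξ
  exact inclL_comp_adjoint_apply (rep_mem_localSpace hf ξ)

theorem rep_comp_inclL_adjoint {f : C₀(Y, ℂ)} (hf : VanishesOff W f) :
    ρ f ∘L inclL ρ W ∘L adjoint (inclL ρ W) = ρ f := by
  have := congrArg adjoint (inclL_adjoint_comp_rep (ρ := ρ) hf.star)
  rwa [adjoint_comp, adjoint_comp, adjoint_adjoint, adjoint_map, star_star, comp_assoc] at this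

/-- `C₀(W)`-elements of the image absorb the projection `P_W`. -/
theorem inclL_adjoint_comp_rep_assoc {f : C₀(Y, ℂ)} (hf : VanishesOff W f) {E : Type*}
    [NormedAddCommGroup E] [NormedSpace ℂ E] (X : E →L[ℂ] K) :
    inclL ρ W ∘L adjoint (inclL ρ W) ∘L ρ f ∘L X = ρ f ∘L X := by
  rw [← comp_assoc (adjoint _), ← comp_assoc (inclL ρ W), inclL_adjoint_comp_rep hf]

theorem rep_comp_inclL_adjoint_assoc {f : C₀(Y, ℂ)} (hf : VanishesOff W f) {E : Type*}
    [NormedAddCommGroup E] [NormedSpace ℂ E] (X : E →L[ℂ] K) :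
    ρ f ∘L inclL ρ W ∘L adjoint (inclL ρ W) ∘L X = ρ f ∘L X := by
  rw [← comp_assoc (inclL ρ W), ← comp_assoc (ρ f), rep_comp_inclL_adjoint hf]

theorem compressOp_extendOp (T : LocalModule ρ W →L[ℂ] LocalModule ρ W) :
    compressOp ρ W (extendOp ρ W T) = T := by
  rw [compressOp, extendOp, comp_assoc, adjoint_inclL_comp_assoc, comp_assoc, adjoint_inclL_comp,
    comp_id]

theorem extendOp_mul (S T : LocalModule ρ W →L[ℂ] LocalModule ρ W) :
    extendOp ρ W (S * T) = extendOp ρ W S ∘L extendOp ρ W T := by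
  simp only [extendOp, comp_assoc, adjoint_inclL_comp_assoc, mul_def]

theorem extendOp_star (T : LocalModule ρ W →L[ℂ] LocalModule ρ W) :
    extendOp ρ W (star T) = adjoint (extendOp ρ W T) := by
  simp only [extendOp, star_eq_adjoint, adjoint_comp, adjoint_adjoint, comp_assoc]

theorem extendOp_add (S T : LocalModule ρ W →L[ℂ] LocalModule ρ W) :
    extendOp ρ W (S + T) = extendOp ρ W S + extendOp ρ W T := by
  simp only [extendOp, add_comp, comp_add]

theorem extendOp_sub (S T : LocalModule ρ W →L[ℂ] LocalModule ρ W) :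
    extendOp ρ W (S - T) = extendOp ρ W S - extendOp ρ W T := by
  simp only [extendOp, sub_comp, comp_sub]

theorem extendOp_smul (c : ℂ) (T : LocalModule ρ W →L[ℂ] LocalModule ρ W) :
    extendOp ρ W (c • T) = c • extendOp ρ W T := by
  simp only [extendOp, smul_comp, comp_smul]

theorem compressOp_add (S T : K →L[ℂ] K) :
    compressOp ρ W (S + T) = compressOp ρ W S + compressOp ρ W T := by
  simp only [compressOp, add_comp, comp_add]

theorem compressOp_sub (S T : K →L[ℂ] K) :
    compressOp ρ W (S - T) = compressOp ρ W S - compressOp ρ W T := by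
  simp only [compressOp, sub_comp, comp_sub]

theorem compressOp_smul (c : ℂ) (T : K →L[ℂ] K) :
    compressOp ρ W (c • T) = c • compressOp ρ W T := by
  simp only [compressOp, smul_comp, comp_smul]

theorem compressOp_adjoint (T : K →L[ℂ] K) :
    compressOp ρ W (adjoint T) = star (compressOp ρ W T) := (compress_adjoint _ _).symm

theorem compressOp_id : compressOp ρ W (ContinuousLinearMap.id ℂ K) = 1 := by
  rw [compressOp, id_comp, adjoint_inclL_comp]; rfl

theorem norm_inclL_le : ‖inclL ρ W‖ ≤ 1 := LinearIsometry.norm_toContinuousLinearMap_le _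

theorem norm_comp_comp_le {E F G L : Type*} [NormedAddCommGroup E] [NormedSpace ℂ E]
    [NormedAddCommGroup F] [NormedSpace ℂ F] [NormedAddCommGroup G] [NormedSpace ℂ G]
    [NormedAddCommGroup L] [NormedSpace ℂ L] {A : G →L[ℂ] L} {B : E →L[ℂ] F} (hA : ‖A‖ ≤ 1)
    (hB : ‖B‖ ≤ 1) (T : F →L[ℂ] G) : ‖A ∘L T ∘L B‖ ≤ ‖T‖ :=
  calc ‖A ∘L T ∘L B‖ ≤ ‖A‖ * (‖T‖ * ‖B‖) :=
        (opNorm_comp_le _ _).trans (by gcongr; exact opNorm_comp_le _ _)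
    _ ≤ 1 * (‖T‖ * 1) := by gcongr
    _ = ‖T‖ := by ring

theorem norm_extendOp_le (T : LocalModule ρ W →L[ℂ] LocalModule ρ W) : ‖extendOp ρ W T‖ ≤ ‖T‖ :=
  norm_comp_comp_le norm_inclL_le (by rw [LinearIsometryEquiv.norm_map]; exact norm_inclL_le) T

theorem norm_compressOp_le (T : K →L[ℂ] K) : ‖compressOp ρ W T‖ ≤ ‖T‖ :=
  norm_comp_comp_le (by rw [LinearIsometryEquiv.norm_map]; exact norm_inclL_le) norm_inclL_le T

theorem continuous_extendOp : Continuous (extendOp ρ W) := by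
  unfold extendOp
  exact continuous_const.clm_comp (continuous_id.clm_comp continuous_const)

theorem continuous_compressOp : Continuous (compressOp ρ W) := by
  unfold compressOp
  exact continuous_const.clm_comp (continuous_id.clm_comp continuous_const)

theorem extendOp_compressOp (T : K →L[ℂ] K) : extendOp ρ W (compressOp ρ W T) =
    inclL ρ W ∘L adjoint (inclL ρ W) ∘L T ∘L inclL ρ W ∘L adjoint (inclL ρ W) := by
  simp only [extendOp, compressOp, comp_assoc]

theorem compressOp_comp_rep {f : C₀(Y, ℂ)} (hf : VanishesOff W f) (T : K →L[ℂ] K) :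
    compressOp ρ W T * localRep ρ W f = compressOp ρ W (T ∘L ρ f) := by
  rw [localRep_eq, mul_def, compressOp, compressOp, compressOp]
  simp only [comp_assoc]
  rw [inclL_adjoint_comp_rep_assoc hf]

theorem rep_comp_compressOp {f : C₀(Y, ℂ)} (hf : VanishesOff W f) (T : K →L[ℂ] K) :
    localRep ρ W f * compressOp ρ W T = compressOp ρ W (ρ f ∘L T) := by
  rw [localRep_eq, mul_def, compressOp, compressOp, compressOp]
  simp only [comp_assoc]
  rw [rep_comp_inclL_adjoint_assoc hf]

theorem extendOp_localRep {f : C₀(Y, ℂ)} (hf : VanishesOff W f) :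
    extendOp ρ W (localRep ρ W f) = ρ f := by
  rw [localRep_eq, extendOp_compressOp, rep_comp_inclL_adjoint hf, inclL_adjoint_comp_rep hf]

theorem CompactEq.extendOp {S T : LocalModule ρ W →L[ℂ] LocalModule ρ W} (h : S ≈ₖ T) :
    extendOp ρ W S ≈ₖ extendOp ρ W T :=
  (h.comp_right _).comp_left _

theorem CompactEq.compressOp {S T : K →L[ℂ] K} (h : S ≈ₖ T) :
    compressOp ρ W S ≈ₖ compressOp ρ W T :=
  (h.comp_right _).comp_left _

theorem PseudolocalOn.isPseudolocal_compressOp {T : K →L[ℂ] K} (hT : PseudolocalOn ρ W T) :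
    IsPseudolocal ρ W (compressOp ρ W T) := fun f hf => by
  rw [compressOp_comp_rep hf, rep_comp_compressOp hf]
  exact (hT f hf).compressOp

theorem LocCompactOn.isLocallyCompactOp_compressOp {T : K →L[ℂ] K} (hT : LocCompactOn ρ W T) :
    IsLocallyCompactOp ρ W (compressOp ρ W T) := fun f hf => by
  have h0 : compressOp ρ W (0 : K →L[ℂ] K) = 0 := by rw [compressOp, zero_comp, comp_zero]
  rw [compressOp_comp_rep hf, rep_comp_compressOp hf, ← compactEq_zero, ← compactEq_zero, ← h0]
  exact ⟨(hT f hf).1.compressOp, (hT f hf).2.compressOp⟩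

/-- Extension by zero brings the operators on the various P_W K to one Hilbert space, where
operators belonging to different open sets can be subtracted and composed. -/
theorem isPseudolocal_iff {T : LocalModule ρ W →L[ℂ] LocalModule ρ W} :
    IsPseudolocal ρ W T ↔ PseudolocalOn ρ W (extendOp ρ W T) := by
  refine ⟨fun h f hf => ?_, fun h => ?_⟩
  · rw [← extendOp_localRep hf, ← extendOp_mul, ← extendOp_mul]
    exact CompactEq.extendOp (h f hf)
  · rw [← compressOp_extendOp T]; exact h.isPseudolocal_compressOp

theorem isLocallyCompactOp_iff {T : LocalModule ρ W →L[ℂ] LocalModule ρ W} :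
    IsLocallyCompactOp ρ W T ↔ LocCompactOn ρ W (extendOp ρ W T) := by
  refine ⟨fun h f hf => ?_, fun h => ?_⟩
  · have h0 : extendOp ρ W (0 : LocalModule ρ W →L[ℂ] LocalModule ρ W) = 0 := by
      rw [_root_.extendOp, zero_comp, comp_zero]
    rw [← extendOp_localRep hf, ← extendOp_mul, ← extendOp_mul, ← h0]
    exact ⟨CompactEq.extendOp (compactEq_zero.2 (h f hf).1),
      CompactEq.extendOp (compactEq_zero.2 (h f hf).2)⟩
  · rw [← compressOp_extendOp T]; exact h.isLocallyCompactOp_compressOp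

/-- With P the projection onto P_W K and f ∈ C₀(W), the operator ρ(f) absorbs P. Modulo compacts,
PTPρ(f) = PTρ(f) ≈ Pρ(f)T = ρ(f)T ≈ Tρ(f), and similarly on the left. So T and PTP are
interchangeable over W, although P itself need not be ρ of a function. -/
theorem PseudolocalOn.extendOp_compressOp_sub {T : K →L[ℂ] K} (hT : PseudolocalOn ρ W T) :
    LocCompactOn ρ W (extendOp ρ W (compressOp ρ W T) - T) := fun f hf => by
  rw [sub_comp, comp_sub, CompactEq.sub_zero_iff, CompactEq.sub_zero_iff, extendOp_compressOp]
  constructor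
  · simp only [comp_assoc]
    rw [inclL_adjoint_comp_rep hf]
    refine (((hT f hf).comp_left _).comp_left _).trans ?_
    rw [inclL_adjoint_comp_rep_assoc hf]
    exact (hT f hf).symm
  · rw [rep_comp_inclL_adjoint_assoc hf, ← comp_assoc]
    refine ((hT f hf).symm.comp_right _).trans ?_
    rw [comp_assoc, rep_comp_inclL_adjoint hf]
    exact hT f hf

/-- Compression is multiplicative up to locally compact operators. -/
theorem PseudolocalOn.compressOp_comp_sub {S T : K →L[ℂ] K} (hS : PseudolocalOn ρ W S)
    (hT : PseudolocalOn ρ W T) : IsLocallyCompactOp ρ W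
      (compressOp ρ W (S ∘L T) - compressOp ρ W S * compressOp ρ W T) := by
  -- With this form of the product, the multiplicativity defect becomes the compression of S(T −
  -- PTP), where T − PTP is locally compact over W.
  have e : compressOp ρ W S * compressOp ρ W T =
      compressOp ρ W (S ∘L extendOp ρ W (compressOp ρ W T)) := by
    rw [extendOp_compressOp, mul_def]
    simp only [compressOp, comp_assoc]
    rw [adjoint_inclL_comp, comp_id]
  rw [e, ← compressOp_sub, ← comp_sub, ← neg_sub, comp_neg]
  exact (hT.extendOp_compressOp_sub.comp_left hS).neg.isLocallyCompactOp_compressOp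

/-- Operators on `P_W K` which agree on the vectors `ρ(f) ξ`, `f ∈ C₀(W)`, are equal. -/
theorem ext_localRep {E : Type*} [NormedAddCommGroup E] [NormedSpace ℂ E]
    {S T : LocalModule ρ W →L[ℂ] E}
    (h : ∀ f, VanishesOff W f → S ∘L localRep ρ W f = T ∘L localRep ρ W f) : S = T := by
  have h2 : ∀ f, VanishesOff W f → S ∘L adjoint (inclL ρ W) ∘L ρ f =
      T ∘L adjoint (inclL ρ W) ∘L ρ f := fun f hf => by
    have e : adjoint (inclL ρ W) ∘L ρ f = localRep ρ W f ∘L adjoint (inclL ρ W) := by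
      rw [localRep_eq, compressOp, comp_assoc, comp_assoc, rep_comp_inclL_adjoint hf]
    rw [e, ← comp_assoc, ← comp_assoc, h f hf]
  have h3 : localSpace ρ W ≤ LinearMap.ker
      ((S ∘L adjoint (inclL ρ W) - T ∘L adjoint (inclL ρ W)) : K →L[ℂ] E).toLinearMap := by
    refine Submodule.topologicalClosure_minimal _ (Submodule.span_le.2 ?_)
      (ContinuousLinearMap.isClosed_ker _)
    rintro _ ⟨f, hf, ξ, rfl⟩
    have := congrArg (fun A : K →L[ℂ] E => A ξ) (h2 f hf)
    exact sub_eq_zero.2 this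
  ext1 v
  have := h3 (localIncl_mem v)
  have hv : adjoint (inclL ρ W) (localIncl ρ W v) = v :=
    congrArg (fun A : LocalModule ρ W →L[ℂ] LocalModule ρ W => A v) (adjoint_inclL_comp ρ W)
  have h4 : S (adjoint (inclL ρ W) (localIncl ρ W v)) -
    T (adjoint (inclL ρ W) (localIncl ρ W v)) = 0 := this
  rw [hv] at h4
  exact sub_eq_zero.1 h4

end LocalModules

/-! ### Calculus of the operators h ↦ f ⊗ h -/

section TensorCalculus

open ContinuousLinearMap
open CompactlySupportedContinuousMap hiding comp_assoc comp_id zero_comp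
open scoped CompactlySupported

set_option linter.unusedSectionVars false

namespace NormalCovering

variable {Γ Y X : Type*} [Group Γ] [TopologicalSpace Y] [TopologicalSpace X] [MulAction Γ Y]
  [T2Space X] [CompactSpace X]
  {H : Type*} [NormedAddCommGroup H] [InnerProductSpace ℂ H] [CompleteSpace H]
  (π : NormalCovering Γ Y X) (ρ : C₀(X, ℂ) →⋆ₙₐ[ℂ] (H →L[ℂ] H))

theorem proj_smul (γ : Γ) (y : Y) : π.proj (γ • y) = π.proj y := π.isQuotientCoveringMap.map_smul γ

theorem mem_preimage {U : Opens X} {y : Y} : y ∈ π.preimage U ↔ π.proj y ∈ U := Iff.rfl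

theorem preimage_mono {U V : Opens X} (h : U ≤ V) : π.preimage U ≤ π.preimage V := fun _ hy => h hy

@[simp]
theorem translate_apply (γ : Γ) (f : C_c(Y, ℂ)) (y : Y) : π.translate γ f y = f (γ⁻¹ • y) := rfl

theorem translate_mul (γ : Γ) (f g : C_c(Y, ℂ)) :
    π.translate γ (f * g) = π.translate γ f * π.translate γ g := rfl

theorem translate_translate (γ δ : Γ) (f : C_c(Y, ℂ)) :
    π.translate γ (π.translate δ f) = π.translate (γ * δ) f := by
  ext y
  simp [mul_smul]

/-- The product of `a ∘ π`, for `a ∈ C(X)`, with a compactly supported function on `Y`. -/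
noncomputable def pullMul (a : C₀(X, ℂ)) (f : C_c(Y, ℂ)) : C_c(Y, ℂ) :=
  bmul ⟨fun y => a (π.proj y), a.continuous.comp π.continuous_proj⟩ f

@[simp]
theorem pullMul_apply (a : C₀(X, ℂ)) (f : C_c(Y, ℂ)) (y : Y) :
    π.pullMul a f y = a (π.proj y) * f y := rfl

theorem tsupport_pullMul (a : C₀(X, ℂ)) (f : C_c(Y, ℂ)) : tsupport (π.pullMul a f) ⊆ tsupport f :=
  tsupport_mul_subset_right (f := fun y => a (π.proj y)) (g := f)

/-- The function a ∘ π is constant along fibres and leaves the fibre sum: summation over fibres is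
C(X)-linear. -/
theorem push_mul_pullMul (a : C₀(X, ℂ)) (k f : C_c(Y, ℂ)) :
    π.push (k * π.pullMul a f) = π.push (k * f) * a := by
  ext x
  obtain ⟨y, rfl⟩ := π.isQuotientCoveringMap.surjective x
  change _ = π.push (k * f) (π.proj y) * a (π.proj y)
  rw [push_apply, push_apply, mul_comm _ (a (π.proj y)), ← smul_eq_mul (a (π.proj y)), smul_finsum]
  refine finsum_congr fun γ => ?_
  simp only [mul_apply, pullMul_apply, proj_smul, smul_eq_mul]
  ring

theorem push_vanishesOff {U : Opens X} {f : C_c(Y, ℂ)} (hf : ∀ y, π.proj y ∉ U → f y = 0) :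
    VanishesOff U (π.push f) := fun x hx => by
  obtain ⟨y, rfl⟩ := π.isQuotientCoveringMap.surjective x
  rw [push_apply]
  have : ∀ γ : Γ, f (γ • y) = 0 := fun γ => hf _ (by rwa [proj_smul])
  simp [this]

theorem vanish_of_tsupport {U : Opens X} {f : C_c(Y, ℂ)} (hf : tsupport f ⊆ π.preimage U) (y : Y)
    (hy : π.proj y ∉ U) : f y = 0 := image_eq_zero_of_notMem_tsupport fun h => hy (hf h)

theorem push_vanishesOff_right {U : Opens X} (k : C_c(Y, ℂ)) {f : C_c(Y, ℂ)}
    (hf : tsupport f ⊆ π.preimage U) : VanishesOff U (π.push (k * f)) :=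
  π.push_vanishesOff fun y hy => by rw [mul_apply, π.vanish_of_tsupport hf y hy, mul_zero]

/-- The inner product of the induced module in operator form. The computations on H̃ below reduce,
through this identity, to computations with ρ on H. -/
theorem adjoint_tensor_comp_tensor (f g : C_c(Y, ℂ)) :
    adjoint (π.tensor ρ f) ∘L π.tensor ρ g = ρ (π.push (star f * g)) := by
  ext1 h
  refine ext_inner_left ℂ fun h' => ?_
  rw [comp_apply, adjoint_inner_right, inner_tensor]

theorem adjoint_tensor_comp_tensor_assoc {E : Type*} [NormedAddCommGroup E] [NormedSpace ℂ E]
    (f g : C_c(Y, ℂ)) (T : E →L[ℂ] H) :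
    adjoint (π.tensor ρ f) ∘L π.tensor ρ g ∘L T = ρ (π.push (star f * g)) ∘L T := by
  rw [← comp_assoc, adjoint_tensor_comp_tensor]

theorem inducedRep_comp_tensor (g f : C_c(Y, ℂ)) :
    π.inducedRep ρ g.toC₀ ∘L π.tensor ρ f = π.tensor ρ (g * f) := by
  ext1 h
  exact π.inducedRep_tensor ρ g.toC₀ f h

theorem adjoint_tensor_mul (g f : C_c(Y, ℂ)) :
    adjoint (π.tensor ρ (g * f)) = adjoint (π.tensor ρ f) ∘L π.inducedRep ρ (star g).toC₀ := by
  rw [← inducedRep_comp_tensor, adjoint_comp, adjoint_map_toC₀]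

theorem adjoint_tensor_comp_inducedRep (g f : C_c(Y, ℂ)) :
    adjoint (π.tensor ρ f) ∘L π.inducedRep ρ g.toC₀ = adjoint (π.tensor ρ (star g * f)) := by
  rw [adjoint_tensor_mul, star_star]

theorem translation_comp_tensor (γ : Γ) (f : C_c(Y, ℂ)) :
    π.inducedTranslation ρ γ ∘L π.tensor ρ f = π.tensor ρ (π.translate γ f) := by
  ext1 h
  exact π.inducedTranslation_tensor ρ γ f h

theorem adjoint_translation (γ : Γ) :
    adjoint (π.inducedTranslation ρ γ) = π.inducedTranslation ρ γ⁻¹ :=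
  π.inducedTranslation_star ρ γ

theorem adjoint_tensor_translate (γ : Γ) (f : C_c(Y, ℂ)) :
    adjoint (π.tensor ρ (π.translate γ f)) =
      adjoint (π.tensor ρ f) ∘L π.inducedTranslation ρ γ⁻¹ := by
  rw [← translation_comp_tensor, adjoint_comp, adjoint_translation]

theorem translation_inv_comp (γ : Γ) : π.inducedTranslation ρ γ⁻¹ ∘L π.inducedTranslation ρ γ =
    ContinuousLinearMap.id ℂ _ := by
  rw [← mul_def, ← inducedTranslation_mul, inv_mul_cancel, inducedTranslation_one]; rfl

/-- The tensor product is balanced over C(X): f ⊗ ρ(a)h = (a ∘ π)f ⊗ h. Both sides have the same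
inner products with all elementary tensors. -/
theorem tensor_comp_rep (f : C_c(Y, ℂ)) (a : C₀(X, ℂ)) :
    π.tensor ρ f ∘L ρ a = π.tensor ρ (π.pullMul a f) := by
  ext1 h
  refine π.ext_inner_tensor ρ fun k x => ?_
  rw [comp_apply, inner_tensor, inner_tensor, push_mul_pullMul, map_mul_comp]
  rfl

theorem rep_comp_adjoint_tensor (f : C_c(Y, ℂ)) (a : C₀(X, ℂ)) :
    ρ a ∘L adjoint (π.tensor ρ f) = adjoint (π.tensor ρ (π.pullMul (star a) f)) := by
  rw [← tensor_comp_rep, adjoint_comp, adjoint_map, star_star]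

theorem tensor_sum {ι : Type*} (s : Finset ι) (f : ι → C_c(Y, ℂ)) :
    π.tensor ρ (∑ i ∈ s, f i) = ∑ i ∈ s, π.tensor ρ (f i) :=
  map_sum (AddMonoidHom.mk' (π.tensor ρ) (π.tensor_add ρ)) f s

/-- The rank one operators of the Hilbert module: functions whose supports do not meet their
translates give multiplication operators. -/
theorem tensor_comp_adjoint_tensor {d : C_c(Y, ℂ)}
    (hd : ∀ γ : Γ, γ ≠ 1 → ∀ y, d y * d (γ • y) = 0) :
    π.tensor ρ d ∘L adjoint (π.tensor ρ d) = π.inducedRep ρ (d * star d).toC₀ := by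
  refine π.ext_tensor ρ fun g h => ?_
  have h1 : adjoint (π.tensor ρ d) (π.tensor ρ g h) = ρ (π.push (star d * g)) h :=
    congrArg (fun A : H →L[ℂ] H => A h) (π.adjoint_tensor_comp_tensor ρ d g)
  have h2 : π.tensor ρ d (ρ (π.push (star d * g)) h) =
      π.tensor ρ (π.pullMul (π.push (star d * g)) d) h := by
    rw [← tensor_comp_rep]; rfl
  have h3 : π.inducedRep ρ (d * star d).toC₀ (π.tensor ρ g h) =
      π.tensor ρ (d * star d * g) h := by
    rw [← inducedRep_comp_tensor]; rfl
  rw [comp_apply, h1, h2, h3]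
  congr 2
  ext y
  rw [pullMul_apply, push_apply, mul_apply, mul_apply]
  by_cases hy : d y = 0
  · simp [hy]
  -- At a point y with d(y) ≠ 0 all d(γy) with γ ≠ 1 vanish, so the fibre sum reduces to the term at
  -- y.
  · rw [finsum_eq_single _ (1 : Γ) fun γ hγ => ?_]
    · simp only [one_smul, mul_apply]; ring
    · have : d (γ • y) = 0 := (mul_eq_zero.1 (hd γ hγ y)).resolve_left hy
      simp [this]

/-- Shows that these fibre sums are real and nonnegative, which allows a frame to be normalized by a
square root. -/
theorem push_star_mul_self (c : C_c(Y, ℂ)) (y : Y) :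
    π.push (star c * c) (π.proj y) = ((∑ᶠ γ : Γ, ‖c (γ • y)‖ ^ 2 : ℝ) : ℂ) := by
  rw [push_apply]
  have := (Complex.ofRealHom.toAddMonoidHom).map_finsum
    (f := fun γ : Γ => ‖c (γ • y)‖ ^ 2) ((π.finite_support c y).subset fun γ hγ => by
      contrapose! hγ
      have : c (γ • y) = 0 := by simpa using hγ
      simp [this])
  refine Eq.trans (finsum_congr fun γ => ?_) this.symm
  change star (c (γ • y)) * c (γ • y) = ((‖c (γ • y)‖ ^ 2 : ℝ) : ℂ)
  have := Complex.conj_mul' (c (γ • y))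
  push_cast
  exact this

end NormalCovering

end TensorCalculus

/-! ### Existence of frames -/

section Frames

open ContinuousLinearMap
open CompactlySupportedContinuousMap hiding comp_assoc comp_id zero_comp
open scoped CompactlySupported

variable {Γ Y X : Type*} [Group Γ] [TopologicalSpace Y] [TopologicalSpace X] [MulAction Γ Y]
  [T2Space X] [CompactSpace X]

/-- A finite family in `C_c(Y)` whose translates form a partition of unity of squares; the supports
lie in sets which do not meet their translates, as witnessed by the functions `n k`. -/
structure CoveringFrame (π : NormalCovering Γ Y X) where
  m : ℕ
  f : Fin m → C_c(Y, ℂ)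
  n : Fin m → C_c(Y, ℂ)
  n_mul : ∀ k, n k * f k = f k
  disj : ∀ k (γ : Γ), γ ≠ 1 → ∀ y, n k y * n k (γ • y) = 0
  sum_push : ∀ x, ∑ k, π.push (star (f k) * f k) x = 1

namespace CoveringFrame

/-- Bumps c_y supported in sets disjoint from their translates are nonzero on open sets whose images
cover X, and by compactness finitely many suffice. The function s = ∑ p(|c_y|²) is then strictly
positive on X, and multiplying the bumps by s^{-1/2} ∘ π normalizes the family without enlarging
supports. -/
theorem nonempty (π : NormalCovering Γ Y X) : Nonempty (CoveringFrame π) := by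
  have := π.t2Space
  have := π.locallyCompactSpace
  have hN : ∀ y : Y, ∃ N : Opens Y, y ∈ N ∧
      ∀ γ : Γ, ∀ z ∈ N, γ • z ∈ N → γ = 1 := fun y => by
    obtain ⟨N, hN, hd⟩ := π.isQuotientCoveringMap.disjoint y
    obtain ⟨N', hN', ho, hy⟩ := mem_nhds_iff.1 hN
    exact ⟨⟨N', ho⟩, hy, fun γ z hz hγ => hd γ ⟨γ • z, ⟨z, hN' hz, rfl⟩, hN' hγ⟩⟩
  choose N hyN hNd using hN
  have hc : ∀ y, ∃ c : C_c(Y, ℂ), tsupport c ⊆ N y ∧ c y = 1 := fun y => by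
    obtain ⟨c, hcN, hc1, -⟩ := exists_cutoff (isCompact_singleton (x := y)) (W := N y)
      (Set.singleton_subset_iff.2 (hyN y))
    exact ⟨c, hcN, hc1 y rfl⟩
  choose c hcN hc1 using hc
  -- The witness n_y equals 1 on the support of c_y and is still supported in N_y, hence meets none
  -- of its proper translates. It is unaffected by the later normalization.
  have hn : ∀ y, ∃ n : C_c(Y, ℂ), tsupport n ⊆ N y ∧ ∀ z ∈ tsupport (c y), n z = 1 := fun y => by
    obtain ⟨n, hnN, hn1, -⟩ := exists_cutoff (c y).hasCompactSupport (hcN y)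
    exact ⟨n, hnN, hn1⟩
  choose n hnN hn1 using hn
  obtain ⟨t, ht⟩ := (isCompact_univ (X := X)).elim_finite_subcover
    (fun y => π.proj '' {z | c y z ≠ 0})
    (fun y => π.isQuotientCoveringMap.isOpenQuotientMap.isOpenMap _
      (isOpen_ne_fun (c y).continuous continuous_const)) (fun x _ => by
      obtain ⟨y, rfl⟩ := π.isQuotientCoveringMap.surjective x
      exact Set.mem_iUnion.2 ⟨y, y, by simp [hc1], rfl⟩)
  let s : C₀(X, ℂ) := ∑ y ∈ t, π.push (star (c y) * c y)
  have hsum : ∀ z, s (π.proj z) = ((∑ y ∈ t, ∑ᶠ γ : Γ, ‖c y (γ • z)‖ ^ 2 : ℝ) : ℂ) := fun z => by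
    rw [Complex.ofReal_sum]
    simp only [← π.push_star_mul_self]
    exact map_sum (⟨⟨fun g : C₀(X, ℂ) => g (π.proj z), rfl⟩, fun _ _ => rfl⟩ : C₀(X, ℂ) →+ ℂ) _ t
  have hpos : ∀ z, 0 < (s (π.proj z)).re := fun z => by
    rw [hsum, Complex.ofReal_re]
    obtain ⟨y, hy, w, hw, hwz⟩ := Set.mem_iUnion₂.1 (ht (Set.mem_univ (π.proj z)))
    obtain ⟨γ, hγ⟩ := π.isQuotientCoveringMap.apply_eq_iff_mem_orbit.1 hwz
    have hγ' : γ • z = w := hγ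
    have h0 : ∀ y', 0 ≤ ∑ᶠ γ : Γ, ‖c y' (γ • z)‖ ^ 2 := fun y' =>
      finsum_nonneg fun γ => by positivity
    have hfin : (Function.support fun γ : Γ => ‖c y (γ • z)‖ ^ 2).Finite :=
      (π.finite_support (c y) z).subset fun γ hγ => by
        contrapose! hγ
        have : c y (γ • z) = 0 := by simpa using hγ
        simp [this]
    calc (0 : ℝ) < ‖c y (γ • z)‖ ^ 2 := by
          rw [hγ']
          have : 0 < ‖c y w‖ := norm_pos_iff.2 hw
          positivity
      _ ≤ ∑ᶠ γ : Γ, ‖c y (γ • z)‖ ^ 2 :=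
          single_le_finsum γ hfin fun γ => by positivity
      _ ≤ _ := Finset.single_le_sum (f := fun y => ∑ᶠ γ : Γ, ‖c y (γ • z)‖ ^ 2)
          (fun y' _ => h0 y') hy
  have hpos' : ∀ x, 0 < (s x).re := fun x => by
    obtain ⟨z, rfl⟩ := π.isQuotientCoveringMap.surjective x
    exact hpos z
  have hre : ∀ x, s x = ((s x).re : ℂ) := fun x => by
    obtain ⟨z, rfl⟩ := π.isQuotientCoveringMap.surjective x
    rw [hsum, Complex.ofReal_re]
  -- The normalizing factor s^{-1/2}, a function on the base, so that it comes out of fibre sums.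
  let r : C₀(X, ℂ) := ⟨⟨fun x => ((Real.sqrt (s x).re)⁻¹ : ℝ), by
    refine Complex.continuous_ofReal.comp (Continuous.inv₀ ?_ fun x => ?_)
    · fun_prop
    · exact (Real.sqrt_pos.2 (hpos' x)).ne'⟩, by simp⟩
  have hrs : ∀ x, star (r x) * r x * s x = 1 := fun x => by
    have h1 : star (r x) = r x := Complex.conj_ofReal _
    have h2 : (Real.sqrt (s x).re)⁻¹ * (Real.sqrt (s x).re)⁻¹ * (s x).re = 1 := by
      have := Real.mul_self_sqrt (hpos' x).le
      have h3 := (Real.sqrt_pos.2 (hpos' x)).ne'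
      field_simp
      rw [sq]; exact this.symm
    rw [h1, hre x]
    change (((Real.sqrt (s x).re)⁻¹ : ℝ) : ℂ) * (((Real.sqrt (s x).re)⁻¹ : ℝ) : ℂ) * _ = 1
    rw [← Complex.ofReal_mul, ← Complex.ofReal_mul, h2, Complex.ofReal_one]
  have hpush : ∀ y, π.push (star (π.pullMul r (c y)) * π.pullMul r (c y)) =
      star r * r * π.push (star (c y) * c y) := fun y => by
    have e : star (π.pullMul r (c y)) = π.pullMul (star r) (star (c y)) := by
      ext z
      change star (r (π.proj z) * c y z) = star (r (π.proj z)) * star (c y z)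
      rw [star_mul, mul_comm]
    rw [π.push_mul_pullMul, e, mul_comm (π.pullMul _ _), π.push_mul_pullMul, mul_comm (c y),
      mul_assoc, mul_comm]
  refine ⟨⟨t.card, fun i => π.pullMul r (c (t.equivFin.symm i)), fun i => n (t.equivFin.symm i),
    fun i => mul_eq_right_of_one fun z hz => hn1 _ z (π.tsupport_pullMul _ _ hz),
    fun i γ hγ y => ?_, fun x => ?_⟩⟩
  · by_contra hne
    rw [mul_eq_zero, not_or] at hne
    exact hγ (hNd _ γ y (hnN _ (subset_tsupport _ hne.1)) (hnN _ (subset_tsupport _ hne.2)))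
  · simp only [hpush]
    change ∑ i, star (r x) * r x * π.push (star (c (t.equivFin.symm i)) * c (t.equivFin.symm i)) x = 1
    rw [← Finset.mul_sum, ← hrs x]
    congr 1
    have e : s x = ∑ y ∈ t, π.push (star (c y) * c y) x :=
      map_sum (⟨⟨fun g : C₀(X, ℂ) => g x, rfl⟩, fun _ _ => rfl⟩ : C₀(X, ℂ) →+ ℂ) _ t
    rw [e, ← Finset.sum_coe_sort t]
    exact t.equivFin.symm.sum_comp fun y : t => π.push (star (c y) * c y) x

end CoveringFrame

end Frames

/-! ### The frame of translates, and lifts of operators -/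

section Lifts

open ContinuousLinearMap
open CompactlySupportedContinuousMap hiding comp_assoc comp_id zero_comp
open scoped CompactlySupported

set_option linter.unusedSectionVars false

variable {Γ Y X : Type*} [Group Γ] [TopologicalSpace Y] [TopologicalSpace X] [MulAction Γ Y]
  [T2Space X] [CompactSpace X]
  {H : Type*} [NormedAddCommGroup H] [InnerProductSpace ℂ H] [CompleteSpace H]
  {π : NormalCovering Γ Y X} (D : CoveringFrame π) (ρ : C₀(X, ℂ) →⋆ₙₐ[ℂ] (H →L[ℂ] H))

namespace CoveringFrame

/-- The translates of the functions of a frame. -/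
noncomputable def e (i : Fin D.m × Γ) : C_c(Y, ℂ) := π.translate i.2 (D.f i.1)

/-- The translates of the witnesses. -/
noncomputable def ν (i : Fin D.m × Γ) : C_c(Y, ℂ) := π.translate i.2 (D.n i.1)

theorem ν_mul_e (i : Fin D.m × Γ) : D.ν i * D.e i = D.e i := by
  rw [ν, e, ← π.translate_mul, D.n_mul]

/-- Translating the witness by i.2 conjugates γ, and a conjugate of γ ≠ 1 is again different from 1.
-/
theorem ν_disj (i : Fin D.m × Γ) {γ : Γ} (hγ : γ ≠ 1) (y : Y) : D.ν i y * D.ν i (γ • y) = 0 := by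
  have h := D.disj i.1 (i.2⁻¹ * γ * i.2) (fun h => hγ (by
    rw [← conj_eq_one_iff (a := i.2⁻¹), inv_inv]; exact h)) (i.2⁻¹ • y)
  rwa [mul_smul, smul_inv_smul, mul_smul] at h

theorem e_disj (i : Fin D.m × Γ) {γ : Γ} (hγ : γ ≠ 1) (y : Y) : D.e i y * D.e i (γ • y) = 0 := by
  rw [← D.ν_mul_e, mul_apply, mul_apply]
  linear_combination D.e i y * D.e i (γ • y) * D.ν_disj i hγ y

/-- The frame is locally finite. -/
theorem exists_finset {L : Set Y} (hL : IsCompact L) : ∃ G : Finset Γ,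
    (∀ i : Fin D.m × Γ, i.2 ∉ G → ∀ y ∈ L, D.e i y = 0) ∧
    ∀ y ∈ L, ∑ i ∈ Finset.univ ×ˢ G, D.e i y * star (D.e i y) = 1 := by
  classical
  have hfin : ∀ k, {γ : Γ | ∃ a ∈ tsupport (D.f k), γ • a ∈ L}.Finite := fun k =>
    π.finite_meet (D.f k).hasCompactSupport hL
  let G : Finset Γ := Finset.univ.biUnion fun k => (hfin k).toFinset
  have hG : ∀ i : Fin D.m × Γ, i.2 ∉ G → ∀ y ∈ L, D.e i y = 0 := by
    rintro ⟨k, γ⟩ hγ y hy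
    by_contra hne
    refine hγ (Finset.mem_biUnion.2 ⟨k, Finset.mem_univ _, (hfin k).mem_toFinset.2 ?_⟩)
    exact ⟨γ⁻¹ • y, subset_tsupport _ hne, by rwa [smul_inv_smul]⟩
  refine ⟨G, hG, fun y hy => ?_⟩
  rw [← D.sum_push (π.proj y), Finset.sum_product]
  refine Finset.sum_congr rfl fun k _ => ?_
  -- The fibre sum evaluates f_k at γy and the translate e_{k,γ} evaluates it at γ⁻¹y; inversion in
  -- Γ matches the two.
  rw [π.push_apply, ← finsum_comp_equiv (Equiv.inv Γ),
    finsum_eq_sum_of_support_subset (s := G)]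
  · refine Finset.sum_congr rfl fun γ _ => ?_
    exact mul_comm _ _
  · intro γ hγ
    by_contra hγG
    have : D.f k (γ⁻¹ • y) = 0 := hG (k, γ) hγG y hy
    exact hγ (by simp [this])

/-- The sum of ‖t_{e_i}⋆ ξ‖² over a finite set is ⟨ξ, gξ⟩ with g = ∑ |e_i|² over that set, because
t_{e_i} t_{e_i}⋆ is multiplication by |e_i|². Since the squares over all i sum to 1, g has norm at
most 1. -/
theorem isBesselFamily :
    IsBesselFamily fun i : Fin D.m × Γ => adjoint (π.tensor ρ (D.e i)) := by
  classical
  intro s ξ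
  let g : C_c(Y, ℂ) := ∑ i ∈ s, D.e i * star (D.e i)
  have hg : ‖g.toC₀‖ ≤ 1 := by
    refine (BoundedContinuousFunction.norm_le zero_le_one (f := g.toC₀.toBCF)).2 fun y => ?_
    change ‖(∑ i ∈ s, D.e i * star (D.e i)) y‖ ≤ 1
    obtain ⟨G, -, hG⟩ := D.exists_finset (isCompact_singleton (x := y))
    have h1 : ∀ t : Finset (Fin D.m × Γ), (∑ i ∈ t, D.e i y * star (D.e i y)) =
        ((∑ i ∈ t, ‖D.e i y‖ ^ 2 : ℝ) : ℂ) := fun t => by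
      push_cast
      exact Finset.sum_congr rfl fun i _ => Complex.mul_conj' _
    -- The squares over G at y already sum to 1, and so do those over the union with G'. A further
    -- nonzero term at an index of G' would make the sum exceed 1, and outside G' the terms vanish.
    have h2 : ∀ i, i ∉ Finset.univ ×ˢ G → D.e i y = 0 := by
      obtain ⟨G', hG', hG1⟩ := D.exists_finset (isCompact_singleton (x := y))
      intro i hi
      have e1 := hG y rfl
      have e2 := hG1 y rfl
      have e3 : (∑ j ∈ (Finset.univ ×ˢ G) ∪ (Finset.univ ×ˢ G'), ‖D.e j y‖ ^ 2 : ℝ) = 1 := by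
        rw [← Finset.sum_subset Finset.subset_union_right]
        · exact_mod_cast (h1 _).symm.trans e2
        · intro j _ hj
          rw [hG' j (fun h => hj (by simpa using h)) y rfl]; simp
      have e4 : (∑ j ∈ (Finset.univ ×ˢ G), ‖D.e j y‖ ^ 2 : ℝ) = 1 := by
        exact_mod_cast (h1 _).symm.trans e1
      by_cases hi' : i ∈ Finset.univ ×ˢ G'
      · have e5 : (∑ j ∈ insert i (Finset.univ ×ˢ G), ‖D.e j y‖ ^ 2 : ℝ) ≤ 1 := by
          rw [← e3]
          refine Finset.sum_le_sum_of_subset_of_nonneg ?_ fun j _ _ => by positivity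
          refine Finset.insert_subset (Finset.mem_union_right _ hi') Finset.subset_union_left
        rw [Finset.sum_insert hi, e4] at e5
        have : ‖D.e i y‖ ^ 2 = 0 := le_antisymm (by linarith) (by positivity)
        simpa using this
      · exact hG' i (fun h => hi' (by simpa using h)) y rfl
    have h3 : (∑ i ∈ s, ‖D.e i y‖ ^ 2 : ℝ) ≤ 1 := by
      have e4 : (∑ j ∈ (Finset.univ ×ˢ G), ‖D.e j y‖ ^ 2 : ℝ) = 1 := by
        exact_mod_cast (h1 _).symm.trans (hG y rfl)
      rw [← e4]
      refine (Finset.sum_le_sum_of_subset_of_nonneg Finset.subset_union_left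
        fun j _ _ => by positivity).trans (le_of_eq
          (Finset.sum_subset (Finset.subset_union_right (s₁ := s)) fun j _ hj => ?_).symm)
      rw [h2 j hj]; simp
    rw [CompactlySupportedContinuousMap.sum_apply]
    simp only [mul_apply, star_apply]
    rw [h1, Complex.norm_real, Real.norm_of_nonneg (Finset.sum_nonneg fun i _ => by positivity)]
    exact h3
  have hterm : ∀ i, ((‖adjoint (π.tensor ρ (D.e i)) ξ‖ ^ 2 : ℝ) : ℂ) =
      inner ℂ ξ (π.inducedRep ρ (D.e i * star (D.e i)).toC₀ ξ) := fun i => by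
    rw [← π.tensor_comp_adjoint_tensor ρ fun γ hγ y => D.e_disj i hγ y, comp_apply,
      ← adjoint_inner_left, inner_self_eq_norm_sq_to_K]
    push_cast; rfl
  have hsum : ((∑ i ∈ s, ‖adjoint (π.tensor ρ (D.e i)) ξ‖ ^ 2 : ℝ) : ℂ) =
      inner ℂ ξ (π.inducedRep ρ g.toC₀ ξ) := by
    rw [Complex.ofReal_sum, toC₀_sum, map_sum, _root_.sum_apply, inner_sum]
    exact Finset.sum_congr rfl fun i _ => hterm i
  have h1 : ‖inner ℂ ξ (π.inducedRep ρ g.toC₀ ξ)‖ ≤ ‖ξ‖ ^ 2 := by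
    refine (norm_inner_le_norm _ _).trans ?_
    rw [sq]
    gcongr
    refine ContinuousLinearMap.le_of_opNorm_le _
      ((NonUnitalStarAlgHom.norm_apply_le (π.inducedRep ρ) _).trans hg) ξ |>.trans ?_
    rw [one_mul]
  rw [← hsum, Complex.norm_real] at h1
  exact (Real.le_norm_self _).trans h1

/-- Local decompositions of the identity by operators factoring through `H`. -/
theorem exists_decomposition {W : Opens Y} {L : Set Y} (hL : IsCompact L) (hLW : L ⊆ W) :
    ∃ (k : C_c(Y, ℂ)) (s : Finset (Fin D.m × Γ)) (d : Fin D.m × Γ → C_c(Y, ℂ)),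
      (∀ y ∈ L, k y = 1) ∧ tsupport k ⊆ W ∧ (∀ i, tsupport (d i) ⊆ W) ∧
      π.inducedRep ρ k.toC₀ = ∑ i ∈ s, π.tensor ρ (d i) ∘L adjoint (π.tensor ρ (d i)) := by
  have := π.t2Space
  have := π.locallyCompactSpace
  obtain ⟨k, hkW, hk1, hks, -⟩ := exists_cutoff hL hLW
  obtain ⟨G, hG, hG1⟩ := D.exists_finset k.hasCompactSupport
  -- The square appears because d_i = k e_i contributes |d_i|² = k²|e_i|², with k real-valued, and
  -- the |e_i|² sum to 1 on the support of k.
  refine ⟨k * k, Finset.univ ×ˢ G, fun i => k * D.e i, fun y hy => by simp [hk1 y hy],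
    (tsupport_mul_left k k).trans hkW, fun i => (tsupport_mul_left k _).trans hkW, ?_⟩
  have hd : ∀ i (γ : Γ), γ ≠ 1 → ∀ y, (k * D.e i) y * (k * D.e i) (γ • y) = 0 :=
    fun i γ hγ y => by
      rw [mul_apply, mul_apply]
      linear_combination k y * k (γ • y) * D.e_disj i hγ y
  simp only [π.tensor_comp_adjoint_tensor ρ (hd _), ← map_sum, ← toC₀_sum]
  congr 2
  ext y
  rw [CompactlySupportedContinuousMap.sum_apply]
  have e1 : ∀ i, (k * D.e i * star (k * D.e i)) y = k y * k y * (D.e i y * star (D.e i y)) :=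
    fun i => by
      have : star (k y) = k y := DFunLike.congr_fun hks y
      simp only [mul_apply, star_apply, star_mul, this]
      ring
  simp only [e1, ← Finset.mul_sum]
  by_cases hy : y ∈ tsupport k
  · rw [hG1 y hy, mul_one, mul_apply]
  · rw [mul_apply, image_eq_zero_of_notMem_tsupport hy, zero_mul, zero_mul]

/-- The operator on `H` corresponding to an operator on the induced module. -/
noncomputable def psi (R : π.InducedModule ρ →L[ℂ] π.InducedModule ρ) : H →L[ℂ] H :=
  ∑ k, adjoint (π.tensor ρ (D.f k)) ∘L R ∘L π.tensor ρ (D.f k)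

/-- The definition of ψ uses only the f_k, but a factor ρ(p(q)) spreads it over the translates: p(q)
is a sum over Γ, and each term is carried by an element of Γ to a position near the support of q.
Invariance of R allows this, and only finitely many e_i are met. -/
theorem rep_push_comp_psi {R : π.InducedModule ρ →L[ℂ] π.InducedModule ρ}
    (hR : ∀ γ, R ∘L π.inducedTranslation ρ γ = π.inducedTranslation ρ γ ∘L R)
    {q : C_c(Y, ℂ)} {G : Finset Γ}
    (hG : ∀ i : Fin D.m × Γ, i.2 ∉ G → ∀ y ∈ tsupport q, D.e i y = 0) :
    ρ (π.push q) ∘L D.psi ρ R = ∑ i ∈ Finset.univ ×ˢ G,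
      adjoint (π.tensor ρ (star q * D.e i)) ∘L R ∘L π.tensor ρ (D.e i) := by
  rw [psi, comp_finsetSum, Finset.sum_product]
  refine Finset.sum_congr rfl fun k _ => ?_
  -- Where f_k(y) ≠ 0, a term q(δy) ≠ 0 puts δy in the support of q with e_{k,δ}(δy) = f_k(y) ≠ 0,
  -- so δ ∈ G.
  have h1 : π.pullMul (star (π.push q)) (D.f k) =
      ∑ δ ∈ G, π.translate δ⁻¹ (star q * D.e (k, δ)) := by
    ext y
    rw [CompactlySupportedContinuousMap.sum_apply]
    have h2 : ∀ δ : Γ, π.translate δ⁻¹ (star q * D.e (k, δ)) y = star (q (δ • y)) * D.f k y :=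
      fun δ => by simp [e]
    simp only [h2, ← Finset.sum_mul]
    change star (π.push q (π.proj y)) * D.f k y = _
    by_cases hy : D.f k y = 0
    · simp [hy]
    · rw [π.push_apply, finsum_eq_sum_of_support_subset (s := G), star_sum]
      intro δ hδ
      by_contra hδG
      have := hG (k, δ) hδG (δ • y) (subset_tsupport _ hδ)
      simp only [e, π.translate_apply, inv_smul_smul] at this
      exact hy this
  rw [← comp_assoc, π.rep_comp_adjoint_tensor, h1, π.tensor_sum, map_sum, finsetSum_comp]
  refine Finset.sum_congr rfl fun δ _ => ?_
  -- On both sides of R a translation can be split off, by δ on the left and by δ⁻¹ on the right;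
  -- these cancel since R commutes with them.
  have h3 : D.f k = π.translate δ⁻¹ (D.e (k, δ)) := by
    ext y; simp [e]
  have h4 : π.tensor ρ (D.f k) = π.inducedTranslation ρ δ⁻¹ ∘L π.tensor ρ (D.e (k, δ)) := by
    rw [π.translation_comp_tensor, ← h3]
  rw [π.adjoint_tensor_translate, h4, inv_inv, comp_assoc]
  congr 1
  have h5 := π.translation_inv_comp ρ δ⁻¹
  rw [inv_inv] at h5
  rw [← comp_assoc, ← hR, comp_assoc, ← comp_assoc (π.inducedTranslation ρ δ), h5, id_comp]

end CoveringFrame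

namespace NormalCovering

variable (π) {ρ} (U : Opens X)

/-- `R` acts on the sheets over `U` as `S`, up to compact operators. -/
def IsLift (R : π.InducedModule ρ →L[ℂ] π.InducedModule ρ) (S : H →L[ℂ] H) : Prop :=
  ∀ f f' : C_c(Y, ℂ), tsupport f ⊆ π.preimage U → tsupport f' ⊆ π.preimage U →
    adjoint (π.tensor ρ f) ∘L R ∘L π.tensor ρ f' ≈ₖ ρ (π.push (star f * f')) ∘L S

variable {π U}

namespace IsLift

variable {R R' : π.InducedModule ρ →L[ℂ] π.InducedModule ρ} {S S' : H →L[ℂ] H}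

theorem mono {V : Opens X} (h : U ≤ V) (hR : π.IsLift V R S) : π.IsLift U R S :=
  fun f f' hf hf' => hR f f' (hf.trans (π.preimage_mono h)) (hf'.trans (π.preimage_mono h))

theorem sub (hR : π.IsLift U R S) (hR' : π.IsLift U R' S') : π.IsLift U (R - R') (S - S') :=
  fun f f' hf hf' => by
    rw [sub_comp, comp_sub, comp_sub]
    exact (hR f f' hf hf').sub (hR' f f' hf hf')

/-- The function p(f̄ f') belongs to C₀(U), so ρ(p(f̄ f')) turns a locally compact change of S into
a compact one. -/
theorem of_compactEq (hR : π.IsLift U R S) (hS : LocCompactOn ρ U (S - S')) : π.IsLift U R S' :=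
  fun f f' hf hf' => by
    have := (hS _ (π.push_vanishesOff_right (star f) hf')).2
    rw [comp_sub, CompactEq.sub_zero_iff] at this
    exact (hR f f' hf hf').trans this

/-- A cutoff k equal to 1 on the support of f' satisfies t_{f'} = k t_{f'}, and (R − R')k is
compact. -/
theorem of_compactEq_lift (hR : π.IsLift U R S)
    (h : LocCompactOn (π.inducedRep ρ) (π.preimage U) (R - R')) : π.IsLift U R' S :=
  fun f f' hf hf' => by
    have := π.t2Space
    have := π.locallyCompactSpace
    obtain ⟨k, hkW, hk1, -⟩ := exists_cutoff f'.hasCompactSupport hf'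
    have h1 := (h _ (vanishesOff hkW)).1
    rw [sub_comp, CompactEq.sub_zero_iff] at h1
    have h2 : ∀ T : π.InducedModule ρ →L[ℂ] π.InducedModule ρ, T ∘L π.tensor ρ f' =
        (T ∘L π.inducedRep ρ k.toC₀) ∘L π.tensor ρ f' := fun T => by
      rw [comp_assoc, π.inducedRep_comp_tensor, mul_eq_right_of_one hk1]
    refine CompactEq.trans ?_ (hR f f' hf hf')
    rw [h2 R, h2 R']
    exact (h1.symm.comp_right _).comp_left _

theorem id : π.IsLift U (ContinuousLinearMap.id ℂ (π.InducedModule ρ))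
    (ContinuousLinearMap.id ℂ H) :=
  fun f f' _ _ => by
    rw [id_comp, comp_id, π.adjoint_tensor_comp_tensor]; exact CompactEq.refl _

/-- A cutoff k with k f' = f' is moved from the right to the left of R', and then replaced by its
decomposition ∑ t_{d_i} t_{d_i}⋆ through H. Each term splits into t_f⋆ R t_{d_i} and t_{d_i}⋆ R'
t_{f'}, to which the hypotheses apply; S is then commuted past the second coefficient, and the
coefficients recombine to ρ(p(f̄ f')). -/
theorem comp (hR : π.IsLift U R S) (hR' : π.IsLift U R' S')
    (hRP' : PseudolocalOn (π.inducedRep ρ) (π.preimage U) R') (hSP : PseudolocalOn ρ U S) :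
    π.IsLift U (R ∘L R') (S ∘L S') := fun f f' hf hf' => by
  obtain ⟨D⟩ := CoveringFrame.nonempty π
  obtain ⟨k, s, d, hk1, hkW, hdW, hk⟩ := D.exists_decomposition ρ f'.hasCompactSupport hf'
  have hkf : π.inducedRep ρ k.toC₀ ∘L π.tensor ρ f' = π.tensor ρ f' := by
    rw [π.inducedRep_comp_tensor, mul_eq_right_of_one hk1]
  have h1 : adjoint (π.tensor ρ f) ∘L (R ∘L R') ∘L π.tensor ρ f' ≈ₖ
      adjoint (π.tensor ρ f) ∘L R ∘L π.inducedRep ρ k.toC₀ ∘L R' ∘L π.tensor ρ f' := by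
    rw [comp_assoc]
    refine CompactEq.comp_left _ (CompactEq.comp_left _ ?_)
    nth_rewrite 1 [← hkf]
    rw [← comp_assoc, ← comp_assoc]
    exact (hRP' _ (vanishesOff hkW)).comp_right _
  have h2 : adjoint (π.tensor ρ f) ∘L R ∘L π.inducedRep ρ k.toC₀ ∘L R' ∘L π.tensor ρ f' =
      ∑ i ∈ s, (adjoint (π.tensor ρ f) ∘L R ∘L π.tensor ρ (d i)) ∘L
        (adjoint (π.tensor ρ (d i)) ∘L R' ∘L π.tensor ρ f') := by
    rw [hk]
    simp only [finsetSum_comp, comp_finsetSum, comp_assoc]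
  have h3 : ρ (π.push (star f * f')) ∘L S ∘L S' = ∑ i ∈ s,
      ρ (π.push (star f * d i)) ∘L ρ (π.push (star (d i) * f')) ∘L S ∘L S' := by
    have e : ρ (π.push (star f * f')) = ∑ i ∈ s,
        ρ (π.push (star f * d i)) ∘L ρ (π.push (star (d i) * f')) := by
      rw [← π.adjoint_tensor_comp_tensor, ← hkf, hk]
      simp only [finsetSum_comp, comp_finsetSum, comp_assoc, ← π.adjoint_tensor_comp_tensor]
    rw [e]
    simp only [finsetSum_comp, comp_assoc]
  refine h1.trans ?_
  rw [h2, h3]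
  refine CompactEq.sum s fun i _ => ?_
  refine ((hR' (d i) f' (hdW i) hf').comp_left _).trans ?_
  refine ((hR f (d i) hf (hdW i)).comp_right _).trans ?_
  rw [comp_assoc]
  refine CompactEq.comp_left _ ?_
  rw [← comp_assoc, ← comp_assoc]
  exact (hSP _ (π.push_vanishesOff_right _ hf')).comp_right _

/-- With b = 1 on the support of a, the frame identity gives a = ∑ p(|f_k|²) a, and p(|f_k|²) a is
the fibre sum of the conjugate of (b ∘ π)f_k times (a ∘ π)f_k. Each ρ(p(|f_k|²) a)S is thus, modulo
compacts, a corner of R, and corners of R are compact. -/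
theorem locCompactOn (hR : π.IsLift U R S) (hSP : PseudolocalOn ρ U S)
    (h : LocCompactOn (π.inducedRep ρ) (π.preimage U) R) : LocCompactOn ρ U S := by
  have := π.t2Space
  have := π.locallyCompactSpace
  obtain ⟨D⟩ := CoveringFrame.nonempty π
  refine LocCompactOn.of_comp_left hSP fun a ha => ?_
  -- The lifting relation needs both test functions over U, whereas f_k need not be supported there;
  -- b cuts down the left one without changing the product.
  obtain ⟨b, hbU, hb1, hbs, -⟩ := exists_cutoff a.hasCompactSupport ha
  have hab : b.toC₀ * a.toC₀ = a.toC₀ := by rw [← toC₀_mul, mul_eq_right_of_one hb1]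
  have hsupp : ∀ c : C_c(X, ℂ), tsupport c ⊆ U → ∀ f,
      tsupport (π.pullMul c.toC₀ f) ⊆ π.preimage U := fun c hc f => by
    refine subset_trans (closure_minimal (fun y hy => ?_)
      ((isClosed_tsupport c).preimage π.continuous_proj)) fun y hy => hc hy
    exact subset_tsupport _ fun h0 => hy (by simp [h0])
  have hpush : ∀ k, π.push (star (π.pullMul b.toC₀ (D.f k)) * π.pullMul a.toC₀ (D.f k)) =
      π.push (star (D.f k) * D.f k) * a.toC₀ := fun k => by
    have e : star (π.pullMul b.toC₀ (D.f k)) = π.pullMul (star b.toC₀) (star (D.f k)) := by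
      ext z
      change star (b (π.proj z) * D.f k z) = star (b (π.proj z)) * star (D.f k z)
      rw [star_mul, mul_comm]
    rw [π.push_mul_pullMul, e, mul_comm (π.pullMul _ _), π.push_mul_pullMul, mul_comm (D.f k),
      mul_assoc, ← toC₀_star, hbs, hab]
  have hsum : a.toC₀ = ∑ k, π.push (star (D.f k) * D.f k) * a.toC₀ := by
    rw [← Finset.sum_mul]
    ext x
    change a x = (∑ k, π.push (star (D.f k) * D.f k)) x * a x
    have e : (∑ k, π.push (star (D.f k) * D.f k)) x = ∑ k, π.push (star (D.f k) * D.f k) x :=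
      map_sum (⟨⟨fun g : C₀(X, ℂ) => g x, rfl⟩, fun _ _ => rfl⟩ : C₀(X, ℂ) →+ ℂ) _ _
    rw [e, D.sum_push, one_mul]
  rw [hsum, map_sum, finsetSum_comp]
  refine CompactEq.sum_zero _ fun k _ => ?_
  rw [← hpush]
  refine (hR _ _ (hsupp b hbU _) (hsupp a ha _)).symm.trans ?_
  obtain ⟨c, hcW, hc1, -⟩ := exists_cutoff (π.pullMul a.toC₀ (D.f k)).hasCompactSupport
    (hsupp a ha (D.f k))
  rw [← mul_eq_right_of_one hc1, ← π.inducedRep_comp_tensor, ← comp_assoc R]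
  exact (((h _ (vanishesOff hcW)).1.zero_of_comp_right _).zero_of_comp_left _)

/-- Over a compact set the identity is a finite sum ∑ t_{d_i} t_{d_i}⋆. Inserted on both sides of R,
it expresses the two-sided cutoff through the corners t_{d_i}⋆ R t_{d_j} ≈ ρ(p(d̄_i d_j)) S, which
are compact. -/
theorem locCompactOn_lift (hR : π.IsLift U R S)
    (hRP : PseudolocalOn (π.inducedRep ρ) (π.preimage U) R) (h : LocCompactOn ρ U S) :
    LocCompactOn (π.inducedRep ρ) (π.preimage U) R := by
  have := π.t2Space
  have := π.locallyCompactSpace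
  obtain ⟨D⟩ := CoveringFrame.nonempty π
  refine LocCompactOn.of_comp_comp hRP fun g g' hg hg' => ?_
  obtain ⟨k, s, d, hk1, hkW, hdW, hk⟩ := D.exists_decomposition ρ
    (L := tsupport g ∪ tsupport g') (g.hasCompactSupport.union g'.hasCompactSupport)
    (Set.union_subset hg hg')
  have e1 : π.inducedRep ρ g.toC₀ = π.inducedRep ρ g.toC₀ ∘L π.inducedRep ρ k.toC₀ := by
    rw [← map_toC₀_mul, mul_comm, mul_eq_right_of_one fun y hy => hk1 y (Or.inl hy)]
  have e2 : π.inducedRep ρ g'.toC₀ = π.inducedRep ρ k.toC₀ ∘L π.inducedRep ρ g'.toC₀ := by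
    rw [← map_toC₀_mul, mul_eq_right_of_one fun y hy => hk1 y (Or.inr hy)]
  have e3 : π.inducedRep ρ k.toC₀ ∘L R ∘L π.inducedRep ρ k.toC₀ ≈ₖ 0 := by
    have : π.inducedRep ρ k.toC₀ ∘L R ∘L π.inducedRep ρ k.toC₀ = ∑ i ∈ s, ∑ j ∈ s,
        π.tensor ρ (d i) ∘L (adjoint (π.tensor ρ (d i)) ∘L R ∘L π.tensor ρ (d j)) ∘L
          adjoint (π.tensor ρ (d j)) := by
      rw [hk]
      simp only [finsetSum_comp, comp_finsetSum, comp_assoc]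
      exact Finset.sum_comm
    rw [this]
    refine CompactEq.sum_zero s fun i _ => CompactEq.sum_zero s fun j _ => CompactEq.zero_of_comp_left _ (CompactEq.zero_of_comp_right _ ?_)
    exact (hR _ _ (hdW i) (hdW j)).trans (h _ (π.push_vanishesOff_right _ (hdW j))).2
  generalize π.inducedRep ρ k.toC₀ = A at e1 e2 e3
  generalize π.inducedRep ρ g.toC₀ = B at e1 ⊢
  generalize π.inducedRep ρ g'.toC₀ = C at e2 ⊢
  have e4 : B ∘L R ∘L C = B ∘L (A ∘L R ∘L A) ∘L C := by
    rw [comp_assoc, comp_assoc, ← e2, ← comp_assoc B A, ← e1]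
  rw [e4]
  exact (e3.zero_of_comp_right _).zero_of_comp_left _

end IsLift

end NormalCovering

/-- Invariant pseudolocal operators are lifts. -/
theorem CoveringFrame.isLift_psi {R : π.InducedModule ρ →L[ℂ] π.InducedModule ρ} {U : Opens X}
    (hR : ∀ γ, R ∘L π.inducedTranslation ρ γ = π.inducedTranslation ρ γ ∘L R)
    (hRP : PseudolocalOn (π.inducedRep ρ) (π.preimage U) R) : π.IsLift U R (D.psi ρ R) := by
  have := π.t2Space
  have := π.locallyCompactSpace
  intro f f' hf hf'
  obtain ⟨k, hkW, hk1, hks, -⟩ := exists_cutoff (W := π.preimage U)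
    (L := tsupport f ∪ tsupport f') (f.hasCompactSupport.union f'.hasCompactSupport)
    (Set.union_subset hf hf')
  obtain ⟨G, hG, hG1⟩ := D.exists_finset
    (L := tsupport f ∪ tsupport f') (f.hasCompactSupport.union f'.hasCompactSupport)
  rw [D.rep_push_comp_psi ρ hR (G := G) fun i hi y hy =>
    hG i hi y (Or.inr (tsupport_mul_right _ _ hy))]
  -- On the support of f the |e_i|² sum to 1 and k equals 1. The factor k is there because e_i need
  -- not be supported over U, while e_i k is.
  have hsum : f = ∑ i ∈ Finset.univ ×ˢ G, star (D.e i * k) * (f * D.e i) := by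
    ext y
    rw [CompactlySupportedContinuousMap.sum_apply]
    have e1 : ∀ i, (star (D.e i * k) * (f * D.e i)) y =
        star (k y) * f y * (D.e i y * star (D.e i y)) := fun i => by
      simp only [mul_apply, star_apply, star_mul]
      ring
    simp only [e1, ← Finset.mul_sum]
    by_cases hy : y ∈ tsupport f
    · rw [hG1 y (Or.inl hy), hk1 y (Or.inl hy)]; simp
    · rw [image_eq_zero_of_notMem_tsupport hy]; simp
  -- Two commutations with R: f' is moved from left to right, where it joins e_i to give (e_i k)f',
  -- and then e_i k is moved from right to left, so that only f' remains on the right.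
  have hterm : ∀ i, adjoint (π.tensor ρ (star (star f * f') * D.e i)) ∘L R ∘L π.tensor ρ (D.e i) ≈ₖ
      adjoint (π.tensor ρ (star (D.e i * k) * (f * D.e i))) ∘L R ∘L π.tensor ρ f' := fun i => by
    have e1 : star (star f * f') * D.e i = star f' * (f * D.e i) := by
      ext y
      simp only [mul_apply, star_apply, star_mul, star_star]
      ring
    have e2 : f' * D.e i = (D.e i * k) * f' := by
      rw [mul_assoc, mul_eq_right_of_one fun y hy => hk1 y (Or.inr hy), mul_comm]
    rw [e1, π.adjoint_tensor_mul, star_star, comp_assoc, ← comp_assoc _ R]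
    refine (((hRP _ (vanishesOff hf')).symm.comp_right _).comp_left _).trans ?_
    rw [comp_assoc, π.inducedRep_comp_tensor, e2,
      ← π.inducedRep_comp_tensor ρ (D.e i * k) f', ← comp_assoc R]
    refine (((hRP _ (vanishesOff ((tsupport_mul_right _ k).trans hkW))).comp_right _).comp_left
      _).trans ?_
    rw [comp_assoc, ← comp_assoc, π.adjoint_tensor_comp_inducedRep]
    exact CompactEq.refl _
  refine CompactEq.symm ((CompactEq.sum _ fun i _ => hterm i).trans (CompactEq.of_eq ?_))
  conv_rhs => rw [hsum, π.tensor_sum, map_sum, finsetSum_comp]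

end Lifts

/-! ### Induced operators: the lift φ(S) = ∑ t_{e_i} S t_{e_i}⋆ -/

section Induction

open ContinuousLinearMap
open CompactlySupportedContinuousMap hiding comp_assoc comp_id zero_comp
open scoped CompactlySupported

set_option linter.unusedSectionVars false

variable {Γ Y X : Type*} [Group Γ] [TopologicalSpace Y] [TopologicalSpace X] [MulAction Γ Y]
  [T2Space X] [CompactSpace X]
  {H : Type*} [NormedAddCommGroup H] [InnerProductSpace ℂ H] [CompleteSpace H]
  {π : NormalCovering Γ Y X} (D : CoveringFrame π) (ρ : C₀(X, ℂ) →⋆ₙₐ[ℂ] (H →L[ℂ] H))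

theorem NormalCovering.tensor_zero (π : NormalCovering Γ Y X) : π.tensor ρ 0 = 0 := by
  have := π.tensor_smul ρ 0 0
  rwa [zero_smul, zero_smul] at this

namespace CoveringFrame

/-- The invariant operator on the induced module which acts as `S` on each sheet. -/
noncomputable def phi (S : H →L[ℂ] H) : π.InducedModule ρ →L[ℂ] π.InducedModule ρ :=
  Classical.choose ((D.isBesselFamily ρ).exists_sum (fun _ => S) (norm_nonneg S) fun _ => le_rfl)

theorem norm_phi_le (S : H →L[ℂ] H) : ‖D.phi ρ S‖ ≤ ‖S‖ :=
  (Classical.choose_spec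
    ((D.isBesselFamily ρ).exists_sum (fun _ => S) (norm_nonneg S) fun _ => le_rfl)).1

theorem hasSum_phi (S : H →L[ℂ] H) (ξ η : π.InducedModule ρ) :
    HasSum (fun i => inner ℂ (adjoint (π.tensor ρ (D.e i)) η)
      (S (adjoint (π.tensor ρ (D.e i)) ξ))) (inner ℂ η (D.phi ρ S ξ)) :=
  (Classical.choose_spec
    ((D.isBesselFamily ρ).exists_sum (fun _ => S) (norm_nonneg S) fun _ => le_rfl)).2 ξ η

/-- The operator φ(S) is obtained by choice, but its matrix coefficients are prescribed, and limits
of sums are unique. Linearity turns the norm bound into Lipschitz continuity. -/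
theorem phi_sub (S T : H →L[ℂ] H) : D.phi ρ (S - T) = D.phi ρ S - D.phi ρ T := by
  ext1 ξ
  refine ext_inner_left ℂ fun η => ?_
  refine (D.hasSum_phi ρ (S - T) ξ η).unique ?_
  rw [_root_.sub_apply, inner_sub_right]
  simpa only [_root_.sub_apply, inner_sub_right] using
    (D.hasSum_phi ρ S ξ η).sub (D.hasSum_phi ρ T ξ η)

theorem continuous_phi : Continuous (D.phi ρ) := by
  refine LipschitzWith.continuous (K := 1) (LipschitzWith.of_dist_le_mul fun S T => ?_)
  rw [dist_eq_norm, dist_eq_norm, ← D.phi_sub, NNReal.coe_one, one_mul]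
  exact D.norm_phi_le ρ _

variable {ρ}

/-- Applied to t_{f'}, the sum is finite and equals ∑ t_{e_i} S ρ(p(ē_i f')). Moving S to the right
of the coefficients leaves ∑ ρ(p(f̄ e_i)) ρ(p(ē_i f')) = ρ(p(f̄ f')), because ∑ |e_i|² = 1 on the
support of f'. -/
theorem phi_isLift {U : Opens X} {S : H →L[ℂ] H} (hS : PseudolocalOn ρ U S) :
    π.IsLift U (D.phi ρ S) S := fun f f' hf hf' => by
  obtain ⟨G, hG, hG1⟩ := D.exists_finset f'.hasCompactSupport
  have h0 : ∀ i, i ∉ Finset.univ ×ˢ G →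
      adjoint (π.tensor ρ (D.e i)) ∘L π.tensor ρ f' = 0 := fun i hi => by
    have : star (D.e i) * f' = 0 := by
      ext y
      by_cases hy : y ∈ tsupport f'
      · simp [hG i (fun h => hi (by simpa using h)) y hy]
      · simp [image_eq_zero_of_notMem_tsupport hy]
    rw [π.adjoint_tensor_comp_tensor, this, map_zero, map_zero]
  have h1 : D.phi ρ S ∘L π.tensor ρ f' = ∑ i ∈ Finset.univ ×ˢ G,
      π.tensor ρ (D.e i) ∘L S ∘L ρ (π.push (star (D.e i) * f')) := by
    rw [comp_eq_sum_of_hasSum (D.hasSum_phi ρ S) (π.tensor ρ f') (Finset.univ ×ˢ G) h0]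
    exact Finset.sum_congr rfl fun i _ => by
      rw [adjoint_adjoint, π.adjoint_tensor_comp_tensor]
  have h2 : π.tensor ρ f' = ∑ i ∈ Finset.univ ×ˢ G,
      π.tensor ρ (D.e i) ∘L ρ (π.push (star (D.e i) * f')) := by
    have : f' = ∑ i ∈ Finset.univ ×ˢ G, (D.e i * star (D.e i)) * f' := by
      rw [← Finset.sum_mul]
      refine (mul_eq_right_of_one fun y hy => ?_).symm
      rw [CompactlySupportedContinuousMap.sum_apply, ← hG1 y hy]
      rfl
    nth_rewrite 1 [this]
    rw [π.tensor_sum]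
    refine Finset.sum_congr rfl fun i _ => ?_
    rw [← π.inducedRep_comp_tensor,
      ← π.tensor_comp_adjoint_tensor ρ fun γ hγ y => D.e_disj i hγ y, comp_assoc,
      π.adjoint_tensor_comp_tensor]
  rw [h1, ← π.adjoint_tensor_comp_tensor, comp_finsetSum]
  conv_rhs => rw [h2, comp_finsetSum, finsetSum_comp]
  refine CompactEq.sum _ fun i _ => ?_
  rw [π.adjoint_tensor_comp_tensor_assoc, π.adjoint_tensor_comp_tensor_assoc, comp_assoc]
  exact (hS _ (π.push_vanishesOff_right _ hf')).comp_left _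

theorem adjoint_tensor_e_comp_eq_zero {g : C_c(Y, ℂ)} {i : Fin D.m × Γ}
    (h : ∀ y ∈ tsupport g, D.e i y = 0) :
    adjoint (π.tensor ρ (D.e i)) ∘L π.inducedRep ρ g.toC₀ = 0 := by
  have : star g * D.e i = 0 := by
    ext y
    by_cases hy : y ∈ tsupport g
    · simp [h y hy]
    · simp [image_eq_zero_of_notMem_tsupport hy]
  rw [π.adjoint_tensor_comp_inducedRep, this, π.tensor_zero, map_zero]

/-- Where e_i is nonzero, g agrees with the pullback of p(ν_i g): there ν_i is 1, and the proper
translates contribute nothing to the fibre sum. Hence g t_{e_i} = t_{e_i} ρ(p(ν_i g)), and commuting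
g with φ(S) reduces, over finitely many i, to commuting functions in C₀(U) with S. -/
theorem phi_pseudolocalOn {U : Opens X} {S : H →L[ℂ] H} (hS : PseudolocalOn ρ U S) :
    PseudolocalOn (π.inducedRep ρ) (π.preimage U) (D.phi ρ S) := by
  have := π.t2Space
  have := π.locallyCompactSpace
  refine PseudolocalOn.of_compactSupport fun g hg => ?_
  obtain ⟨G, hG, hG1⟩ := D.exists_finset g.hasCompactSupport
  have hz : ∀ i, i ∉ Finset.univ ×ˢ G → ∀ y ∈ tsupport g, D.e i y = 0 := fun i hi =>
    hG i fun h => hi (by simpa using h)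
  have hval : ∀ i y, D.e i y ≠ 0 → π.push (D.ν i * g) (π.proj y) = g y ∧ D.ν i y = 1 :=
    fun i y hy => by
      have h1 : D.ν i y = 1 := by
        have := DFunLike.congr_fun (D.ν_mul_e i) y
        rw [mul_apply] at this
        exact mul_right_cancel₀ hy (by rw [this, one_mul])
      refine ⟨?_, h1⟩
      rw [π.push_apply, finsum_eq_single _ (1 : Γ) fun γ hγ => ?_]
      · rw [one_smul, mul_apply, h1, one_mul]
      · have := D.ν_disj i hγ y
        rw [h1, one_mul] at this
        rw [mul_apply, this, zero_mul]
  have hl : ∀ i, π.inducedRep ρ g.toC₀ ∘L π.tensor ρ (D.e i) =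
      π.tensor ρ (D.e i) ∘L ρ (π.push (D.ν i * g)) := fun i => by
    rw [π.inducedRep_comp_tensor, π.tensor_comp_rep]
    congr 1
    ext y
    rw [mul_apply, π.pullMul_apply]
    by_cases hy : D.e i y = 0
    · simp [hy]
    · rw [(hval i y hy).1]
  have hr : ∀ i, adjoint (π.tensor ρ (D.e i)) ∘L π.inducedRep ρ g.toC₀ =
      ρ (π.push (D.ν i * g)) ∘L adjoint (π.tensor ρ (D.e i)) := fun i => by
    rw [π.adjoint_tensor_comp_inducedRep, π.rep_comp_adjoint_tensor]
    congr 2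
    ext y
    rw [mul_apply, π.pullMul_apply]
    by_cases hy : D.e i y = 0
    · simp [hy]
    · change star (g y) * _ = star (π.push (D.ν i * g) (π.proj y)) * _
      rw [(hval i y hy).1]
  rw [comp_eq_sum_of_hasSum (D.hasSum_phi ρ S) (π.inducedRep ρ g.toC₀) (Finset.univ ×ˢ G)
      fun i hi => D.adjoint_tensor_e_comp_eq_zero (hz i hi),
    eq_comp_sum_of_hasSum (D.hasSum_phi ρ S) (π.inducedRep ρ g.toC₀) (Finset.univ ×ˢ G)
      fun i hi => ?_]
  · refine CompactEq.sum _ fun i _ => ?_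
    rw [adjoint_adjoint, hr, ← comp_assoc (π.inducedRep ρ g.toC₀), hl, comp_assoc,
      ← comp_assoc S, ← comp_assoc (ρ _)]
    exact ((hS _ (π.push_vanishesOff_right _ hg)).comp_right _).comp_left _
  · have h2 := D.adjoint_tensor_e_comp_eq_zero (ρ := ρ) (g := star g) (i := i)
      (fun y hy => hz i hi y ((CompactlySupportedContinuousMap.tsupport_star g).le hy))
    have h3 := congrArg adjoint h2
    rwa [adjoint_comp, adjoint_map_toC₀, star_star, map_zero] at h3

theorem adjoint_tensor_e_comp_translation (i : Fin D.m × Γ) (γ : Γ) :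
    adjoint (π.tensor ρ (D.e i)) ∘L π.inducedTranslation ρ γ⁻¹ =
      adjoint (π.tensor ρ (D.e (i.1, γ * i.2))) := by
  rw [← π.adjoint_tensor_translate, e, e, π.translate_translate]

/-- Translation by γ permutes the frame, and the same S is placed at every index; the sum is merely
reindexed. -/
theorem phi_comp_translation (S : H →L[ℂ] H) (γ : Γ) :
    D.phi ρ S ∘L π.inducedTranslation ρ γ = π.inducedTranslation ρ γ ∘L D.phi ρ S := by
  ext1 ξ
  refine ext_inner_left ℂ fun η => ?_
  rw [comp_apply, comp_apply, ← adjoint_inner_left (π.inducedTranslation ρ γ),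
    π.adjoint_translation]
  refine (D.hasSum_phi ρ S _ η).unique ?_
  have h := D.hasSum_phi ρ S ξ (π.inducedTranslation ρ γ⁻¹ η)
  let σ : Fin D.m × Γ ≃ Fin D.m × Γ := (Equiv.refl _).prodCongr (Equiv.mulLeft γ⁻¹)
  rw [← σ.hasSum_iff] at h
  convert h using 1
  funext i
  have e1 : ∀ δ : Γ, adjoint (π.tensor ρ (D.e (i.1, δ⁻¹ * i.2))) =
      adjoint (π.tensor ρ (D.e i)) ∘L π.inducedTranslation ρ δ := fun δ => by
    have := D.adjoint_tensor_e_comp_translation (ρ := ρ) i δ⁻¹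
    rw [inv_inv] at this
    exact this.symm
  have e2 : adjoint (π.tensor ρ (D.e (σ i))) ∘L π.inducedTranslation ρ γ⁻¹ =
      adjoint (π.tensor ρ (D.e i)) := by
    rw [D.adjoint_tensor_e_comp_translation]
    simp [σ]
  change _ = inner ℂ ((adjoint (π.tensor ρ (D.e (σ i))) ∘L π.inducedTranslation ρ γ⁻¹) η)
    (S (adjoint (π.tensor ρ (D.e (i.1, γ⁻¹ * i.2))) ξ))
  rw [e2, e1]
  rfl

/-- The lift of an operator on `H` is controlled. -/
theorem exists_isControlledSet_phi : ∃ C : Set (Y × Y), IsControlledSet Γ C ∧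
    ∀ (S : H →L[ℂ] H) (f g : C_c(Y, ℂ)), Disjoint (tsupport f ×ˢ tsupport g) C →
      π.inducedRep ρ f.toC₀ ∘L D.phi ρ S ∘L π.inducedRep ρ g.toC₀ = 0 := by
  -- The function e_{k,γ} is supported in γL, so a term of the sum survives only if the supports of
  -- f and g meet a common translate of L. The resulting set does not depend on S.
  let L : Set Y := ⋃ k, tsupport (D.f k)
  have hL : IsCompact L := isCompact_iUnion fun k => (D.f k).hasCompactSupport
  refine ⟨{p | ∃ γ : Γ, ∃ a ∈ L, ∃ b ∈ L, p = (γ • a, γ • b)}, ⟨L, hL, fun p hp => hp⟩, fun S f g hd => ?_⟩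
  ext1 ξ
  refine ext_inner_left ℂ fun η => ?_
  rw [comp_apply, comp_apply, ← adjoint_inner_left, adjoint_map_toC₀]
  refine (D.hasSum_phi ρ S _ _).unique ?_
  rw [_root_.zero_apply, inner_zero_right]
  convert hasSum_zero using 1
  funext i
  have h0 : (∀ y ∈ tsupport g, D.e i y = 0) ∨ ∀ y ∈ tsupport f, D.e i y = 0 := by
    by_contra! h
    obtain ⟨⟨y, hy, hy'⟩, z, hz, hz'⟩ := h
    refine Set.disjoint_left.1 hd (show (z, y) ∈ _ from ⟨hz, hy⟩)
      ⟨i.2, i.2⁻¹ • z, ?_, i.2⁻¹ • y, ?_, ?_⟩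
    · exact Set.mem_iUnion.2 ⟨i.1, subset_tsupport _ hz'⟩
    · exact Set.mem_iUnion.2 ⟨i.1, subset_tsupport _ hy'⟩
    · simp
  rcases h0 with h | h
  · have := DFunLike.congr_fun (D.adjoint_tensor_e_comp_eq_zero (ρ := ρ) h) ξ
    rw [comp_apply, _root_.zero_apply] at this
    rw [this, map_zero, inner_zero_right]
  · have := DFunLike.congr_fun (D.adjoint_tensor_e_comp_eq_zero (ρ := ρ) (g := star f)
      fun y hy => h y ((CompactlySupportedContinuousMap.tsupport_star f).le hy)) η
    rw [comp_apply, _root_.zero_apply] at this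
    rw [this, inner_zero_left]

end CoveringFrame
end Induction

/-! ### Controlled operators under compression and extension by zero -/

section ControlledOperators

open ContinuousLinearMap
open scoped CompactlySupported

variable {Y : Type*} [TopologicalSpace Y] {Γ : Type*} [Group Γ] [MulAction Γ Y]
  {K : Type*} [NormedAddCommGroup K] [InnerProductSpace ℂ K] [CompleteSpace K]

variable (Γ) in
/-- Operators on the whole module which are controlled over `W`. -/
def ControlledOn (ρ : C₀(Y, ℂ) →⋆ₙₐ[ℂ] (K →L[ℂ] K)) (W : Opens Y) (T : K →L[ℂ] K) : Prop :=
  ∃ S : Set (Y × Y), IsControlledSet Γ S ∧ ∀ f g : C₀(Y, ℂ),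
    HasCompactSupport f → tsupport f ⊆ W → HasCompactSupport g → tsupport g ⊆ W →
    Disjoint (tsupport f ×ˢ tsupport g) S → ρ f ∘L T ∘L ρ g = 0

variable {ρ : C₀(Y, ℂ) →⋆ₙₐ[ℂ] (K →L[ℂ] K)} {W : Opens Y}

theorem ControlledOn.mono {V : Opens Y} (h : W ≤ V) {T : K →L[ℂ] K} (hT : ControlledOn Γ ρ V T) :
    ControlledOn Γ ρ W T :=
  let ⟨S, hS, hT⟩ := hT
  ⟨S, hS, fun f g hf hfW hg hgW => hT f g hf (hfW.trans h) hg (hgW.trans h)⟩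

theorem localRep_compressOp_localRep {f g : C₀(Y, ℂ)} (hf : VanishesOff W f)
    (hg : VanishesOff W g) (T : K →L[ℂ] K) :
    localRep ρ W f * compressOp ρ W T * localRep ρ W g = compressOp ρ W (ρ f ∘L T ∘L ρ g) := by
  rw [localRep_eq, localRep_eq]
  change (adjoint (inclL ρ W) ∘L ρ f ∘L inclL ρ W) ∘L (adjoint (inclL ρ W) ∘L T ∘L inclL ρ W) ∘L
    (adjoint (inclL ρ W) ∘L ρ g ∘L inclL ρ W) = adjoint (inclL ρ W) ∘L _ ∘L inclL ρ W
  simp only [comp_assoc, rep_comp_inclL_adjoint_assoc hf, inclL_adjoint_comp_rep_assoc hg]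

theorem ControlledOn.isControlledOp_compressOp {T : K →L[ℂ] K} (hT : ControlledOn Γ ρ W T) :
    IsControlledOp Γ ρ W (compressOp ρ W T) :=
  let ⟨S, hS, hT⟩ := hT
  ⟨S, hS, fun f g hf hfW hg hgW hd => by
    rw [localRep_compressOp_localRep (vanishesOff_of_tsupport hfW) (vanishesOff_of_tsupport hgW),
      hT f g hf hfW hg hgW hd]
    ext1 v; simp [compressOp]⟩

theorem IsControlledOp.controlledOn_extendOp {T : LocalModule ρ W →L[ℂ] LocalModule ρ W}
    (hT : IsControlledOp Γ ρ W T) : ControlledOn Γ ρ W (extendOp ρ W T) :=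
  let ⟨S, hS, hT⟩ := hT
  ⟨S, hS, fun f g hf hfW hg hgW hd => by
    have h := congrArg (extendOp ρ W) (hT f g hf hfW hg hgW hd)
    rw [extendOp_mul, extendOp_mul, extendOp_localRep (vanishesOff_of_tsupport hfW),
      extendOp_localRep (vanishesOff_of_tsupport hgW)] at h
    rw [← comp_assoc]
    refine Eq.trans h ?_
    ext1 v; simp [extendOp]⟩

theorem apply_mem_localSpace {T : K →L[ℂ] K}
    (h : ∀ f, VanishesOff W f → ∀ ξ, T (ρ f ξ) ∈ localSpace ρ W) {ξ : K}
    (hξ : ξ ∈ localSpace ρ W) : T ξ ∈ localSpace ρ W := by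
  have hc : IsClosed ((localSpace ρ W).comap T.toLinearMap : Set K) :=
    (Submodule.isClosed_topologicalClosure _).preimage T.continuous
  refine Submodule.topologicalClosure_minimal _ (Submodule.span_le.2 ?_) hc hξ
  rintro _ ⟨f, hf, η, rfl⟩
  exact h f hf η

end ControlledOperators

/-! ### Equivariance of the projections P_U -/

section EquivariantAlgebras

open ContinuousLinearMap
open CompactlySupportedContinuousMap hiding comp_assoc comp_id zero_comp
open scoped CompactlySupported

set_option linter.unusedSectionVars false

variable {Γ Y X : Type*} [Group Γ] [TopologicalSpace Y] [TopologicalSpace X] [MulAction Γ Y]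
  [T2Space X] [CompactSpace X]
  {H : Type*} [NormedAddCommGroup H] [InnerProductSpace ℂ H] [CompleteSpace H]
  (π : NormalCovering Γ Y X) {ρ : C₀(X, ℂ) →⋆ₙₐ[ℂ] (H →L[ℂ] H)} {U : Opens X}

namespace NormalCovering

/-- Operators commuting with the translations. -/
def IsEquivariant (R : π.InducedModule ρ →L[ℂ] π.InducedModule ρ) : Prop :=
  ∀ γ, R ∘L π.inducedTranslation ρ γ = π.inducedTranslation ρ γ ∘L R

/-- The action of `Γ` on `C₀(Y)`. -/
noncomputable def translateZero (γ : Γ) (g : C₀(Y, ℂ)) : C₀(Y, ℂ) :=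
  have := π.isQuotientCoveringMap.toContinuousConstSMul
  g.comp (Homeomorph.toCocompactMap (Homeomorph.smul γ⁻¹))

/-- Covariance of the representation of C₀(X̃). As π⁻¹(U) is Γ-invariant, it shows that translations
preserve P_U H̃. -/
theorem translation_comp_inducedRep (γ : Γ) (g : C₀(Y, ℂ)) :
    π.inducedTranslation ρ γ ∘L π.inducedRep ρ g =
      π.inducedRep ρ (π.translateZero γ g) ∘L π.inducedTranslation ρ γ :=
  π.ext_tensor ρ fun f h => by
    rw [comp_apply, comp_apply, inducedRep_tensor, inducedTranslation_tensor,
      inducedTranslation_tensor, inducedRep_tensor]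
    rfl

theorem vanishesOff_translateZero (γ : Γ) {g : C₀(Y, ℂ)} (hg : VanishesOff (π.preimage U) g) :
    VanishesOff (π.preimage U) (π.translateZero γ g) := fun y hy =>
  hg (γ⁻¹ • y) fun h => hy (by
    rw [π.mem_preimage, π.proj_smul] at h
    exact h)

theorem translation_rep_mem (γ : Γ) {g : C₀(Y, ℂ)} (hg : VanishesOff (π.preimage U) g)
    (η : π.InducedModule ρ) : π.inducedTranslation ρ γ (π.inducedRep ρ g η) ∈
      localSpace (π.inducedRep ρ) (π.preimage U) := by
  have e := DFunLike.congr_fun (π.translation_comp_inducedRep (ρ := ρ) γ g) η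
  rw [comp_apply, comp_apply] at e
  rw [e]
  exact rep_mem_localSpace (π.vanishesOff_translateZero γ hg) _

theorem translation_mem_localSpace (γ : Γ) {ξ : π.InducedModule ρ}
    (hξ : ξ ∈ localSpace (π.inducedRep ρ) (π.preimage U)) :
    π.inducedTranslation ρ γ ξ ∈ localSpace (π.inducedRep ρ) (π.preimage U) :=
  apply_mem_localSpace (fun _ hg η => π.translation_rep_mem γ hg η) hξ

/-- The projections `P_U` are equivariant. -/
theorem isEquivariant_proj : π.IsEquivariant (ρ := ρ)
    (inclL (π.inducedRep ρ) (π.preimage U) ∘L adjoint (inclL (π.inducedRep ρ) (π.preimage U))) := by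
  obtain ⟨P, hP⟩ : ∃ P, P = inclL (π.inducedRep ρ) (π.preimage U) ∘L
    adjoint (inclL (π.inducedRep ρ) (π.preimage U)) := ⟨_, rfl⟩
  have hPs : adjoint P = P := by rw [hP, adjoint_comp, adjoint_adjoint]
  have h1 : ∀ γ, P ∘L π.inducedTranslation ρ γ ∘L P = π.inducedTranslation ρ γ ∘L P := fun γ => by
    ext1 ξ
    rw [hP]
    exact inclL_comp_adjoint_apply (π.translation_mem_localSpace γ (Subtype.property _))
  rw [← hP]
  intro γ
  -- Invariance of the range gives P u P = u P for every translation u. The adjoint of this identity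
  -- for u⁻¹ is P u P = P u, and the two together show that P and u commute.
  have h2 := congrArg adjoint (h1 γ⁻¹)
  rw [adjoint_comp, adjoint_comp, hPs, π.adjoint_translation, inv_inv, comp_assoc,
    h1] at h2
  exact h2.symm

variable {π}

theorem inclL_adjoint_translation (γ : Γ) (v : π.LocalInduced ρ U) :
    inclL (π.inducedRep ρ) (π.preimage U) (adjoint (inclL (π.inducedRep ρ) (π.preimage U))
      (π.inducedTranslation ρ γ (inclL (π.inducedRep ρ) (π.preimage U) v))) =
        π.inducedTranslation ρ γ (inclL (π.inducedRep ρ) (π.preimage U) v) :=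
  inclL_comp_adjoint_apply (π.translation_mem_localSpace γ v.2)

theorem translation_inclL_adjoint (γ : Γ) (ξ : π.InducedModule ρ) :
    π.inducedTranslation ρ γ (inclL (π.inducedRep ρ) (π.preimage U)
      (adjoint (inclL (π.inducedRep ρ) (π.preimage U)) ξ)) =
    inclL (π.inducedRep ρ) (π.preimage U) (adjoint (inclL (π.inducedRep ρ) (π.preimage U))
      (π.inducedTranslation ρ γ ξ)) :=
  (DFunLike.congr_fun (π.isEquivariant_proj γ) ξ).symm

theorem adjoint_inclL_inclL (v : π.LocalInduced ρ U) :
    adjoint (inclL (π.inducedRep ρ) (π.preimage U)) (inclL (π.inducedRep ρ) (π.preimage U) v) = v :=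
  DFunLike.congr_fun (adjoint_inclL_comp (π.inducedRep ρ) (π.preimage U)) v

/-- Since P_U commutes with translations, the compressed translations act on P_U H̃ as the
translations themselves. -/
theorem IsEquivariant.isInvariantOp_compressOp {R : π.InducedModule ρ →L[ℂ] π.InducedModule ρ}
    (hR : π.IsEquivariant R) : IsInvariantOp (π.inducedRep ρ) (π.preimage U) (π.inducedAction ρ)
      (compressOp (π.inducedRep ρ) (π.preimage U) R) := fun γ => by
  ext1 v
  change adjoint (inclL (π.inducedRep ρ) (π.preimage U)) (R (inclL (π.inducedRep ρ) (π.preimage U)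
    (adjoint (inclL (π.inducedRep ρ) (π.preimage U))
      (π.inducedTranslation ρ γ (inclL (π.inducedRep ρ) (π.preimage U) v))))) =
    adjoint (inclL (π.inducedRep ρ) (π.preimage U)) (π.inducedTranslation ρ γ
      (inclL (π.inducedRep ρ) (π.preimage U) (adjoint (inclL (π.inducedRep ρ) (π.preimage U))
        (R (inclL (π.inducedRep ρ) (π.preimage U) v)))))
  rw [inclL_adjoint_translation, translation_inclL_adjoint, adjoint_inclL_inclL]
  exact congrArg _ (DFunLike.congr_fun (hR γ) _)

theorem isEquivariant_extendOp {T : π.LocalInduced ρ U →L[ℂ] π.LocalInduced ρ U}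
    (hT : IsInvariantOp (π.inducedRep ρ) (π.preimage U) (π.inducedAction ρ) T) :
    π.IsEquivariant (extendOp (π.inducedRep ρ) (π.preimage U) T) := fun γ => by
  ext1 ξ
  have h := DFunLike.congr_fun (hT γ) (adjoint (inclL (π.inducedRep ρ) (π.preimage U)) ξ)
  change T (adjoint (inclL (π.inducedRep ρ) (π.preimage U)) (π.inducedTranslation ρ γ
    (inclL (π.inducedRep ρ) (π.preimage U)
      (adjoint (inclL (π.inducedRep ρ) (π.preimage U)) ξ)))) =
    adjoint (inclL (π.inducedRep ρ) (π.preimage U)) (π.inducedTranslation ρ γ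
      (inclL (π.inducedRep ρ) (π.preimage U)
        (T (adjoint (inclL (π.inducedRep ρ) (π.preimage U)) ξ)))) at h
  rw [translation_inclL_adjoint, adjoint_inclL_inclL] at h
  change inclL (π.inducedRep ρ) (π.preimage U) (T (adjoint (inclL (π.inducedRep ρ) (π.preimage U))
    (π.inducedTranslation ρ γ ξ))) = π.inducedTranslation ρ γ
      (inclL (π.inducedRep ρ) (π.preimage U)
        (T (adjoint (inclL (π.inducedRep ρ) (π.preimage U)) ξ)))
  rw [h, inclL_adjoint_translation]

end NormalCovering

end EquivariantAlgebras

/-! ### The maps φ and ψ over U, and the identification of ℭ_Γ(U) -/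

section EquivariantLifts

open ContinuousLinearMap
open CompactlySupportedContinuousMap hiding comp_assoc comp_id zero_comp
open scoped CompactlySupported

set_option linter.unusedSectionVars false

variable {Γ Y X : Type*} [Group Γ] [TopologicalSpace Y] [TopologicalSpace X] [MulAction Γ Y]
  [T2Space X] [CompactSpace X]
  {H : Type*} [NormedAddCommGroup H] [InnerProductSpace ℂ H] [CompleteSpace H]
  {π : NormalCovering Γ Y X} {ρ : C₀(X, ℂ) →⋆ₙₐ[ℂ] (H →L[ℂ] H)} {U : Opens X}

namespace NormalCovering

theorem compressOp_mem_preAlgDΓ {R : π.InducedModule ρ →L[ℂ] π.InducedModule ρ}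
    (hc : ControlledOn Γ (π.inducedRep ρ) (π.preimage U) R)
    (hp : PseudolocalOn (π.inducedRep ρ) (π.preimage U) R) (he : π.IsEquivariant R) :
    compressOp (π.inducedRep ρ) (π.preimage U) R ∈
      preAlgDΓ (π.inducedRep ρ) (π.preimage U) π (π.inducedAction ρ) :=
  ⟨hc.isControlledOp_compressOp, hp.isPseudolocal_compressOp, he.isInvariantOp_compressOp⟩

theorem compressOp_mem_preIdealCΓ {R : π.InducedModule ρ →L[ℂ] π.InducedModule ρ}
    (hc : ControlledOn Γ (π.inducedRep ρ) (π.preimage U) R)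
    (hp : LocCompactOn (π.inducedRep ρ) (π.preimage U) R) (he : π.IsEquivariant R) :
    compressOp (π.inducedRep ρ) (π.preimage U) R ∈
      preIdealCΓ (π.inducedRep ρ) (π.preimage U) (π.inducedAction ρ) :=
  ⟨hc.isControlledOp_compressOp, hp.isLocallyCompactOp_compressOp, he.isInvariantOp_compressOp⟩

theorem mem_𝔇Γ_of_mem_preAlgDΓ {T : π.LocalInduced ρ U →L[ℂ] π.LocalInduced ρ U}
    (hT : T ∈ preAlgDΓ (π.inducedRep ρ) (π.preimage U) π (π.inducedAction ρ)) : T ∈ π.𝔇Γ ρ U :=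
  subset_closure hT

/-- Pseudolocality is a norm-closed condition and so passes to the closure of the controlled
operators. Together with equivariance it is all that the lifting argument needs; control itself is
not required of T. -/
theorem pseudolocalOn_of_mem {T : π.LocalInduced ρ U →L[ℂ] π.LocalInduced ρ U}
    (hT : T ∈ π.𝔇Γ ρ U) : PseudolocalOn (π.inducedRep ρ) (π.preimage U)
      (extendOp (π.inducedRep ρ) (π.preimage U) T) :=
  isPseudolocal_iff.1 (closure_minimal (fun _ h => h.2.1) isClosed_isPseudolocal hT)

theorem isClosed_isEquivariant :
    IsClosed {R : π.InducedModule ρ →L[ℂ] π.InducedModule ρ | π.IsEquivariant R} := by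
  simp only [IsEquivariant, Set.ofPred_forall]
  exact isClosed_iInter fun γ => isClosed_eq (continuous_id.clm_comp continuous_const)
    (continuous_const.clm_comp continuous_id)

theorem isEquivariant_of_mem {T : π.LocalInduced ρ U →L[ℂ] π.LocalInduced ρ U}
    (hT : T ∈ π.𝔇Γ ρ U) :
    π.IsEquivariant (extendOp (π.inducedRep ρ) (π.preimage U) T) := by
  have hc : IsClosed {T | π.IsEquivariant (extendOp (π.inducedRep ρ) (π.preimage U) T)} :=
    isClosed_isEquivariant.preimage continuous_extendOp
  have hs : (preAlgDΓ (π.inducedRep ρ) (π.preimage U) π (π.inducedAction ρ) : Set _) ⊆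
      {T | π.IsEquivariant (extendOp (π.inducedRep ρ) (π.preimage U) T)} :=
    fun T h => isEquivariant_extendOp h.2.2
  exact closure_minimal hs hc hT

/-- Restriction to smaller open sets preserves the algebras `𝔇_Γ`. -/
theorem restrictOp_mem_𝔇Γ {V : Opens X} (h : U ≤ V)
    {T : π.LocalInduced ρ V →L[ℂ] π.LocalInduced ρ V} (hT : T ∈ π.𝔇Γ ρ V) :
    restrictOp (π.inducedRep ρ) (π.preimage V) (π.preimage U) T ∈ π.𝔇Γ ρ U :=
  map_mem_closure (f := fun T => compressOp (π.inducedRep ρ) (π.preimage U)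
    (extendOp (π.inducedRep ρ) (π.preimage V) T)) (continuous_compressOp.comp continuous_extendOp) hT
    fun _ hT => compressOp_mem_preAlgDΓ (hT.1.controlledOn_extendOp.mono (π.preimage_mono h))
      ((isPseudolocal_iff.1 hT.2.1).mono (π.preimage_mono h)) (isEquivariant_extendOp hT.2.2)

end NormalCovering

theorem restrictOp_mem_algD {Z K : Type*} [TopologicalSpace Z] [NormedAddCommGroup K]
    [InnerProductSpace ℂ K] [CompleteSpace K] {σ : C₀(Z, ℂ) →⋆ₙₐ[ℂ] (K →L[ℂ] K)}
    {V W : Opens Z} (h : W ≤ V) {T : LocalModule σ V →L[ℂ] LocalModule σ V} (hT : T ∈ algD σ V) :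
    restrictOp σ V W T ∈ algD σ W :=
  ((isPseudolocal_iff.1 hT).mono h).isPseudolocal_compressOp

namespace CoveringFrame

variable (D : CoveringFrame π)

theorem controlledOn_phi (W : Opens Y) (S : H →L[ℂ] H) :
    ControlledOn Γ (π.inducedRep ρ) W (D.phi ρ S) :=
  let ⟨C, hC, h⟩ := D.exists_isControlledSet_phi (ρ := ρ)
  ⟨C, hC, fun f g hf _ hg _ hd => h S ⟨⟨f, f.continuous⟩, hf⟩ ⟨⟨g, g.continuous⟩, hg⟩ hd⟩

theorem continuous_psi : Continuous (D.psi ρ) :=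
  continuous_finsetSum _ fun _ _ =>
    continuous_const.clm_comp (continuous_id.clm_comp continuous_const)

/-- As n_k f_k = f_k, one has t_{f_k} ρ(a) = ((a ∘ π) n_k) t_{f_k}, where (a ∘ π) n_k is supported
over U. Commuting a with ψ(R) becomes commuting such functions with R. -/
theorem pseudolocalOn_psi {R : π.InducedModule ρ →L[ℂ] π.InducedModule ρ}
    (hR : PseudolocalOn (π.inducedRep ρ) (π.preimage U) R) :
    PseudolocalOn ρ U (D.psi ρ R) := by
  refine PseudolocalOn.of_compactSupport fun a ha => ?_
  rw [psi, finsetSum_comp, comp_finsetSum]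
  refine CompactEq.sum _ fun k _ => ?_
  have hsupp : tsupport (π.pullMul a.toC₀ (D.n k)) ⊆ π.preimage U := by
    refine subset_trans (closure_minimal (fun y hy => ?_)
      ((isClosed_tsupport a).preimage π.continuous_proj)) fun y hy => ha hy
    exact subset_tsupport _ fun h0 => hy (by simp [h0])
  have e1 : π.tensor ρ (D.f k) ∘L ρ a.toC₀ =
      π.inducedRep ρ (π.pullMul a.toC₀ (D.n k)).toC₀ ∘L π.tensor ρ (D.f k) := by
    rw [π.tensor_comp_rep, π.inducedRep_comp_tensor]
    congr 1
    conv_lhs => rw [← D.n_mul]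
    ext y
    simp [mul_assoc]
  have e2 : ρ a.toC₀ ∘L adjoint (π.tensor ρ (D.f k)) =
      adjoint (π.tensor ρ (D.f k)) ∘L π.inducedRep ρ (π.pullMul a.toC₀ (D.n k)).toC₀ := by
    rw [π.rep_comp_adjoint_tensor, π.adjoint_tensor_comp_inducedRep]
    congr 2
    conv_lhs => rw [← D.n_mul]
    -- Nothing is assumed about complex conjugation of n_k, but n_k f_k = f_k forces n_k = 1
    -- wherever f_k is nonzero.
    have hn : ∀ y, star (D.n k y) * D.f k y = D.n k y * D.f k y := fun y => by
      by_cases hy : D.f k y = 0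
      · rw [hy, mul_zero, mul_zero]
      · have h1 := DFunLike.congr_fun (D.n_mul k) y
        rw [mul_apply] at h1
        have h2 : D.n k y = 1 := mul_right_cancel₀ hy (by rw [h1, one_mul])
        rw [h2, star_one]
    ext y
    change star (a (π.proj y)) * (D.n k y * D.f k y) =
      star (a (π.proj y) * D.n k y) * D.f k y
    rw [star_mul, mul_comm (star (D.n k y)), mul_assoc, hn]
  rw [comp_assoc, comp_assoc, e1, ← comp_assoc R, ← comp_assoc (ρ a.toC₀), e2]
  exact ((hR _ (vanishesOff hsupp)).comp_right _).comp_left _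

variable (U) in
/-- The operator on `P_U H̃` which acts as `S` on each sheet. -/
noncomputable def localPhi (S : LocalModule ρ U →L[ℂ] LocalModule ρ U) :
    π.LocalInduced ρ U →L[ℂ] π.LocalInduced ρ U :=
  compressOp (π.inducedRep ρ) (π.preimage U) (D.phi ρ (extendOp ρ U S))

variable (U) in
/-- The operator on `P_U H` corresponding to an operator on `P_U H̃`. -/
noncomputable def localPsi (T : π.LocalInduced ρ U →L[ℂ] π.LocalInduced ρ U) :
    LocalModule ρ U →L[ℂ] LocalModule ρ U :=
  compressOp ρ U (D.psi ρ (extendOp (π.inducedRep ρ) (π.preimage U) T))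

theorem continuous_localPhi : Continuous (D.localPhi (ρ := ρ) U) :=
  continuous_compressOp.comp ((D.continuous_phi ρ).comp continuous_extendOp)

theorem continuous_localPsi : Continuous (D.localPsi (ρ := ρ) U) :=
  continuous_compressOp.comp (D.continuous_psi.comp continuous_extendOp)

theorem localPhi_mem_preAlgDΓ {S : LocalModule ρ U →L[ℂ] LocalModule ρ U} (hS : S ∈ algD ρ U) :
    D.localPhi U S ∈ preAlgDΓ (π.inducedRep ρ) (π.preimage U) π (π.inducedAction ρ) :=
  π.compressOp_mem_preAlgDΓ (D.controlledOn_phi _ _) (D.phi_pseudolocalOn (isPseudolocal_iff.1 hS))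
    (D.phi_comp_translation _)

/-- The induced operator is controlled and invariant by construction, and being a lift of a locally
compact operator makes it locally compact; no closure is taken. -/
theorem localPhi_mem_preIdealCΓ {S : LocalModule ρ U →L[ℂ] LocalModule ρ U}
    (hS : IsLocallyCompactOp ρ U S) :
    D.localPhi U S ∈ preIdealCΓ (π.inducedRep ρ) (π.preimage U) (π.inducedAction ρ) :=
  have h := isLocallyCompactOp_iff.1 hS
  π.compressOp_mem_preIdealCΓ (D.controlledOn_phi _ _)
    ((D.phi_isLift h.pseudolocalOn).locCompactOn_lift (D.phi_pseudolocalOn h.pseudolocalOn) h)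
    (D.phi_comp_translation _)

theorem localPsi_mem_algD {T : π.LocalInduced ρ U →L[ℂ] π.LocalInduced ρ U} (hT : T ∈ π.𝔇Γ ρ U) :
    D.localPsi U T ∈ algD ρ U :=
  (D.pseudolocalOn_psi (π.pseudolocalOn_of_mem hT)).isPseudolocal_compressOp

/-- Compressing ψ to P_U H and extending by zero changes it by a locally compact operator over U
only, to which the lifting relation is insensitive. -/
theorem isLift_localPsi {T : π.LocalInduced ρ U →L[ℂ] π.LocalInduced ρ U} (hT : T ∈ π.𝔇Γ ρ U) :
    π.IsLift U (extendOp (π.inducedRep ρ) (π.preimage U) T) (extendOp ρ U (D.localPsi U T)) := by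
  refine (D.isLift_psi ρ (π.isEquivariant_of_mem hT) (π.pseudolocalOn_of_mem hT)).of_compactEq ?_
  rw [← neg_sub]
  exact (D.pseudolocalOn_psi (π.pseudolocalOn_of_mem hT)).extendOp_compressOp_sub.neg

theorem isLift_localPhi {S : LocalModule ρ U →L[ℂ] LocalModule ρ U} (hS : S ∈ algD ρ U) :
    π.IsLift U (extendOp (π.inducedRep ρ) (π.preimage U) (D.localPhi U S)) (extendOp ρ U S) := by
  refine (D.phi_isLift (isPseudolocal_iff.1 hS)).of_compactEq_lift ?_
  rw [← neg_sub]
  exact (D.phi_pseudolocalOn (isPseudolocal_iff.1 hS)).extendOp_compressOp_sub.neg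

end CoveringFrame

namespace NormalCovering

theorem isLocallyCompactOp_of_isLift {T : π.LocalInduced ρ U →L[ℂ] π.LocalInduced ρ U}
    (hT : T ∈ π.𝔇Γ ρ U) {S : LocalModule ρ U →L[ℂ] LocalModule ρ U}
    (h : π.IsLift U (extendOp (π.inducedRep ρ) (π.preimage U) T) (extendOp ρ U S))
    (hS : IsLocallyCompactOp ρ U S) :
    IsLocallyCompactOp (π.inducedRep ρ) (π.preimage U) T :=
  isLocallyCompactOp_iff.2 (h.locCompactOn_lift (pseudolocalOn_of_mem hT)
    (isLocallyCompactOp_iff.1 hS))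

/-- The ideal `ℭ_Γ(U)` consists of the locally compact elements of `𝔇_Γ(U)`. -/
theorem mem_closure_preIdealCΓ_iff {T : π.LocalInduced ρ U →L[ℂ] π.LocalInduced ρ U}
    (hT : T ∈ π.𝔇Γ ρ U) :
    T ∈ closure (preIdealCΓ (π.inducedRep ρ) (π.preimage U) (π.inducedAction ρ)) ↔
      IsLocallyCompactOp (π.inducedRep ρ) (π.preimage U) T := by
  refine ⟨fun h => closure_minimal (fun _ h => h.2.1) isClosed_isLocallyCompactOp h, fun h => ?_⟩
  obtain ⟨D⟩ := CoveringFrame.nonempty π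
  -- The map T ↦ T − φψT is continuous, so it is enough that it takes controlled operators to
  -- controlled, locally compact, invariant ones. Norm limits are thereby treated without
  -- approximating a locally compact T by locally compact controlled operators directly.
  have h1 : T - D.localPhi U (D.localPsi U T) ∈
      closure (preIdealCΓ (π.inducedRep ρ) (π.preimage U) (π.inducedAction ρ)) := by
    refine map_mem_closure (f := fun T => T - D.localPhi U (D.localPsi U T))
      (continuous_id.sub (D.continuous_localPhi.comp D.continuous_localPsi)) hT fun T hT => ?_
    have hT' := mem_𝔇Γ_of_mem_preAlgDΓ hT
    have hP := D.localPhi_mem_preAlgDΓ (D.localPsi_mem_algD hT')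
    have hd : T - D.localPhi U (D.localPsi U T) ∈
        preAlgDΓ (π.inducedRep ρ) (π.preimage U) π (π.inducedAction ρ) := sub_mem hT hP
    refine ⟨hd.1, ?_, hd.2.2⟩
    -- Both T and φψT are lifts of ψT, so their difference is a lift of 0.
    refine isLocallyCompactOp_of_isLift (mem_𝔇Γ_of_mem_preAlgDΓ hd) (S := 0) ?_ .zero
    have := (D.isLift_localPsi hT').sub (D.isLift_localPhi (D.localPsi_mem_algD hT'))
    rw [← extendOp_sub, ← extendOp_sub, sub_self] at this
    exact this
  -- Only here is T assumed to be locally compact: then so is ψT, and φψT lies in the ideal even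
  -- before closure.
  have h2 : IsLocallyCompactOp ρ U (D.localPsi U T) :=
    isLocallyCompactOp_iff.2 ((D.isLift_localPsi hT).locCompactOn
      (isPseudolocal_iff.1 (D.localPsi_mem_algD hT)) (isLocallyCompactOp_iff.1 h))
  have h3 := map_mem_closure₂ continuous_add h1 (subset_closure (D.localPhi_mem_preIdealCΓ h2))
    (u := preIdealCΓ (π.inducedRep ρ) (π.preimage U) (π.inducedAction ρ))
    fun S hS T hT => ⟨hS.1.add hT.1, hS.2.1.add hT.2.1, hS.2.2.add hT.2.2⟩
  rwa [sub_add_cancel] at h3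

theorem toQuot_eq_iff_locallyCompact {T T' : π.𝔇Γ ρ U} :
    (π.ℭΓ ρ U).toQuot T = (π.ℭΓ ρ U).toQuot T' ↔
      IsLocallyCompactOp (π.inducedRep ρ) (π.preimage U) (T.1 - T'.1) :=
  (CStarIdeal.toQuot_eq_iff _).trans (mem_closure_preIdealCΓ_iff (T - T').2)

end NormalCovering

theorem toQuot_idealC_eq_iff {Z K : Type*} [TopologicalSpace Z] [NormedAddCommGroup K]
    [InnerProductSpace ℂ K] [CompleteSpace K] {σ : C₀(Z, ℂ) →⋆ₙₐ[ℂ] (K →L[ℂ] K)}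
    {W : Opens Z} {T T' : algD σ W} :
    (idealC σ W).toQuot T = (idealC σ W).toQuot T' ↔ IsLocallyCompactOp σ W (T.1 - T'.1) :=
  CStarIdeal.toQuot_eq_iff _

end EquivariantLifts

/-! ### The presheaves 𝔔 and 𝔔_Γ -/

section Presheaves

open ContinuousLinearMap

section Restriction

variable {Y : Type*} [TopologicalSpace Y]
  {K : Type*} [NormedAddCommGroup K] [InnerProductSpace ℂ K] [CompleteSpace K]
  {ρ : C₀(Y, ℂ) →⋆ₙₐ[ℂ] (K →L[ℂ] K)} {U V W : Opens Y}

theorem localSpace_mono (h : W ≤ V) : localSpace ρ W ≤ localSpace ρ V :=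
  Submodule.topologicalClosure_mono (Submodule.span_mono fun _ ⟨f, hf, ξ, hv⟩ =>
    ⟨f, hf.mono h, ξ, hv⟩)

theorem inclL_comp_adjoint_inclL (h : W ≤ V) :
    inclL ρ V ∘L adjoint (inclL ρ V) ∘L inclL ρ W = inclL ρ W := by
  ext1 v
  exact inclL_comp_adjoint_apply (localSpace_mono h v.2)

theorem adjoint_inclL_comp_inclL (h : W ≤ V) :
    adjoint (inclL ρ W) ∘L inclL ρ V ∘L adjoint (inclL ρ V) = adjoint (inclL ρ W) := by
  have := congrArg adjoint (inclL_comp_adjoint_inclL (ρ := ρ) h)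
  rwa [adjoint_comp, adjoint_comp, adjoint_adjoint, comp_assoc] at this

theorem restrictOp_one (h : W ≤ V) : restrictOp ρ V W 1 = 1 := by
  change adjoint (inclL ρ W) ∘L (inclL ρ V ∘L ContinuousLinearMap.id ℂ _ ∘L
    adjoint (inclL ρ V)) ∘L inclL ρ W = ContinuousLinearMap.id ℂ _
  rw [id_comp, comp_assoc, inclL_comp_adjoint_inclL h, adjoint_inclL_comp]

/-- P_U P_V = P_U for U ⊆ V. Compression is thus functorial on operators exactly, whereas it is
multiplicative only in the quotients. -/
theorem compressOp_extendOp_compressOp (h : U ≤ V) (T : K →L[ℂ] K) :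
    compressOp ρ U (extendOp ρ V (compressOp ρ V T)) = compressOp ρ U T := by
  rw [extendOp_compressOp]
  change adjoint (inclL ρ U) ∘L _ ∘L inclL ρ U = adjoint (inclL ρ U) ∘L T ∘L inclL ρ U
  have h1 := inclL_comp_adjoint_inclL (ρ := ρ) h
  have h2 := adjoint_inclL_comp_inclL (ρ := ρ) h
  ext1 v
  have h1v := DFunLike.congr_fun h1 v
  have h2v := DFunLike.congr_fun h2 (T (inclL ρ U v))
  simp only [comp_apply] at h1v h2v ⊢
  rw [h1v, h2v]

theorem restrictOp_restrictOp (h : U ≤ V) (T : LocalModule ρ W →L[ℂ] LocalModule ρ W) :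
    restrictOp ρ V U (restrictOp ρ W V T) = restrictOp ρ W U T :=
  compressOp_extendOp_compressOp h _

theorem restrictOp_self (T : LocalModule ρ W →L[ℂ] LocalModule ρ W) :
    restrictOp ρ W W T = T := compressOp_extendOp T

theorem restrictOp_star (T : LocalModule ρ V →L[ℂ] LocalModule ρ V) :
    restrictOp ρ V W (star T) = star (restrictOp ρ V W T) := by
  rw [restrictOp_eq, restrictOp_eq, extendOp_star]
  exact compressOp_adjoint _

theorem isLocallyCompactOp_restrictOp (h : W ≤ V) {T : LocalModule ρ V →L[ℂ] LocalModule ρ V}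
    (hT : IsLocallyCompactOp ρ V T) : IsLocallyCompactOp ρ W (restrictOp ρ V W T) :=
  ((isLocallyCompactOp_iff.1 hT).mono h).isLocallyCompactOp_compressOp

theorem isLocallyCompactOp_restrictOp_mul_sub (h : W ≤ V)
    {S T : LocalModule ρ V →L[ℂ] LocalModule ρ V} (hS : IsPseudolocal ρ V S)
    (hT : IsPseudolocal ρ V T) : IsLocallyCompactOp ρ W
      (restrictOp ρ V W (S * T) - restrictOp ρ V W S * restrictOp ρ V W T) := by
  rw [restrictOp_eq, extendOp_mul]
  exact ((isPseudolocal_iff.1 hS).mono h).compressOp_comp_sub ((isPseudolocal_iff.1 hT).mono h)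

variable (ρ V W) in
/-- Restriction as a linear map. -/
noncomputable def restrictLin : (LocalModule ρ V →L[ℂ] LocalModule ρ V) →ₗ[ℂ]
    (LocalModule ρ W →L[ℂ] LocalModule ρ W) where
  toFun T := restrictOp ρ V W T
  map_add' S T := by simp only [restrictOp_eq, extendOp_add, compressOp_add]
  map_smul' c T := by simp only [restrictOp_eq, extendOp_smul, compressOp_smul, RingHom.id_apply]

variable (ρ) in
/-- The restriction `𝔇(V) → 𝔇(W)`. -/
noncomputable def restrictD (h : W ≤ V) : algD ρ V →ₗ[ℂ] algD ρ W :=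
  ((restrictLin ρ V W).comp (algD ρ V).subtype.toLinearMap).codRestrict
    (Subalgebra.toSubmodule (algD ρ W).toSubalgebra) fun T => restrictOp_mem_algD h T.2

theorem coe_restrictD (h : W ≤ V) (T : algD ρ V) :
    (restrictD ρ h T : LocalModule ρ W →L[ℂ] LocalModule ρ W) = restrictOp ρ V W T := rfl

theorem mem_idealC_iff {T : algD ρ W} :
    T ∈ (idealC ρ W).toIdeal ↔ IsLocallyCompactOp ρ W T.1 := Iff.rfl

variable (ρ) in
/-- The restriction `𝔔(V) → 𝔔(W)`. -/
noncomputable def restrictQ (h : W ≤ V) : algQ ρ V →⋆ₐ[ℂ] algQ ρ W :=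
  (idealC ρ V).quotMap (idealC ρ W) (restrictD ρ h)
    (fun a ha => mem_idealC_iff.2 (by
      rw [coe_restrictD]
      exact isLocallyCompactOp_restrictOp h (mem_idealC_iff.1 ha)))
    (mem_idealC_iff.2 (by
      have : (restrictD ρ h 1 - 1 : algD ρ W).1 = 0 :=
        sub_eq_zero.2 (restrictOp_one h)
      rw [this]; exact .zero))
    (fun a b => mem_idealC_iff.2 (isLocallyCompactOp_restrictOp_mul_sub h a.2 b.2))
    (fun a => Subtype.ext (restrictOp_star a.1))

theorem restrictQ_toQuot (h : W ≤ V) (T : algD ρ V) :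
    restrictQ ρ h ((idealC ρ V).toQuot T) = (idealC ρ W).toQuot (restrictD ρ h T) :=
  CStarIdeal.quotMap_toQuot ..

variable (ρ) in
/-- The presheaf `𝔔`. -/
noncomputable def symbolPresheaf : CStarPresheaf (fun U : Opens Y => algQ ρ U) where
  res h := restrictQ ρ h
  res_refl {U} a := by
    obtain ⟨T, rfl⟩ := (idealC ρ U).toQuot_surjective a
    refine (restrictQ_toQuot _ T).trans ?_
    exact congrArg _ (Subtype.ext (restrictOp_self T.1))
  res_res {U V W} hUV hVW a := by
    obtain ⟨T, rfl⟩ := (idealC ρ W).toQuot_surjective a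
    refine (congrArg _ (restrictQ_toQuot hVW T)).trans ((restrictQ_toQuot hUV _).trans ?_)
    refine Eq.trans ?_ (restrictQ_toQuot (hUV.trans hVW) T).symm
    exact congrArg _ (Subtype.ext (restrictOp_restrictOp hUV T.1))

theorem symbolPresheaf_res (h : W ≤ V) (T : algD ρ V) :
    (symbolPresheaf ρ).res h ((idealC ρ V).toQuot T) =
      (idealC ρ W).toQuot ⟨restrictOp ρ V W T, restrictOp_mem_algD h T.2⟩ :=
  restrictQ_toQuot h T

end Restriction

namespace NormalCovering

variable {Γ Y X : Type*} [Group Γ] [TopologicalSpace Y] [TopologicalSpace X] [MulAction Γ Y]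
  [T2Space X] [CompactSpace X]
  {H : Type*} [NormedAddCommGroup H] [InnerProductSpace ℂ H] [CompleteSpace H]
  (π : NormalCovering Γ Y X) (ρ : C₀(X, ℂ) →⋆ₙₐ[ℂ] (H →L[ℂ] H)) {U V : Opens X}

theorem isPseudolocal_of_mem {T : π.LocalInduced ρ U →L[ℂ] π.LocalInduced ρ U}
    (hT : T ∈ π.𝔇Γ ρ U) : IsPseudolocal (π.inducedRep ρ) (π.preimage U) T :=
  isPseudolocal_iff.2 (pseudolocalOn_of_mem hT)

theorem mem_ℭΓ_iff {T : π.𝔇Γ ρ U} : T ∈ (π.ℭΓ ρ U).toIdeal ↔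
    IsLocallyCompactOp (π.inducedRep ρ) (π.preimage U) T.1 :=
  mem_closure_preIdealCΓ_iff T.2

/-- The restriction `𝔇_Γ(V) → 𝔇_Γ(U)`. -/
noncomputable def restrictDΓ (h : U ≤ V) : π.𝔇Γ ρ V →ₗ[ℂ] π.𝔇Γ ρ U :=
  ((restrictLin (π.inducedRep ρ) (π.preimage V) (π.preimage U)).comp
    (π.𝔇Γ ρ V).subtype.toLinearMap).codRestrict
    (Subalgebra.toSubmodule (π.𝔇Γ ρ U).toSubalgebra) fun T => restrictOp_mem_𝔇Γ h T.2

theorem restrictDΓ_one (h : U ≤ V) : π.restrictDΓ ρ h 1 = 1 :=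
  Subtype.ext (restrictOp_one (π.preimage_mono h))

theorem restrictDΓ_star (h : U ≤ V) (T : π.𝔇Γ ρ V) :
    π.restrictDΓ ρ h (star T) = star (π.restrictDΓ ρ h T) :=
  Subtype.ext (restrictOp_star T.1)

/-- The compression argument yields only a locally compact defect in 𝔇_Γ(U); that it belongs to the
norm closure defining ℭ_Γ(U) is the content of `mem_closure_preIdealCΓ_iff`. -/
theorem restrictDΓ_mul_sub (h : U ≤ V) (S T : π.𝔇Γ ρ V) :
    π.restrictDΓ ρ h (S * T) - π.restrictDΓ ρ h S * π.restrictDΓ ρ h T ∈ (π.ℭΓ ρ U).toIdeal :=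
  (π.mem_ℭΓ_iff ρ).2 (isLocallyCompactOp_restrictOp_mul_sub (π.preimage_mono h)
    (π.isPseudolocal_of_mem ρ S.2) (π.isPseudolocal_of_mem ρ T.2))

theorem restrictDΓ_mem (h : U ≤ V) {T : π.𝔇Γ ρ V} (hT : T ∈ (π.ℭΓ ρ V).toIdeal) :
    π.restrictDΓ ρ h T ∈ (π.ℭΓ ρ U).toIdeal :=
  (π.mem_ℭΓ_iff ρ).2
    (isLocallyCompactOp_restrictOp (π.preimage_mono h) ((π.mem_ℭΓ_iff ρ).1 hT))

/-- The restriction `𝔔_Γ(V) → 𝔔_Γ(U)`. -/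
noncomputable def restrictQΓ (h : U ≤ V) : π.𝔔Γ ρ V →⋆ₐ[ℂ] π.𝔔Γ ρ U :=
  (π.ℭΓ ρ V).quotMap (π.ℭΓ ρ U) (π.restrictDΓ ρ h) (fun _ ha => π.restrictDΓ_mem ρ h ha)
    (by rw [π.restrictDΓ_one, sub_self]; exact Submodule.zero_mem _)
    (π.restrictDΓ_mul_sub ρ h) (π.restrictDΓ_star ρ h)

theorem restrictQΓ_toQuot (h : U ≤ V) (T : π.𝔇Γ ρ V) :
    π.restrictQΓ ρ h ((π.ℭΓ ρ V).toQuot T) = (π.ℭΓ ρ U).toQuot (π.restrictDΓ ρ h T) :=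
  CStarIdeal.quotMap_toQuot ..

theorem restrictDΓ_refl (T : π.𝔇Γ ρ U) : π.restrictDΓ ρ le_rfl T = T :=
  Subtype.ext (restrictOp_self T.1)

theorem restrictDΓ_restrictDΓ {W : Opens X} (hUV : U ≤ V) (hVW : V ≤ W) (T : π.𝔇Γ ρ W) :
    π.restrictDΓ ρ hUV (π.restrictDΓ ρ hVW T) = π.restrictDΓ ρ (hUV.trans hVW) T :=
  Subtype.ext (restrictOp_restrictOp (π.preimage_mono hUV) T.1)

theorem restrictQΓ_restrictQΓ {W : Opens X} (hUV : U ≤ V) (hVW : V ≤ W) (a : π.𝔔Γ ρ W) :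
    π.restrictQΓ ρ hUV (π.restrictQΓ ρ hVW a) = π.restrictQΓ ρ (hUV.trans hVW) a := by
  obtain ⟨T, rfl⟩ := (π.ℭΓ ρ W).toQuot_surjective a
  have h1 := π.restrictQΓ_toQuot ρ hVW T
  have h2 := π.restrictQΓ_toQuot ρ hUV (π.restrictDΓ ρ hVW T)
  have h3 := π.restrictQΓ_toQuot ρ (hUV.trans hVW) T
  have h4 := π.restrictDΓ_restrictDΓ ρ hUV hVW T
  rw [h1, h2, h3, h4]

/-- The presheaf `𝔔_Γ`. -/
noncomputable def symbolPresheafΓ : CStarPresheaf (fun U : Opens X => π.𝔔Γ ρ U) where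
  res h := π.restrictQΓ ρ h
  res_refl {U} a := by
    obtain ⟨T, rfl⟩ := (π.ℭΓ ρ U).toQuot_surjective a
    rw [π.restrictQΓ_toQuot, π.restrictDΓ_refl]
  res_res {U V W} hUV hVW a := by
    exact π.restrictQΓ_restrictQΓ ρ hUV hVW a

theorem symbolPresheafΓ_res (h : U ≤ V) (T : π.𝔇Γ ρ V) :
    (π.symbolPresheafΓ ρ).res h ((π.ℭΓ ρ V).toQuot T) = (π.ℭΓ ρ U).toQuot
      ⟨restrictOp (π.inducedRep ρ) (π.preimage V) (π.preimage U) T, restrictOp_mem_𝔇Γ h T.2⟩ :=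
  π.restrictQΓ_toQuot ρ h T

end NormalCovering

end Presheaves

/-! ### Transport of the sheaf property -/

section SheafIsomorphisms

namespace CStarPresheaf

variable {X : Type*} [TopologicalSpace X] {A B : Opens X → Type*} [∀ U, CStarAlgebra (A U)]
  [∀ U, CStarAlgebra (B U)] {F : CStarPresheaf A} {G : CStarPresheaf B}

/-- Injective ⋆-homomorphisms of C⋆-algebras are isometric, so the norm bound in the gluing axiom is
invariant under isomorphism. -/
theorem Iso.norm_map (α : F.Iso G) (U : Opens X) (a : A U) : ‖α.toEquiv U a‖ = ‖a‖ :=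
  NonUnitalStarAlgHom.norm_map (α.toEquiv U) (EquivLike.injective (α.toEquiv U)) a

/-- A presheaf isomorphic to a sheaf is a sheaf. -/
theorem IsSheaf.of_iso (hG : G.IsSheaf) (α : F.Iso G) : F.IsSheaf where
  empty := have := hG.empty; (EquivLike.injective (α.toEquiv ⊥)).subsingleton
  uniqueness 𝒰 a h := by
    refine EquivLike.injective (α.toEquiv _) ?_
    rw [map_zero]
    refine hG.uniqueness 𝒰 _ fun U hU => ?_
    rw [← α.natural, h U hU, map_zero]
  gluing 𝒰 a hb hc := by
    have hn : ∀ U : 𝒰, ‖α.toEquiv U (a U)‖ = ‖a U‖ := fun U => α.norm_map _ _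
    obtain ⟨b, hb1, hb2⟩ := hG.gluing 𝒰 (fun U => α.toEquiv U (a U)) (by simpa only [hn] using hb)
      fun U V => by rw [← α.natural, ← α.natural, hc]
    refine ⟨(α.toEquiv _).symm b, fun U => EquivLike.injective (α.toEquiv U) ?_, ?_⟩
    · rw [α.natural, (α.toEquiv _).apply_symm_apply, hb1]
    · rw [← α.norm_map, (α.toEquiv _).apply_symm_apply]
      simpa only [hn] using hb2

theorem Iso.ext {α β : F.Iso G} (h : ∀ U a, α.toEquiv U a = β.toEquiv U a) : α = β := by
  cases α; cases β
  congr
  funext U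
  exact StarAlgEquiv.ext (h U)

end CStarPresheaf

end SheafIsomorphisms

/-! ### The isomorphism 𝔔_Γ → 𝔔 -/

section SymbolIsomorphism

open ContinuousLinearMap

variable {Γ Y X : Type*} [Group Γ] [TopologicalSpace Y] [TopologicalSpace X] [MulAction Γ Y]
  [T2Space X] [CompactSpace X]
  {H : Type*} [NormedAddCommGroup H] [InnerProductSpace ℂ H] [CompleteSpace H]
  {π : NormalCovering Γ Y X} {ρ : C₀(X, ℂ) →⋆ₙₐ[ℂ] (H →L[ℂ] H)} {U V : Opens X}

namespace NormalCovering

variable (π) in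
/-- The operator `T` on `P_U H̃` acts on the sheets over `U` as `S`, up to compact operators. -/
def IsLocalLift (T : π.LocalInduced ρ U →L[ℂ] π.LocalInduced ρ U)
    (S : LocalModule ρ U →L[ℂ] LocalModule ρ U) : Prop :=
  π.IsLift U (extendOp (π.inducedRep ρ) (π.preimage U) T) (extendOp ρ U S)

/-- The zero operator is a lift of S − S', so S − S' is locally compact: over U, an operator on H̃
has at most one partner class. -/
theorem IsLift.locCompactOn_sub {R : π.InducedModule ρ →L[ℂ] π.InducedModule ρ} {S S' : H →L[ℂ] H}
    (h : π.IsLift U R S) (h' : π.IsLift U R S') (hS : PseudolocalOn ρ U S)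
    (hS' : PseudolocalOn ρ U S') : LocCompactOn ρ U (S - S') := by
  have h0 := h.sub h'
  rw [sub_self] at h0
  exact h0.locCompactOn (hS.sub hS') .zero

namespace IsLocalLift

variable {T T' : π.LocalInduced ρ U →L[ℂ] π.LocalInduced ρ U}
  {S S' : LocalModule ρ U →L[ℂ] LocalModule ρ U}

theorem isLocallyCompactOp_sub (h : π.IsLocalLift T S) (h' : π.IsLocalLift T S')
    (hS : IsPseudolocal ρ U S) (hS' : IsPseudolocal ρ U S') :
    IsLocallyCompactOp ρ U (S - S') := by
  rw [isLocallyCompactOp_iff, extendOp_sub]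
  exact h.locCompactOn_sub h' (isPseudolocal_iff.1 hS) (isPseudolocal_iff.1 hS')

theorem mul (h : π.IsLocalLift T S) (h' : π.IsLocalLift T' S')
    (hT' : IsPseudolocal (π.inducedRep ρ) (π.preimage U) T') (hS : IsPseudolocal ρ U S) :
    π.IsLocalLift (T * T') (S * S') := by
  rw [IsLocalLift, extendOp_mul, extendOp_mul]
  exact IsLift.comp h h' (isPseudolocal_iff.1 hT') (isPseudolocal_iff.1 hS)

theorem _root_.NormalCovering.isLocalLift_compressOp {R : π.InducedModule ρ →L[ℂ] π.InducedModule ρ}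
    {S : H →L[ℂ] H} (h : π.IsLift U R S) (hR : PseudolocalOn (π.inducedRep ρ) (π.preimage U) R)
    (hS : PseudolocalOn ρ U S) :
    π.IsLocalLift (compressOp (π.inducedRep ρ) (π.preimage U) R) (compressOp ρ U S) := by
  have h1 := hR.extendOp_compressOp_sub.neg
  have h2 := hS.extendOp_compressOp_sub.neg
  rw [neg_sub] at h1 h2
  exact (h.of_compactEq h2).of_compactEq_lift h1

theorem one : π.IsLocalLift (1 : π.LocalInduced ρ U →L[ℂ] π.LocalInduced ρ U) 1 := by
  have := isLocalLift_compressOp (IsLift.id (π := π) (ρ := ρ) (U := U)) .id .id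
  rwa [compressOp_id, compressOp_id] at this

theorem restrict {T : π.LocalInduced ρ V →L[ℂ] π.LocalInduced ρ V}
    {S : LocalModule ρ V →L[ℂ] LocalModule ρ V} (h : U ≤ V) (hT : π.IsLocalLift T S)
    (hTP : IsPseudolocal (π.inducedRep ρ) (π.preimage V) T) (hS : IsPseudolocal ρ V S) :
    π.IsLocalLift (restrictOp (π.inducedRep ρ) (π.preimage V) (π.preimage U) T)
      (restrictOp ρ V U S) :=
  isLocalLift_compressOp (IsLift.mono h hT) ((isPseudolocal_iff.1 hTP).mono (π.preimage_mono h))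
    ((isPseudolocal_iff.1 hS).mono h)

end IsLocalLift

end NormalCovering

namespace CoveringFrame

variable (D : CoveringFrame π) (ρ U)

theorem psi_adjoint (R : π.InducedModule ρ →L[ℂ] π.InducedModule ρ) :
    D.psi ρ (adjoint R) = adjoint (D.psi ρ R) := by
  rw [psi, psi, map_sum]
  exact Finset.sum_congr rfl fun k _ => by
    rw [adjoint_comp, adjoint_comp, adjoint_adjoint, comp_assoc]

/-- The map `localPsi` as a linear map. -/
noncomputable def psiLin : π.𝔇Γ ρ U →ₗ[ℂ] algD ρ U where
  toFun T := ⟨D.localPsi U T, D.localPsi_mem_algD T.2⟩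
  map_add' S T := Subtype.ext (by
    have : ∀ R R', D.psi ρ (R + R') = D.psi ρ R + D.psi ρ R' := fun R R' => by
      simp only [psi, add_comp, comp_add, Finset.sum_add_distrib]
    change compressOp _ _ (D.psi ρ (extendOp _ _ (S.1 + T.1))) = _
    rw [extendOp_add, this, compressOp_add]
    rfl)
  map_smul' c T := Subtype.ext (by
    have : ∀ R, D.psi ρ (c • R) = c • D.psi ρ R := fun R => by
      simp only [psi, smul_comp, comp_smul, Finset.smul_sum]
    change compressOp _ _ (D.psi ρ (extendOp _ _ (c • T.1))) = _
    rw [extendOp_smul, this, compressOp_smul]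
    rfl)

variable {ρ U}

theorem isLocalLift_psiLin (T : π.𝔇Γ ρ U) : π.IsLocalLift T.1 (D.psiLin ρ U T).1 :=
  D.isLift_localPsi T.2

variable (ρ U)

/-- The homomorphism `𝔔_Γ(U) → 𝔔(U)`. -/
noncomputable def symbolHom : π.𝔔Γ ρ U →⋆ₐ[ℂ] algQ ρ U :=
  (π.ℭΓ ρ U).quotMap (idealC ρ U) (D.psiLin ρ U)
    (fun T hT => mem_idealC_iff.2 (isLocallyCompactOp_iff.2
      ((D.isLift_localPsi T.2).locCompactOn (isPseudolocal_iff.1 (D.localPsi_mem_algD T.2))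
        (isLocallyCompactOp_iff.1 ((π.mem_ℭΓ_iff ρ).1 hT)))))
    (mem_idealC_iff.2 ((D.isLocalLift_psiLin 1).isLocallyCompactOp_sub .one
      (D.psiLin ρ U 1).2 (1 : algD ρ U).2))
    (fun S T => mem_idealC_iff.2 ((D.isLocalLift_psiLin (S * T)).isLocallyCompactOp_sub
      ((D.isLocalLift_psiLin S).mul (D.isLocalLift_psiLin T) (π.isPseudolocal_of_mem ρ T.2)
        (D.psiLin ρ U S).2) (D.psiLin ρ U (S * T)).2
        (D.psiLin ρ U S * D.psiLin ρ U T).2))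
    (fun T => Subtype.ext (by
      change compressOp _ _ (D.psi ρ (extendOp _ _ (star T.1))) = star (compressOp _ _ _)
      rw [extendOp_star, psi_adjoint, compressOp_adjoint]))

variable {ρ U}

/-- The homomorphism may be computed with any S of which T is a lift, not only with ψT; in
particular it does not depend on the frame. Naturality and the comparison with sections use it in
this form. -/
theorem symbolHom_eq {T : π.𝔇Γ ρ U} {S : algD ρ U} (h : π.IsLocalLift T.1 S.1) :
    D.symbolHom ρ U ((π.ℭΓ ρ U).toQuot T) = (idealC ρ U).toQuot S := by
  refine (CStarIdeal.quotMap_toQuot ..).trans ?_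
  exact toQuot_idealC_eq_iff.2
    ((D.isLocalLift_psiLin T).isLocallyCompactOp_sub h (D.psiLin ρ U T).2 S.2)

/-- A lift of a locally compact operator is locally compact, and the locally compact elements of
𝔇_Γ(U) form ℭ_Γ(U). -/
theorem symbolHom_injective : Function.Injective (D.symbolHom ρ U) := by
  rw [injective_iff_map_eq_zero]
  intro a ha
  obtain ⟨T, rfl⟩ := (π.ℭΓ ρ U).toQuot_surjective a
  rw [D.symbolHom_eq (D.isLocalLift_psiLin T), CStarIdeal.toQuot_eq_zero, mem_idealC_iff] at ha
  rw [CStarIdeal.toQuot_eq_zero, π.mem_ℭΓ_iff]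
  exact π.isLocallyCompactOp_of_isLift T.2 (D.isLocalLift_psiLin T) ha

/-- The operator φ(S) provides a controlled invariant lift of any pseudolocal S. -/
theorem symbolHom_surjective : Function.Surjective (D.symbolHom ρ U) := fun b => by
  obtain ⟨S, rfl⟩ := (idealC ρ U).toQuot_surjective b
  exact ⟨_, D.symbolHom_eq (T := ⟨D.localPhi U S.1,
    π.mem_𝔇Γ_of_mem_preAlgDΓ (D.localPhi_mem_preAlgDΓ S.2)⟩) (D.isLift_localPhi S.2)⟩

variable (ρ)

/-- The isomorphism of presheaves `𝔔_Γ → 𝔔`. -/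
noncomputable def symbolIso : (π.symbolPresheafΓ ρ).Iso (symbolPresheaf ρ) where
  toEquiv U := StarAlgEquiv.ofBijective (D.symbolHom ρ U)
    ⟨D.symbolHom_injective, D.symbolHom_surjective⟩
  natural {U V} h a := by
    obtain ⟨T, rfl⟩ := (π.ℭΓ ρ V).toQuot_surjective a
    change D.symbolHom ρ U (π.restrictQΓ ρ h _) = restrictQ ρ h (D.symbolHom ρ V _)
    have h1 := π.restrictQΓ_toQuot ρ h T
    have h2 := D.symbolHom_eq (D.isLocalLift_psiLin T)
    have h3 := restrictQ_toQuot h (D.psiLin ρ V T)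
    rw [h1, h2, h3]
    exact D.symbolHom_eq ((D.isLocalLift_psiLin T).restrict h (π.isPseudolocal_of_mem ρ T.2)
      (D.psiLin ρ V T).2)

theorem symbolIso_eq {T : π.𝔇Γ ρ U} {S : algD ρ U} (h : π.IsLocalLift T.1 S.1) :
    (D.symbolIso ρ).toEquiv U ((π.ℭΓ ρ U).toQuot T) = (idealC ρ U).toQuot S :=
  D.symbolHom_eq h

end CoveringFrame

end SymbolIsomorphism

/-! ### Partitions of unity by squares on open subsets -/

section Gluing

open ContinuousLinearMap
open CompactlySupportedContinuousMap hiding comp_assoc comp_id zero_comp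
open scoped CompactlySupported

/-- A partition of unity by squares of compactly supported functions. -/
theorem exists_partition_compactlySupported {X : Type*} [TopologicalSpace X] [MetrizableSpace X]
    [LocallyCompactSpace X] {𝒰 : Set (Opens X)} {W : Opens X} (hW : W = sSup 𝒰) :
    ∃ (j : W → 𝒰) (g : W → C_c(X, ℂ)),
      (∀ i, tsupport (g i) ⊆ (j i : Opens X)) ∧ (∀ i, star (g i) = g i) ∧
      (∀ (s : Finset W) x, ∑ i ∈ s, ‖g i x‖ ^ 2 ≤ 1) ∧
      ∀ L : Set X, IsCompact L → L ⊆ (W : Set X) → ∃ s : Finset W,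
        (∀ i, i ∉ s → ∀ x ∈ L, g i x = 0) ∧ ∀ x ∈ L, ∑ i ∈ s, g i x * g i x = 1 := by
  have hj : ∀ w : W, ∃ U : 𝒰, (w : X) ∈ (U : Opens X) := fun w => by
    obtain ⟨U, hU, hw⟩ := Opens.mem_sSup.1 (hW ▸ w.2 : (w : X) ∈ sSup 𝒰)
    exact ⟨⟨U, hU⟩, hw⟩
  choose j hj using hj
  -- The partition is indexed by the points of W. Subordination to the interiors of compact
  -- neighbourhoods, and not just to members of 𝒰, makes the supports compact.
  have hK : ∀ w : W, ∃ K : Set X, IsCompact K ∧ (w : X) ∈ interior K ∧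
      K ⊆ (j w : Opens X) := fun w => exists_compact_subset (j w).1.2 (hj w)
  choose K hKc hKi hKj using hK
  have hjW : ∀ w, ((j w : Opens X) : Set X) ⊆ W := fun w =>
    hW ▸ le_sSup (a := (j w : Opens X)) (j w).2
  -- W need not be compact; metrizability makes it paracompact, hence it has locally finite
  -- partitions of unity.
  have _ : MetrizableSpace W := Topology.IsEmbedding.subtypeVal.metrizableSpace
  let _ := metrizableSpaceMetric W
  have hpre : ∀ {L : Set X}, IsCompact L → L ⊆ W → IsCompact (Subtype.val ⁻¹' L : Set W) :=
    fun {L} hL hLW => Topology.IsInducing.subtypeVal.isCompact_preimage' hL fun x hx =>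
      ⟨⟨x, hLW hx⟩, rfl⟩
  obtain ⟨f, hf⟩ := PartitionOfUnity.exists_isSubordinate (X := W) isClosed_univ
    (fun w => Subtype.val ⁻¹' interior (K w))
    (fun w => isOpen_interior.preimage continuous_subtype_val)
    fun w _ => Set.mem_iUnion.2 ⟨w, hKi w⟩
  have hc : ∀ w, HasCompactSupport (f w) := fun w => by
    refine IsCompact.of_isClosed_subset (s := Subtype.val ⁻¹' K w) ?_ (isClosed_tsupport _)
      ((hf w).trans (Set.preimage_mono interior_subset))
    exact hpre (hKc w) ((hKj w).trans (hjW w))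
  let h : W → W → ℂ := fun w x => (Real.sqrt (f w x) : ℂ)
  have hh : ∀ w, HasCompactSupport (h w) := fun w =>
    (hc w).comp_left (g := fun t : ℝ => (Real.sqrt t : ℂ)) (by simp)
  have hhc : ∀ w, Continuous (h w) := fun w => by fun_prop
  -- The square roots have compact support in W, so extension by zero to X keeps them continuous.
  let g : W → C_c(X, ℂ) := fun w =>
    ⟨⟨Subtype.val.extend (h w) 0, HasCompactSupport.continuous_extend_zero W.isOpen
      (hhc w) (hh w)⟩, (hh w).extend_zero continuous_subtype_val⟩
  have hgW : ∀ w (x : W), g w x = h w x := fun w x =>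
    Subtype.val_injective.extend_apply (h w) (0 : X → ℂ) x
  have hg0 : ∀ w (x : X), x ∉ W → g w x = 0 := fun w x hx =>
    Function.extend_apply' (h w) (0 : X → ℂ) x (by rintro ⟨y, rfl⟩; exact hx y.2)
  have hh2 : ∀ w x, h w x * h w x = (f w x : ℂ) := fun w x => by
    rw [← Complex.ofReal_mul, Real.mul_self_sqrt (f.nonneg w x)]
  have hhn : ∀ w x, ‖h w x‖ ^ 2 = f w x := fun w x => by
    rw [Complex.norm_real, Real.norm_of_nonneg (Real.sqrt_nonneg _), Real.sq_sqrt (f.nonneg w x)]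
  refine ⟨j, g, fun w => ?_, fun w => ?_, fun s x => ?_, fun L hL hLW => ?_⟩
  · have e : tsupport (g w) = Subtype.val '' tsupport (h w) :=
      (hh w).tsupport_extend_zero continuous_subtype_val Subtype.val_injective
    rw [e]
    rintro _ ⟨x, hx, rfl⟩
    have hx' : x ∈ tsupport (f w) := closure_mono (fun y hy => by
      contrapose! hy
      simp only [Function.mem_support, not_not] at hy
      simp [h, hy]) hx
    exact hKj w (interior_subset (hf w hx'))
  · ext x
    by_cases hx : x ∈ W
    · have := hgW w ⟨x, hx⟩
      change star (g w x) = g w x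
      rw [this]
      exact Complex.conj_ofReal _
    · change star (g w x) = g w x
      rw [hg0 w x hx, star_zero]
  · by_cases hx : x ∈ W
    · have : ∀ w, ‖g w x‖ ^ 2 = f w ⟨x, hx⟩ := fun w => by
        rw [hgW w ⟨x, hx⟩, hhn]
      simp only [this]
      classical
      calc ∑ w ∈ s, f w ⟨x, hx⟩ ≤ ∑ w ∈ s ∪ f.finsupport ⟨x, hx⟩, f w ⟨x, hx⟩ :=
            Finset.sum_le_sum_of_subset_of_nonneg Finset.subset_union_left
              fun w _ _ => f.nonneg w _
        _ = 1 := f.sum_finsupport' (Set.mem_univ _) Finset.subset_union_right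
        _ ≤ 1 := le_rfl
    · simp [hg0 _ x hx]
  · have hL' : IsCompact (Subtype.val ⁻¹' L : Set W) :=
      hpre hL hLW
    -- By local finiteness only finitely many members of the partition meet a compact subset of W.
    have hfin := f.locallyFinite.finite_nonempty_inter_compact hL'
    have hz : ∀ w, w ∉ hfin.toFinset → ∀ x (hx : x ∈ L), f w ⟨x, hLW hx⟩ = 0 := fun w hw x hx => by
      by_contra hne
      exact hw (hfin.mem_toFinset.2 ⟨⟨x, hLW hx⟩, hne, hx⟩)
    refine ⟨hfin.toFinset, fun w hw x hx => ?_, fun x hx => ?_⟩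
    · rw [hgW w ⟨x, hLW hx⟩]
      simp [h, hz w hw x hx]
    · have e : ∀ w, g w x * g w x = (f w ⟨x, hLW hx⟩ : ℂ) := fun w => by
        rw [hgW w ⟨x, hLW hx⟩, hh2]
      simp only [e]
      rw [← Complex.ofReal_sum, f.sum_finsupport' (Set.mem_univ _), Complex.ofReal_one]
      intro w hw
      by_contra hw'
      exact (f.mem_finsupport _).1 hw (hz w hw' x hx)

end Gluing

/-! ### 𝔔 is a sheaf -/

section SymbolSheaf

open ContinuousLinearMap
open CompactlySupportedContinuousMap hiding comp_assoc comp_id zero_comp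
open scoped CompactlySupported

variable {X : Type*} [TopologicalSpace X]
  {H : Type*} [NormedAddCommGroup H] [InnerProductSpace ℂ H] [CompleteSpace H]
  {ρ : C₀(X, ℂ) →⋆ₙₐ[ℂ] (H →L[ℂ] H)}

/-- ∑ ‖ρ(g_i)ξ‖² = ⟨ξ, ρ(∑ |g_i|²)ξ⟩ over a finite index set, and ρ is contractive. -/
theorem isBesselFamily_rep {ι : Type*} {g : ι → C_c(X, ℂ)} 
    (h1 : ∀ (s : Finset ι) x, ∑ i ∈ s, ‖g i x‖ ^ 2 ≤ 1) :
    IsBesselFamily fun i => ρ (g i).toC₀ := by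
  intro s ξ
  let k : C_c(X, ℂ) := ∑ i ∈ s, star (g i) * g i
  have hk : ‖k.toC₀‖ ≤ 1 := by
    refine (BoundedContinuousFunction.norm_le zero_le_one (f := k.toC₀.toBCF)).2 fun x => ?_
    change ‖(∑ i ∈ s, star (g i) * g i) x‖ ≤ 1
    have e : (∑ i ∈ s, star (g i) * g i) x = ((∑ i ∈ s, ‖g i x‖ ^ 2 : ℝ) : ℂ) := by
      rw [CompactlySupportedContinuousMap.sum_apply]
      push_cast
      exact Finset.sum_congr rfl fun i _ => Complex.conj_mul' _
    rw [e, Complex.norm_real, Real.norm_of_nonneg (Finset.sum_nonneg fun i _ => by positivity)]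
    exact h1 s x
  have hterm : ∀ i, ((‖ρ (g i).toC₀ ξ‖ ^ 2 : ℝ) : ℂ) =
      inner ℂ ξ (ρ (star (g i) * g i).toC₀ ξ) := fun i => by
    rw [map_toC₀_mul, comp_apply, ← adjoint_inner_left, adjoint_map_toC₀, star_star,
      inner_self_eq_norm_sq_to_K]
    push_cast; rfl
  have hsum : ((∑ i ∈ s, ‖ρ (g i).toC₀ ξ‖ ^ 2 : ℝ) : ℂ) = inner ℂ ξ (ρ k.toC₀ ξ) := by
    rw [Complex.ofReal_sum, toC₀_sum, map_sum, _root_.sum_apply, inner_sum]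
    exact Finset.sum_congr rfl fun i _ => hterm i
  have h2 : ‖inner ℂ ξ (ρ k.toC₀ ξ)‖ ≤ ‖ξ‖ ^ 2 := by
    refine (norm_inner_le_norm _ _).trans ?_
    rw [sq]
    gcongr
    refine ContinuousLinearMap.le_of_opNorm_le _
      ((NonUnitalStarAlgHom.norm_apply_le ρ _).trans hk) ξ |>.trans ?_
    rw [one_mul]
  rw [← hsum, Complex.norm_real] at h2
  exact (Real.le_norm_self _).trans h2

/-- Pseudolocal operators over open sets which agree on the intersections, up to locally compact
operators, may be glued. -/
theorem exists_glued_operator [MetrizableSpace X] [LocallyCompactSpace X] (𝒰 : Set (Opens X))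
    (E : 𝒰 → H →L[ℂ] H) {C : ℝ} (hC : 0 ≤ C) (hE : ∀ U, ‖E U‖ ≤ C)
    (hP : ∀ U : 𝒰, PseudolocalOn ρ U (E U))
    (hc : ∀ U V : 𝒰, LocCompactOn ρ ((U : Opens X) ⊓ V) (E U - E V)) :
    ∃ R : H →L[ℂ] H, ‖R‖ ≤ C ∧ PseudolocalOn ρ (sSup 𝒰) R ∧
      ∀ U : 𝒰, LocCompactOn ρ U (R - E U) := by
  obtain ⟨W, hW⟩ : ∃ W, W = sSup 𝒰 := ⟨_, rfl⟩
  obtain ⟨j, g, hgj, hgs, hg1, hgL⟩ := exists_partition_compactlySupported hW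
  -- The glued operator is ∑ g_i E_{j(i)} g_i. Placing square roots on both sides, in place of ∑
  -- g_i² E_{j(i)}, gives the norm bound C.
  obtain ⟨R, hR, hRs⟩ := (isBesselFamily_rep (ρ := ρ) hg1).exists_sum (fun i => E (j i)) hC
    fun i => hE _
  have hadj : ∀ i, adjoint (ρ (g i).toC₀) = ρ (g i).toC₀ := fun i => by
    rw [adjoint_map_toC₀, hgs]
  have hz : ∀ (f : C_c(X, ℂ)) i, (∀ x ∈ tsupport f, g i x = 0) → g i * f = 0 := fun f i h => by
    ext x
    by_cases hx : x ∈ tsupport f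
    · simp [h x hx]
    · simp [image_eq_zero_of_notMem_tsupport hx]
  have h0 : ρ (0 : C_c(X, ℂ)).toC₀ = 0 := map_zero ρ
  have hleft : ∀ (f : C_c(X, ℂ)) (s : Finset W), (∀ i, i ∉ s → ∀ x ∈ tsupport f, g i x = 0) →
      ρ f.toC₀ ∘L R = ∑ i ∈ s, ρ (f * g i).toC₀ ∘L E (j i) ∘L ρ (g i).toC₀ := fun f s hs => by
    rw [eq_comp_sum_of_hasSum hRs _ s fun i hi => ?_]
    · refine Finset.sum_congr rfl fun i _ => ?_
      rw [hadj, ← comp_assoc, map_toC₀_mul]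
    · rw [hadj, ← map_toC₀_mul, mul_comm, hz f i (hs i hi), h0]
  have hright : ∀ (f : C_c(X, ℂ)) (s : Finset W), (∀ i, i ∉ s → ∀ x ∈ tsupport f, g i x = 0) →
      R ∘L ρ f.toC₀ = ∑ i ∈ s, ρ (g i).toC₀ ∘L E (j i) ∘L ρ (g i * f).toC₀ := fun f s hs => by
    rw [comp_eq_sum_of_hasSum hRs _ s fun i hi => ?_]
    · refine Finset.sum_congr rfl fun i _ => ?_
      rw [hadj, map_toC₀_mul]
    · rw [← map_toC₀_mul, hz f i (hs i hi), h0]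
  have hv : ∀ i (f : C_c(X, ℂ)), VanishesOff (j i : Opens X) (g i * f).toC₀ := fun i f =>
    vanishesOff ((tsupport_mul_left _ _).trans (hgj i))
  have hv' : ∀ i, VanishesOff (j i : Opens X) (g i).toC₀ := fun i => vanishesOff (hgj i)
  -- After a cutoff f makes the sum finite, g_i may be moved across E_{j(i)}, which is pseudolocal
  -- on the support of g_i; the terms become f g_i² E_{j(i)}.
  have hterm : ∀ (f : C_c(X, ℂ)) i, ρ (f * g i).toC₀ ∘L E (j i) ∘L ρ (g i).toC₀ ≈ₖ
      ρ (f * (g i * g i)).toC₀ ∘L E (j i) := fun f i => by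
    refine ((hP _ _ (hv' i)).comp_left _).trans (CompactEq.of_eq ?_)
    rw [← comp_assoc, ← map_toC₀_mul, mul_assoc]
  have hRP : PseudolocalOn ρ W R := PseudolocalOn.of_compactSupport fun f hf => by
    obtain ⟨s, hs, -⟩ := hgL _ f.hasCompactSupport hf
    rw [hleft f s hs, hright f s hs]
    refine CompactEq.sum s fun i _ => ?_
    refine CompactEq.trans ?_ (hterm f i).symm
    refine ((hP _ _ (hv i f)).comp_left _).trans (CompactEq.of_eq ?_)
    rw [← comp_assoc, ← map_toC₀_mul, mul_comm f, mul_assoc]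
  refine ⟨R, hR, hW ▸ hRP, fun U => ?_⟩
  have hUW : (U : Opens X) ≤ W := hW ▸ le_sSup U.2
  refine LocCompactOn.of_comp_left ((hRP.mono hUW).sub (hP U)) fun f hf => ?_
  obtain ⟨s, hs, hs1⟩ := hgL _ f.hasCompactSupport (hf.trans hUW)
  rw [comp_sub, CompactEq.sub_zero_iff, hleft f s hs]
  have hf1 : f = ∑ i ∈ s, f * (g i * g i) := by
    ext x
    rw [CompactlySupportedContinuousMap.sum_apply]
    simp only [mul_apply, ← Finset.mul_sum]
    by_cases hx : x ∈ tsupport f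
    · rw [hs1 x hx, mul_one]
    · rw [image_eq_zero_of_notMem_tsupport hx, zero_mul]
  have e : ρ f.toC₀ ∘L E U = ∑ i ∈ s, ρ (f * (g i * g i)).toC₀ ∘L E U := by
    conv_lhs => rw [hf1, toC₀_sum, map_sum, finsetSum_comp]
  rw [e]
  refine CompactEq.sum s fun i _ => (hterm f i).trans ?_
  rw [← CompactEq.sub_zero_iff, ← comp_sub]
  -- The function f g_i² vanishes outside the intersection of U with the open set of index j(i),
  -- where E_{j(i)} and E_U agree up to locally compact operators; and ∑ f g_i² = f.
  refine (hc (j i) U _ fun x hx => ?_).2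
  rw [toC₀_apply, mul_apply, mul_apply]
  by_cases hxU : x ∈ (U : Opens X)
  · have : x ∉ tsupport (g i) := fun h => hx ⟨hgj i h, hxU⟩
    rw [image_eq_zero_of_notMem_tsupport this, zero_mul, mul_zero]
  · have : x ∉ tsupport f := fun h => hxU (hf h)
    rw [image_eq_zero_of_notMem_tsupport this, zero_mul]

theorem PseudolocalOn.isLocallyCompactOp_compressOp_iff {T : H →L[ℂ] H} {W : Opens X}
    (hT : PseudolocalOn ρ W T) :
    IsLocallyCompactOp ρ W (compressOp ρ W T) ↔ LocCompactOn ρ W T := by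
  refine ⟨fun h => ?_, fun h => h.isLocallyCompactOp_compressOp⟩
  have := (isLocallyCompactOp_iff.1 h).sub hT.extendOp_compressOp_sub
  rwa [sub_sub_cancel] at this

theorem isLocallyCompactOp_restrictOp_sub_iff {V V' W : Opens X} (h : W ≤ V) (h' : W ≤ V')
    {T : LocalModule ρ V →L[ℂ] LocalModule ρ V} {T' : LocalModule ρ V' →L[ℂ] LocalModule ρ V'}
    (hT : IsPseudolocal ρ V T) (hT' : IsPseudolocal ρ V' T') :
    IsLocallyCompactOp ρ W (restrictOp ρ V W T - restrictOp ρ V' W T') ↔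
      LocCompactOn ρ W (extendOp ρ V T - extendOp ρ V' T') := by
  rw [restrictOp_eq, restrictOp_eq, ← compressOp_sub]
  exact (((isPseudolocal_iff.1 hT).mono h).sub
    ((isPseudolocal_iff.1 hT').mono h')).isLocallyCompactOp_compressOp_iff

/-- Coincidence of restrictions is expressed on the whole space H through extensions by zero, which
is the form required for gluing. -/
theorem restrictQ_eq_iff {V V' W : Opens X} (h : W ≤ V) (h' : W ≤ V') {T : algD ρ V}
    {T' : algD ρ V'} : restrictQ ρ h ((idealC ρ V).toQuot T) =
      restrictQ ρ h' ((idealC ρ V').toQuot T') ↔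
      LocCompactOn ρ W (extendOp ρ V T.1 - extendOp ρ V' T'.1) := by
  have h1 := restrictQ_toQuot h T
  have h2 := restrictQ_toQuot h' T'
  rw [h1, h2]
  exact toQuot_idealC_eq_iff.trans (isLocallyCompactOp_restrictOp_sub_iff h h' T.2 T'.2)

/-- Separatedness is the locality of local compactness, `LocCompactOn.of_sSup`. -/
theorem symbolPresheaf_eq_zero [T2Space X] [LocallyCompactSpace X] (𝒰 : Set (Opens X))
    (a : algQ ρ (sSup 𝒰)) (h : ∀ U (hU : U ∈ 𝒰), restrictQ ρ (le_sSup hU) a = 0) : a = 0 := by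
  obtain ⟨T, rfl⟩ := (idealC ρ _).toQuot_surjective a
  rw [CStarIdeal.toQuot_eq_zero, mem_idealC_iff, isLocallyCompactOp_iff]
  refine LocCompactOn.of_sSup (isPseudolocal_iff.1 T.2) fun U hU => ?_
  have := h U hU
  rw [← map_zero (restrictQ ρ (le_sSup hU)), ← map_zero (idealC ρ (sSup 𝒰)).toQuot] at this
  have h3 := (restrictQ_eq_iff _ _).1 this
  have h4 : extendOp ρ (sSup 𝒰) (0 : algD ρ (sSup 𝒰)).1 = 0 := by
    ext1 v; simp [extendOp]
  rwa [h4, sub_zero] at h3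

/-- The presheaf `𝔔` is a sheaf. -/
theorem symbolPresheaf_isSheaf [MetrizableSpace X] [LocallyCompactSpace X] :
    (symbolPresheaf ρ).IsSheaf where
  empty := ⟨fun a b => by
    obtain ⟨S, rfl⟩ := (idealC ρ ⊥).toQuot_surjective a
    obtain ⟨T, rfl⟩ := (idealC ρ ⊥).toQuot_surjective b
    refine toQuot_idealC_eq_iff.2 fun f hf => ?_
    have h0 : localRep ρ ⊥ f = 0 := by
      have : f = 0 := by
        ext x
        exact hf x id
      rw [localRep_eq, this, map_zero]
      ext1 v; simp [compressOp]
    rw [h0, mul_zero, zero_mul]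
    exact ⟨isCompactOperator_zero, isCompactOperator_zero⟩⟩
  uniqueness := symbolPresheaf_eq_zero
  gluing 𝒰 a hb hc := by
    have hC : 0 ≤ ⨆ U : 𝒰, ‖a U‖ := Real.iSup_nonneg fun U => norm_nonneg _
    -- The quotient norm is an infimum over representatives, so operators representing the family
    -- can be bounded uniformly by the supremum plus ε.
    have key : ∀ ε : ℝ, 0 < ε → ∃ b : algQ ρ (sSup 𝒰),
        (∀ U : 𝒰, restrictQ ρ (le_sSup U.2) b = a U) ∧ ‖b‖ ≤ (⨆ U : 𝒰, ‖a U‖) + ε := fun ε hε => by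
      choose T hT hTn using fun U : 𝒰 => (idealC ρ (U : Opens X)).exists_norm_lt (a U) hε
      obtain ⟨R, hR, hRP, hRU⟩ := exists_glued_operator (ρ := ρ) 𝒰
        (fun U => extendOp ρ (U : Opens X) (T U).1) (add_nonneg hC hε.le)
        (fun U => (norm_extendOp_le _).trans ((hTn U).le.trans
          (by gcongr; exact le_ciSup hb U)))
        (fun U => isPseudolocal_iff.1 (T U).2)
        (fun U V => (restrictQ_eq_iff inf_le_left inf_le_right).1 (by
          rw [hT, hT]; exact hc U V))
      have hRm : compressOp ρ (sSup 𝒰) R ∈ algD ρ (sSup 𝒰) := hRP.isPseudolocal_compressOp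
      refine ⟨(idealC ρ (sSup 𝒰)).toQuot ⟨_, hRm⟩, fun U => ?_, ?_⟩
      · have h1 := (symbolPresheaf ρ).res_refl (a U)
        refine Eq.trans ?_ h1
        change _ = restrictQ ρ le_rfl (a U)
        rw [← hT U]
        refine (restrictQ_eq_iff (le_sSup U.2) le_rfl).2 ?_
        have h2 := (hRP.extendOp_compressOp_sub.mono (le_sSup U.2)).add (hRU U)
        rwa [sub_add_sub_cancel] at h2
      · refine (CStarIdeal.norm_toQuot_le _ _).trans ?_
        exact (norm_compressOp_le R).trans hR
    -- The value 1 is arbitrary: by uniqueness the glued section is the same for all ε, hence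
    -- satisfies all the bounds at once.
    obtain ⟨b, hb1, -⟩ := key 1 one_pos
    refine ⟨b, hb1, le_of_forall_pos_le_add fun ε hε => ?_⟩
    obtain ⟨b', hb', hbn⟩ := key ε hε
    have : b - b' = 0 := symbolPresheaf_eq_zero 𝒰 _ fun U hU => by
      rw [map_sub, hb1 ⟨U, hU⟩, hb' ⟨U, hU⟩, sub_self]
    rwa [sub_eq_zero.1 this]

end SymbolSheaf

/-! ### Multiplication by bounded continuous functions -/

section MultiplicationOperators

open ContinuousLinearMap

variable {Y : Type*} [TopologicalSpace Y]
  {K : Type*} [NormedAddCommGroup K] [InnerProductSpace ℂ K] [CompleteSpace K]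
  {ρ : C₀(Y, ℂ) →⋆ₙₐ[ℂ] (K →L[ℂ] K)} {V W : Opens Y}

open Classical in
/-- The product of a function on `W` and a function on `Y`, extended by zero. -/
noncomputable def mulExtFun (F : W → ℂ) (g : Y → ℂ) (y : Y) : ℂ :=
  if h : y ∈ W then F ⟨y, h⟩ * g y else 0

theorem mulExtFun_of_mem {F : W → ℂ} {g : Y → ℂ} {y : Y} (h : y ∈ W) :
    mulExtFun F g y = F ⟨y, h⟩ * g y := dif_pos h

theorem mulExtFun_of_notMem {F : W → ℂ} {g : Y → ℂ} {y : Y} (h : y ∉ W) :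
    mulExtFun F g y = 0 := dif_neg h

theorem norm_mulExtFun_le (F : W →ᵇ ℂ) (g : Y → ℂ) (y : Y) :
    ‖mulExtFun F g y‖ ≤ ‖F‖ * ‖g y‖ := by
  by_cases h : y ∈ W
  · rw [mulExtFun_of_mem h, norm_mul]
    gcongr
    exact F.norm_coe_le_norm _
  · rw [mulExtFun_of_notMem h, norm_zero]
    positivity

/-- F may have no limit at boundary points of W, but g tends to 0 there and F is bounded. -/
theorem continuous_mulExtFun (F : W →ᵇ ℂ) {g : C₀(Y, ℂ)} (hg : VanishesOff W g) :
    Continuous (mulExtFun F g) := by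
  rw [continuous_iff_continuousAt]
  intro y
  by_cases h : y ∈ W
  · refine (W.isOpen.isOpenEmbedding_subtypeVal.continuousAt_iff (x := ⟨y, h⟩)).1 ?_
    have hc : Continuous fun w : W => F w * g w := by fun_prop
    exact hc.continuousAt.congr (.of_forall fun w => (mulExtFun_of_mem w.2).symm)
  · rw [ContinuousAt, mulExtFun_of_notMem h]
    refine squeeze_zero_norm (norm_mulExtFun_le F g) ?_
    have h1 : Tendsto (fun z => ‖F‖ * ‖g z‖) (𝓝 y) (𝓝 (‖F‖ * ‖g y‖)) :=
      Continuous.tendsto (by fun_prop) y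
    simpa [hg y h] using h1

/-- The product of a bounded function on `W` and a function in `C₀(W)`, extended by zero. -/
noncomputable def mulExt (F : W →ᵇ ℂ) (g : C₀(Y, ℂ)) (hg : VanishesOff W g) : C₀(Y, ℂ) where
  toFun := mulExtFun F g
  continuous_toFun := continuous_mulExtFun F hg
  zero_at_infty' := by
    refine squeeze_zero_norm (norm_mulExtFun_le F g) ?_
    have h1 := (g.zero_at_infty'.norm).const_mul ‖F‖
    simpa using h1

theorem mulExt_apply {F : W →ᵇ ℂ} {g : C₀(Y, ℂ)} (hg : VanishesOff W g) {y : Y} (h : y ∈ W) :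
    mulExt F g hg y = F ⟨y, h⟩ * g y := mulExtFun_of_mem h

theorem vanishesOff_mulExt (F : W →ᵇ ℂ) {g : C₀(Y, ℂ)} (hg : VanishesOff W g) :
    VanishesOff W (mulExt F g hg) := fun _ h => mulExtFun_of_notMem h

theorem eq_mulExt {F : W →ᵇ ℂ} {g g' : C₀(Y, ℂ)} (hg : VanishesOff W g) (hg' : VanishesOff W g')
    (h : ∀ (y : Y) (hy : y ∈ W), g' y = F ⟨y, hy⟩ * g y) : g' = mulExt F g hg := by
  ext y
  by_cases hy : y ∈ W
  · rw [h y hy, mulExt_apply hg hy]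
  · rw [hg' y hy, vanishesOff_mulExt F hg y hy]

theorem localRep_total : (Submodule.span ℂ (Set.range
    fun i : {g : C₀(Y, ℂ) // VanishesOff W g} × LocalModule ρ W =>
      localRep ρ W i.1 i.2)).topologicalClosure = ⊤ := by
  rw [Submodule.topologicalClosure_eq_top_iff, Submodule.eq_bot_iff]
  intro v hv
  have h1 : innerSL ℂ v = 0 := by
    refine ext_localRep (ρ := ρ) (W := W) fun f hf => ?_
    ext1 w
    exact (Submodule.mem_orthogonal' _ _).1 hv _ (Submodule.subset_span ⟨(⟨f, hf⟩, w), rfl⟩)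
  have h2 := DFunLike.congr_fun h1 v
  exact (inner_self_eq_zero (𝕜 := ℂ)).1 h2

theorem inner_localRep {f g : C₀(Y, ℂ)} (hf : VanishesOff W f) (hg : VanishesOff W g)
    (v w : LocalModule ρ W) : inner ℂ (localRep ρ W f v) (localRep ρ W g w) =
      inner ℂ v (localRep ρ W (star f * g) w) := by
  rw [localRep_mul hf.star hg, ← localRep_star]
  exact (adjoint_inner_right _ _ _).symm

/-- With k = √(‖F‖² − |F|²) one has F̄F + k̄k = ‖F‖², so multiplication by k supplies the defect in
the Gram matrix criterion, and multiplication by F is bounded on the total family of vectors ρ(g)v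
with g ∈ C₀(W). -/
theorem exists_mulOp (F : W →ᵇ ℂ) : ∃ T : LocalModule ρ W →L[ℂ] LocalModule ρ W,
    ∀ g (hg : VanishesOff W g), T * localRep ρ W g = localRep ρ W (mulExt F g hg) := by
  let k : W →ᵇ ℂ := BoundedContinuousFunction.ofNormedAddCommGroup
    (fun w => (Real.sqrt (‖F‖ ^ 2 - ‖F w‖ ^ 2) : ℂ)) (by fun_prop) ‖F‖ fun w => by
      rw [Complex.norm_real, Real.norm_of_nonneg (Real.sqrt_nonneg _)]
      refine Real.sqrt_le_iff.2 ⟨norm_nonneg _, ?_⟩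
      linarith [sq_nonneg ‖F w‖]
  have hk : ∀ w, star (F w) * F w + star (k w) * k w = (‖F‖ : ℂ) ^ 2 := fun w => by
    have h1 : star (k w) = k w := Complex.conj_ofReal _
    have h2 : k w * k w = ((‖F‖ ^ 2 - ‖F w‖ ^ 2 : ℝ) : ℂ) := by
      change (Real.sqrt _ : ℂ) * (Real.sqrt _ : ℂ) = _
      rw [← Complex.ofReal_mul, Real.mul_self_sqrt]
      have := F.norm_coe_le_norm w
      nlinarith [norm_nonneg (F w)]
    have h3 : star (F w) * F w = ((‖F w‖ ^ 2 : ℝ) : ℂ) := by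
      push_cast
      exact Complex.conj_mul' (F w)
    rw [h1, h2, h3]
    push_cast
    ring
  refine (exists_clm_of_gram
    (fun i : {g : C₀(Y, ℂ) // VanishesOff W g} × LocalModule ρ W => localRep ρ W i.1 i.2)
    (fun i => localRep ρ W (mulExt F i.1.1 i.1.2) i.2)
    (fun i => localRep ρ W (mulExt k i.1.1 i.1.2) i.2) localRep_total (norm_nonneg F) ?_).imp
    fun T hT g hg => by ext1 v; exact hT (⟨g, hg⟩, v)
  rintro ⟨⟨g, hg⟩, v⟩ ⟨⟨g', hg'⟩, v'⟩
  have e : star (mulExt F g hg) * mulExt F g' hg' + star (mulExt k g hg) * mulExt k g' hg' =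
      ((‖F‖ : ℂ) ^ 2) • (star g * g') := by
    ext y
    change star (mulExt F g hg y) * mulExt F g' hg' y +
      star (mulExt k g hg y) * mulExt k g' hg' y = (‖F‖ : ℂ) ^ 2 * (star (g y) * g' y)
    by_cases hy : y ∈ W
    · simp only [mulExt_apply _ hy, star_mul]
      linear_combination (star (g y) * g' y) * hk ⟨y, hy⟩
    · simp [vanishesOff_mulExt _ _ y hy, hg y hy]
  simp only
  rw [inner_localRep (vanishesOff_mulExt F hg) (vanishesOff_mulExt F hg'),
    inner_localRep (vanishesOff_mulExt k hg) (vanishesOff_mulExt k hg'), inner_localRep hg hg',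
    ← inner_add_right, ← _root_.add_apply, ← localRep_add, e]
  simp only [localRep_eq, map_smul, compressOp_smul, _root_.smul_apply, inner_smul_right]

variable (ρ) in
/-- Multiplication by a bounded continuous function on `W`. -/
noncomputable def mulOp (F : W →ᵇ ℂ) : LocalModule ρ W →L[ℂ] LocalModule ρ W :=
  Classical.choose (exists_mulOp (ρ := ρ) F)

theorem mulOp_mul_localRep (F : W →ᵇ ℂ) {g : C₀(Y, ℂ)} (hg : VanishesOff W g) :
    mulOp ρ F * localRep ρ W g = localRep ρ W (mulExt F g hg) :=
  Classical.choose_spec (exists_mulOp (ρ := ρ) F) g hg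

theorem eq_of_mul_localRep {S T : LocalModule ρ W →L[ℂ] LocalModule ρ W}
    (h : ∀ f, VanishesOff W f → S * localRep ρ W f = T * localRep ρ W f) : S = T :=
  ext_localRep h

/-- Multiplication operators are determined by their products with C₀(W), so identities between them
reduce to pointwise identities of functions. -/
theorem mulOp_eq {F : W →ᵇ ℂ} {T : LocalModule ρ W →L[ℂ] LocalModule ρ W}
    (h : ∀ g (hg : VanishesOff W g), T * localRep ρ W g = localRep ρ W (mulExt F g hg)) :
    mulOp ρ F = T :=
  eq_of_mul_localRep fun g hg => by rw [mulOp_mul_localRep F hg, h g hg]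

theorem localRep_mul_mulOp (F : W →ᵇ ℂ) {g : C₀(Y, ℂ)} (hg : VanishesOff W g) :
    localRep ρ W g * mulOp ρ F = localRep ρ W (mulExt F g hg) := by
  refine eq_of_mul_localRep fun h hh => ?_
  rw [mul_assoc, mulOp_mul_localRep F hh, ← localRep_mul hg (vanishesOff_mulExt F hh),
    ← localRep_mul (vanishesOff_mulExt F hg) hh]
  congr 1
  ext y
  change g y * mulExt F h hh y = mulExt F g hg y * h y
  by_cases hy : y ∈ W
  · rw [mulExt_apply hh hy, mulExt_apply hg hy]; ring
  · rw [hg y hy, hh y hy, zero_mul, mul_zero]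

theorem mulOp_one : mulOp ρ (1 : W →ᵇ ℂ) = 1 := mulOp_eq fun g hg => by
  rw [one_mul]
  exact congrArg _ (eq_mulExt hg hg fun y hy => (one_mul _).symm)

theorem mulOp_mul (F G : W →ᵇ ℂ) : mulOp ρ (F * G) = mulOp ρ F * mulOp ρ G :=
  mulOp_eq fun g hg => by
    rw [mul_assoc, mulOp_mul_localRep G hg, mulOp_mul_localRep F (vanishesOff_mulExt G hg)]
    refine congrArg _ (eq_mulExt hg (vanishesOff_mulExt F (vanishesOff_mulExt G hg)) fun y hy => ?_)
    rw [mulExt_apply _ hy, mulExt_apply _ hy, ← mul_assoc]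
    rfl

theorem mulOp_add (F G : W →ᵇ ℂ) : mulOp ρ (F + G) = mulOp ρ F + mulOp ρ G :=
  mulOp_eq fun g hg => by
    rw [add_mul, mulOp_mul_localRep G hg, mulOp_mul_localRep F hg, ← localRep_add]
    refine congrArg _ (eq_mulExt hg (fun y hy => ?_) fun y hy => ?_)
    · change mulExt F g hg y + mulExt G g hg y = 0
      rw [vanishesOff_mulExt F hg y hy, vanishesOff_mulExt G hg y hy, add_zero]
    · change mulExt F g hg y + mulExt G g hg y = _
      rw [mulExt_apply _ hy, mulExt_apply _ hy, ← add_mul]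
      rfl

theorem mulOp_const (c : ℂ) : mulOp ρ (BoundedContinuousFunction.const W c) =
    c • (1 : LocalModule ρ W →L[ℂ] LocalModule ρ W) :=
  mulOp_eq fun g hg => by
    have : localRep ρ W (c • g) = c • localRep ρ W g := by
      simp only [localRep_eq, map_smul, compressOp_smul]
    rw [smul_mul_assoc, one_mul, ← this]
    refine congrArg _ (eq_mulExt hg (fun y hy => ?_) fun y hy => rfl)
    change c * g y = 0
    rw [hg y hy, mul_zero]

theorem mulOp_star (F : W →ᵇ ℂ) : mulOp ρ (star F) = star (mulOp ρ F) :=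
  mulOp_eq fun g hg => by
    have h1 := congrArg star (localRep_mul_mulOp (ρ := ρ) F hg.star)
    rw [star_mul, localRep_star, star_star, localRep_star] at h1
    rw [h1]
    refine congrArg _ (eq_mulExt hg (vanishesOff_mulExt F hg.star).star fun y hy => ?_)
    change star (mulExt F (star g) hg.star y) = _
    rw [mulExt_apply _ hy]
    change star (F ⟨y, hy⟩ * star (g y)) = star (F ⟨y, hy⟩) * g y
    rw [star_mul, star_star, mul_comm]

theorem isPseudolocal_mulOp (F : W →ᵇ ℂ) : IsPseudolocal ρ W (mulOp ρ F) := fun f hf => by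
  rw [mulOp_mul_localRep F hf, localRep_mul_mulOp F hf, sub_self]
  exact isCompactOperator_zero

/-- Pseudolocal operators commute with multiplication operators up to locally compact operators. -/
theorem IsPseudolocal.commutator_mulOp {T : LocalModule ρ W →L[ℂ] LocalModule ρ W}
    (hT : IsPseudolocal ρ W T) (F : W →ᵇ ℂ) :
    IsLocallyCompactOp ρ W (mulOp ρ F * T - T * mulOp ρ F) := fun f hf => by
  -- Both f and Ff are in C₀(W), although F itself is not. Pseudolocality is applied to each: F T f
  -- ≈ F f T = (Ff) T ≈ T (Ff), and similarly with f on the left.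
  have h1 : localRep ρ W f * T ≈ₖ T * localRep ρ W f := CompactEq.symm (hT f hf)
  have h2 : localRep ρ W (mulExt F f hf) * T ≈ₖ T * localRep ρ W (mulExt F f hf) :=
    CompactEq.symm (hT _ (vanishesOff_mulExt F hf))
  constructor
  · have e : (mulOp ρ F * T - T * mulOp ρ F) * localRep ρ W f =
        mulOp ρ F * (T * localRep ρ W f) - T * localRep ρ W (mulExt F f hf) := by
      rw [sub_mul, mul_assoc, mul_assoc, mulOp_mul_localRep]
    rw [e]
    refine CompactEq.trans (h1.symm.comp_left (mulOp ρ F)) ?_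
    refine CompactEq.trans (CompactEq.of_eq ?_) h2
    change mulOp ρ F * (localRep ρ W f * T) = _
    rw [← mul_assoc, mulOp_mul_localRep]
  · have e : localRep ρ W f * (mulOp ρ F * T - T * mulOp ρ F) =
        localRep ρ W (mulExt F f hf) * T - (localRep ρ W f * T) * mulOp ρ F := by
      rw [mul_sub, ← mul_assoc, ← mul_assoc, localRep_mul_mulOp]
    rw [e]
    refine CompactEq.trans h2 ?_
    refine CompactEq.trans (CompactEq.of_eq ?_) (h1.symm.comp_right (mulOp ρ F))
    change _ = T * localRep ρ W f * mulOp ρ F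
    rw [mul_assoc, localRep_mul_mulOp]

/-- Multiplication operators restrict to multiplication operators. -/
theorem restrictOp_mulOp (h : W ≤ V) (F : V →ᵇ ℂ) :
    restrictOp ρ V W (mulOp ρ F) = mulOp ρ (CStarPresheaf.restrictBounded h F) :=
  Eq.symm (mulOp_eq fun g hg => by
    have hgV := hg.mono h
    rw [restrictOp_eq, compressOp_comp_rep hg, ← extendOp_localRep hgV]
    have := extendOp_mul (mulOp ρ F) (localRep ρ V g)
    rw [← this, mulOp_mul_localRep F hgV, extendOp_localRep (vanishesOff_mulExt F hgV),
      ← localRep_eq]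
    refine congrArg _ (eq_mulExt hg (fun y hy => ?_) fun y hy => mulExt_apply hgV (h hy))
    by_cases hyV : y ∈ V
    · rw [mulExt_apply hgV hyV, hg y hy, mul_zero]
    · exact vanishesOff_mulExt F hgV y hyV)

end MultiplicationOperators

/-! ### The module structure on 𝔔_Γ -/

section SpecialSheaf

open ContinuousLinearMap

namespace NormalCovering

variable {Γ Y X : Type*} [Group Γ] [TopologicalSpace Y] [TopologicalSpace X] [MulAction Γ Y]
  (π : NormalCovering Γ Y X) {U V : Opens X}

/-- The function `f ∘ π` on `π⁻¹(U)`. -/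
noncomputable def pullBounded (f : U →ᵇ ℂ) : π.preimage U →ᵇ ℂ :=
  f.compContinuous ⟨fun y => ⟨π.proj y, y.2⟩,
    (π.continuous_proj.comp continuous_subtype_val).subtype_mk _⟩

theorem pullBounded_apply (f : U →ᵇ ℂ) {y : Y} (hy : y ∈ π.preimage U) :
    π.pullBounded f ⟨y, hy⟩ = f ⟨π.proj y, hy⟩ := rfl

variable [T2Space X] [CompactSpace X]
  {H : Type*} [NormedAddCommGroup H] [InnerProductSpace ℂ H] [CompleteSpace H]
  (ρ : C₀(X, ℂ) →⋆ₙₐ[ℂ] (H →L[ℂ] H))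

theorem compressOp_translation_mul_localRep (γ : Γ) {g : C₀(Y, ℂ)}
    (hg : VanishesOff (π.preimage U) g) :
    compressOp (π.inducedRep ρ) (π.preimage U) (π.inducedTranslation ρ γ) *
      localRep (π.inducedRep ρ) (π.preimage U) g =
    localRep (π.inducedRep ρ) (π.preimage U) (π.translateZero γ g) *
      compressOp (π.inducedRep ρ) (π.preimage U) (π.inducedTranslation ρ γ) := by
  rw [compressOp_comp_rep hg, rep_comp_compressOp (π.vanishesOff_translateZero γ hg),
    π.translation_comp_inducedRep]

/-- A multiplication operator is supported on the diagonal, which is controlled because Γ acts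
cocompactly; it commutes with C₀(π⁻¹(U)), and with translations because f ∘ π is constant on orbits.
-/
theorem mulOp_mem_preAlgDΓ (f : U →ᵇ ℂ) : mulOp (π.inducedRep ρ) (π.pullBounded f) ∈
    preAlgDΓ (π.inducedRep ρ) (π.preimage U) π (π.inducedAction ρ) := by
  refine ⟨?_, isPseudolocal_mulOp _, fun γ => ?_⟩
  · obtain ⟨L, hL, hLY⟩ := π.exists_compact_cover
    refine ⟨{p | ∃ γ : Γ, ∃ a ∈ L, ∃ b ∈ L, p = (γ • a, γ • b)}, ⟨L, hL, fun p hp => hp⟩,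
      fun g h _ hgW _ hhW hd => ?_⟩
    have hg0 := vanishesOff_of_tsupport hgW
    have hh0 := vanishesOff_of_tsupport hhW
    rw [localRep_mul_mulOp _ hg0, ← localRep_mul (vanishesOff_mulExt _ hg0) hh0]
    have : mulExt (π.pullBounded f) g hg0 * h = 0 := by
      ext y
      change mulExt (π.pullBounded f) g hg0 y * h y = 0
      by_cases hy : y ∈ π.preimage U
      · rw [mulExt_apply hg0 hy]
        by_cases hy1 : y ∈ tsupport g
        · by_cases hy2 : y ∈ tsupport h
          · obtain ⟨γ, a, ha, rfl⟩ := hLY y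
            exact absurd ⟨γ, a, ha, a, ha, rfl⟩
              (Set.disjoint_left.1 hd (show (γ • a, γ • a) ∈ _ from ⟨hy1, hy2⟩))
          · rw [image_eq_zero_of_notMem_tsupport hy2, mul_zero]
        · rw [image_eq_zero_of_notMem_tsupport hy1, mul_zero, zero_mul]
      · rw [hh0 y hy, mul_zero]
    rw [this, localRep_eq, map_zero]
    ext1 v; simp [compressOp]
  · change _ * compressOp _ _ (π.inducedTranslation ρ γ) =
      compressOp _ _ (π.inducedTranslation ρ γ) * _
    refine eq_of_mul_localRep fun g hg => ?_
    have hgF := vanishesOff_mulExt (π.pullBounded f) hg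
    have hγ := π.vanishesOff_translateZero γ hg
    rw [mul_assoc, π.compressOp_translation_mul_localRep ρ γ hg, mul_assoc,
      mulOp_mul_localRep _ hg, π.compressOp_translation_mul_localRep ρ γ hgF, ← mul_assoc,
      mulOp_mul_localRep _ hγ]
    congr 2
    refine (eq_mulExt hγ (π.vanishesOff_translateZero γ hgF) fun y hy => ?_).symm
    change mulExt (π.pullBounded f) g hg (γ⁻¹ • y) = _ * g (γ⁻¹ • y)
    have hy' : γ⁻¹ • y ∈ π.preimage U := by
      rw [π.mem_preimage, π.proj_smul]
      exact hy
    rw [mulExt_apply hg hy', pullBounded_apply, pullBounded_apply]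
    congr 3
    exact π.proj_smul _ _

/-- Multiplication by `f ∘ π`, as an element of `𝔇_Γ(U)`. -/
noncomputable def mulD (f : U →ᵇ ℂ) : π.𝔇Γ ρ U :=
  ⟨mulOp (π.inducedRep ρ) (π.pullBounded f), mem_𝔇Γ_of_mem_preAlgDΓ (π.mulOp_mem_preAlgDΓ ρ f)⟩

theorem isMultiplication_mulD (f : U →ᵇ ℂ) :
    π.IsMultiplication (ρ := ρ) f (π.mulD ρ f) := fun g g' hg hg' h => by
  rw [eq_mulExt (F := π.pullBounded f) hg hg' h]
  exact mulOp_mul_localRep _ hg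

/-- The class of multiplication by `f ∘ π`. -/
noncomputable def mulQ (f : U →ᵇ ℂ) : π.𝔔Γ ρ U := (π.ℭΓ ρ U).toQuot (π.mulD ρ f)

theorem mulQ_one : π.mulQ ρ (1 : U →ᵇ ℂ) = 1 :=
  (congrArg (π.ℭΓ ρ U).toQuot (Subtype.ext mulOp_one)).trans (map_one _)

theorem mulQ_mul (f g : U →ᵇ ℂ) : π.mulQ ρ (f * g) = π.mulQ ρ f * π.mulQ ρ g :=
  (congrArg (π.ℭΓ ρ U).toQuot (Subtype.ext (mulOp_mul (π.pullBounded f) (π.pullBounded g)) :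
    π.mulD ρ (f * g) = π.mulD ρ f * π.mulD ρ g)).trans (map_mul _ _ _)

theorem mulQ_add (f g : U →ᵇ ℂ) : π.mulQ ρ (f + g) = π.mulQ ρ f + π.mulQ ρ g :=
  (congrArg (π.ℭΓ ρ U).toQuot (Subtype.ext (mulOp_add (π.pullBounded f) (π.pullBounded g)) :
    π.mulD ρ (f + g) = π.mulD ρ f + π.mulD ρ g)).trans (map_add _ _ _)

theorem mulQ_const (c : ℂ) : π.mulQ ρ (BoundedContinuousFunction.const U c) = c • 1 :=
  (congrArg (π.ℭΓ ρ U).toQuot (Subtype.ext (mulOp_const c) :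
    π.mulD ρ (BoundedContinuousFunction.const U c) = c • 1)).trans
    ((map_smul _ _ _).trans (congrArg _ (map_one _)))

theorem mulQ_star (f : U →ᵇ ℂ) : π.mulQ ρ (star f) = star (π.mulQ ρ f) :=
  (congrArg (π.ℭΓ ρ U).toQuot (Subtype.ext (mulOp_star (π.pullBounded f)) :
    π.mulD ρ (star f) = star (π.mulD ρ f))).trans (CStarIdeal.toQuot_star _ _)

/-- Centrality of these classes is what makes left multiplication by them a module structure
compatible with products and the involution. -/
theorem mulQ_comm (f : U →ᵇ ℂ) (a : π.𝔔Γ ρ U) : π.mulQ ρ f * a = a * π.mulQ ρ f := by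
  obtain ⟨T, rfl⟩ := (π.ℭΓ ρ U).toQuot_surjective a
  have h1 : (π.ℭΓ ρ U).toQuot (π.mulD ρ f * T) = (π.ℭΓ ρ U).toQuot (T * π.mulD ρ f) :=
    toQuot_eq_iff_locallyCompact.2 ((π.isPseudolocal_of_mem ρ T.2).commutator_mulOp _)
  rwa [map_mul, map_mul] at h1

theorem restrictQΓ_mulQ (h : U ≤ V) (f : V →ᵇ ℂ) : π.restrictQΓ ρ h (π.mulQ ρ f) =
    π.mulQ ρ (CStarPresheaf.restrictBounded h f) :=
  (π.restrictQΓ_toQuot ρ h _).trans (congrArg (π.ℭΓ ρ U).toQuot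
    (Subtype.ext (restrictOp_mulOp (π.preimage_mono h) (π.pullBounded f))))

/-- The module structure on `𝔔_Γ`. -/
noncomputable def moduleStructure : (π.symbolPresheafΓ ρ).ModuleStructure where
  act _ f a := π.mulQ ρ f * a
  one_act _ a := by rw [π.mulQ_one, one_mul]
  mul_act _ f g a := by rw [π.mulQ_mul, mul_assoc]
  add_act _ f g a := by rw [π.mulQ_add, add_mul]
  act_add _ f a b := mul_add _ _ _
  const_act _ c a := by rw [π.mulQ_const, smul_mul_assoc, one_mul]
  act_mul _ f a b := (mul_assoc _ _ _).symm
  mul_act_comm _ f a b := by rw [← mul_assoc, π.mulQ_comm, mul_assoc]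
  star_act _ f a := by rw [star_mul, ← π.mulQ_star, π.mulQ_comm]
  res_act h f a := by
    change π.restrictQΓ ρ h _ = _ * π.restrictQΓ ρ h a
    rw [map_mul, π.restrictQΓ_mulQ]

end NormalCovering

end SpecialSheaf

/-! ### Functions carried by sections of the covering -/

section SectionLifts

open ContinuousLinearMap
open CompactlySupportedContinuousMap hiding comp_assoc comp_id zero_comp
open scoped CompactlySupported

set_option linter.unusedSectionVars false

/-- The extension by zero of a compactly supported function along an open embedding. -/
theorem Topology.IsOpenEmbedding.continuous_extend_zero {Z Y : Type*} [TopologicalSpace Z]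
    [TopologicalSpace Y] [T2Space Y] {s : Z → Y} (hs : IsOpenEmbedding s) {b : Z → ℂ}
    (hb : Continuous b) {L : Set Z} (hL : IsCompact L) (hbL : ∀ z, z ∉ L → b z = 0) :
    Continuous (Function.extend s b 0) := by
  rw [continuous_iff_continuousAt]
  intro y
  by_cases hy : y ∈ Set.range s
  · obtain ⟨z, rfl⟩ := hy
    refine hs.continuousAt_iff.1 (hb.continuousAt.congr (.of_forall fun w => ?_))
    exact (hs.injective.extend_apply b 0 w).symm
  · have hK := (hL.image hs.continuous).isClosed
    have h0 : ∀ w ∈ (s '' L)ᶜ, Function.extend s b 0 w = 0 := fun w hw => by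
      by_cases h : w ∈ Set.range s
      · obtain ⟨z, rfl⟩ := h
        rw [hs.injective.extend_apply]
        exact hbL z fun hz => hw ⟨z, hz, rfl⟩
      · exact Function.extend_apply' _ _ _ h
    have hyL : y ∈ (s '' L)ᶜ := fun ⟨z, _, hz⟩ => hy ⟨z, hz⟩
    exact continuousAt_const.congr
      (Filter.eventuallyEq_of_mem (hK.isOpen_compl.mem_nhds hyL) fun w hw => (h0 w hw).symm)

namespace NormalCovering

variable {Γ Y X : Type*} [Group Γ] [TopologicalSpace Y] [TopologicalSpace X] [MulAction Γ Y]
  [T2Space X] [CompactSpace X] (π : NormalCovering Γ Y X) {U V : Opens X}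

theorem isLocalHomeomorph_proj : IsLocalHomeomorph π.proj :=
  π.isQuotientCoveringMap.isCoveringMap.isLocalHomeomorph

/-- As π is a local homeomorphism, ranges of its continuous sections over open sets form a basis of
X̃; a basic set around a preimage of x inside π⁻¹(U) gives the section. -/
theorem exists_local_section {U : Opens X} {x : X} (hx : x ∈ U) :
    ∃ W : Opens X, x ∈ W ∧ W ≤ U ∧ ∃ s : C(W, Y), ∀ w, π.proj (s w) = w := by
  obtain ⟨y, rfl⟩ := π.isQuotientCoveringMap.surjective x
  obtain ⟨_, ⟨V, hV, s, hs, rfl⟩, ⟨v, hv⟩, hU⟩ :=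
    π.isLocalHomeomorph_proj.isTopologicalBasis.exists_subset_of_mem_open
      (show y ∈ π.preimage U from hx) (π.preimage U).isOpen
  have hs' : ∀ v, π.proj (s v) = v := fun v => congrFun hs v
  refine ⟨⟨V, hV⟩, ?_, fun w hw => ?_, s, hs'⟩
  · rw [← hv, hs']; exact v.2
  · have := hU ⟨⟨w, hw⟩, rfl⟩
    rwa [SetLike.mem_coe, π.mem_preimage, hs'] at this

variable {π}

/-- The composite π ∘ s is the inclusion of an open set and π is a local homeomorphism. -/
theorem isOpenEmbedding_section {s : C(U, Y)} (hs : ∀ u, π.proj (s u) = u) :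
    IsOpenEmbedding s := by
  refine π.isLocalHomeomorph_proj.isOpenEmbedding_of_comp ?_ s.continuous
  have : π.proj ∘ s = Subtype.val := funext hs
  rw [this]
  exact U.isOpen.isOpenEmbedding_subtypeVal

/-- The function `f` on `Y` is `a ∘ s⁻¹` extended by zero, where `s` is a section over `U` and
`a ∈ C₀(U)`. -/
structure IsSectionLift (s : C(U, Y)) (a : C₀(X, ℂ)) (f : C_c(Y, ℂ)) : Prop where
  vanishesOff : VanishesOff U a
  apply : ∀ u, f (s u) = a u
  eq_zero : ∀ y, y ∉ Set.range s → f y = 0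

namespace IsSectionLift

variable {s : C(U, Y)} {a b : C₀(X, ℂ)} {f g : C_c(Y, ℂ)}

theorem mul (hf : IsSectionLift s a f) (hg : IsSectionLift s b g) :
    IsSectionLift s (a * b) (f * g) where
  vanishesOff := hf.vanishesOff.mul_right b
  apply u := by
    change f (s u) * g (s u) = a u * b u
    rw [hf.apply, hg.apply]
  eq_zero y hy := by
    change f y * g y = 0
    rw [hf.eq_zero y hy, zero_mul]

theorem star (hf : IsSectionLift s a f) : IsSectionLift s (star a) (star f) where
  vanishesOff := hf.vanishesOff.star
  apply u := congrArg Star.star (hf.apply u)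
  eq_zero y hy := by
    change Star.star (f y) = 0
    rw [hf.eq_zero y hy, star_zero]

theorem eq_zero_of_proj_notMem (hf : IsSectionLift s a f) (hs : ∀ u, π.proj (s u) = u) {y : Y}
    (hy : y ∉ π.preimage U) : f y = 0 :=
  hf.eq_zero y fun ⟨u, hu⟩ => hy (by rw [π.mem_preimage, ← hu, hs]; exact u.2)

/-- The sum over the fibres of a function supported in the image of a section. -/
theorem push_eq (hf : IsSectionLift s a f)
    (hs : ∀ u, π.proj (s u) = u) : π.push f = a := by
  ext x
  by_cases hx : x ∈ U
  · have hx' : π.proj (s ⟨x, hx⟩) = x := hs _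
    conv_lhs => rw [← hx']
    -- The range of s meets each fibre at most once and the action is free, so only γ = 1
    -- contributes.
    rw [π.push_apply, finsum_eq_single _ (1 : Γ) fun γ hγ => ?_, one_smul, hf.apply]
    refine hf.eq_zero _ ?_
    rintro ⟨u, hu⟩
    have h1 := congrArg π.proj hu
    rw [hs, π.proj_smul, hs] at h1
    have h2 : u = ⟨x, hx⟩ := Subtype.ext h1
    rw [h2] at hu
    exact hγ (π.smul_injective _ (hu.symm.trans (one_smul Γ _).symm))
  · obtain ⟨y, rfl⟩ := π.isQuotientCoveringMap.surjective x
    rw [hf.vanishesOff _ hx]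
    refine π.push_vanishesOff (fun z hz => hf.eq_zero_of_proj_notMem hs hz) _ hx

end IsSectionLift

/-- The image of the compact support of a under s is compact, so a ∘ s⁻¹ extends by zero with
support in that image, hence over U. -/
theorem exists_isSectionLift {s : C(U, Y)}
    (hs : ∀ u, π.proj (s u) = u) {a : C_c(X, ℂ)} (ha : tsupport a ⊆ U) :
    ∃ f : C_c(Y, ℂ), IsSectionLift s a.toC₀ f ∧ tsupport f ⊆ π.preimage U := by
  have := π.t2Space
  have he := isOpenEmbedding_section hs
  have hL : IsCompact ((↑) ⁻¹' tsupport a : Set U) :=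
    U.isOpen.isOpenEmbedding_subtypeVal.isInducing.isCompact_preimage' a.hasCompactSupport
      (by rwa [Subtype.range_coe])
  have hK := hL.image s.continuous
  have h0 : ∀ y, y ∉ s '' ((↑) ⁻¹' tsupport a) →
      Function.extend s (fun u : U => a u) 0 y = 0 := fun y hy => by
    by_cases h : y ∈ Set.range s
    · obtain ⟨u, rfl⟩ := h
      rw [he.injective.extend_apply]
      exact image_eq_zero_of_notMem_tsupport fun hu => hy ⟨u, hu, rfl⟩
    · exact Function.extend_apply' _ _ _ h
  refine ⟨⟨⟨Function.extend s (fun u : U => a u) 0, he.continuous_extend_zero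
    (a.continuous.comp continuous_subtype_val) hL fun u hu =>
      image_eq_zero_of_notMem_tsupport hu⟩, HasCompactSupport.intro hK h0⟩,
    ⟨vanishesOff ha, fun u => he.injective.extend_apply (fun u : U => a u) 0 u,
      fun y hy => Function.extend_apply' (f := s) (fun u : U => a u) 0 y hy⟩, ?_⟩
  refine (closure_minimal (fun y hy => ?_) hK.isClosed).trans
    (?_ : s '' ((↑) ⁻¹' tsupport a) ⊆ _)
  · by_contra h
    exact hy (h0 y h)
  · rintro _ ⟨u, -, rfl⟩
    rw [SetLike.mem_coe, π.mem_preimage, hs]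
    exact u.2

end NormalCovering

/-- Each compactly supported function is a product of two such functions with the same zeros. -/
theorem CompactlySupportedContinuousMap.exists_eq_mul {Y : Type*} [TopologicalSpace Y]
    [T2Space Y] (f : C_c(Y, ℂ)) : ∃ g k : C_c(Y, ℂ), g * k = f ∧ ∀ y, f y = 0 → g y = 0 := by
  have hc : Continuous fun y => (Real.sqrt ‖f y‖ : ℂ) := by fun_prop
  have hn : ∀ y, ‖f y / (Real.sqrt ‖f y‖ : ℂ)‖ = Real.sqrt ‖f y‖ := fun y => by
    rw [norm_div, Complex.norm_real, Real.norm_of_nonneg (Real.sqrt_nonneg _), Real.div_sqrt]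
  -- The factors are f/√|f| and √|f|. The first has modulus √|f|, which makes it continuous also at
  -- the zeros of f, where it takes the value 0.
  have hg : Continuous fun y => f y / (Real.sqrt ‖f y‖ : ℂ) := by
    rw [continuous_iff_continuousAt]
    intro y
    by_cases hy : f y = 0
    · rw [ContinuousAt, hy, zero_div]
      refine squeeze_zero_norm (fun z => (hn z).le) ?_
      have : Tendsto (fun z => Real.sqrt ‖f z‖) (𝓝 y) (𝓝 (Real.sqrt ‖f y‖)) :=
        Continuous.tendsto (by fun_prop) y
      simpa [hy] using this
    · refine f.continuous.continuousAt.div hc.continuousAt ?_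
      rw [Complex.ofReal_ne_zero, Real.sqrt_ne_zero']
      exact norm_pos_iff.2 hy
  have h0 : ∀ {y}, y ∉ tsupport f → f y = 0 := image_eq_zero_of_notMem_tsupport
  refine ⟨⟨⟨_, hg⟩, HasCompactSupport.intro f.hasCompactSupport fun y hy => by simp [h0 hy]⟩,
    ⟨⟨_, hc⟩, HasCompactSupport.intro f.hasCompactSupport fun y hy => by simp [h0 hy]⟩, ?_,
    fun y hy => ?_⟩
  · ext y
    change f y / (Real.sqrt ‖f y‖ : ℂ) * (Real.sqrt ‖f y‖ : ℂ) = f y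
    by_cases hy : f y = 0
    · rw [hy, zero_div, zero_mul]
    · refine div_mul_cancel₀ _ ?_
      rw [Complex.ofReal_ne_zero, Real.sqrt_ne_zero']
      exact norm_pos_iff.2 hy
  · change f y / _ = 0
    rw [hy, zero_div]

end SectionLifts

/-! ### Testing operators on compactly supported functions -/

section LocalModules

open ContinuousLinearMap
open scoped CompactlySupported

theorem ext_localRep_of_compactSupport {Y K : Type*} [TopologicalSpace Y] [T2Space Y]
    [LocallyCompactSpace Y] [NormedAddCommGroup K] [InnerProductSpace ℂ K] [CompleteSpace K]
    {ρ : C₀(Y, ℂ) →⋆ₙₐ[ℂ] (K →L[ℂ] K)} {W : Opens Y} {E : Type*} [NormedAddCommGroup E]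
    [NormedSpace ℂ E] {S T : LocalModule ρ W →L[ℂ] E}
    (h : ∀ f : C_c(Y, ℂ), tsupport f ⊆ W →
      S ∘L localRep ρ W f.toC₀ = T ∘L localRep ρ W f.toC₀) : S = T :=
  ext_localRep fun _ hf => hf.induction_of_compactSupport
    (p := fun f => S ∘L localRep ρ W f = T ∘L localRep ρ W f)
    (isClosed_eq
      (continuous_const.clm_comp (continuous_compressOp.comp continuous_rep))
      (continuous_const.clm_comp (continuous_compressOp.comp continuous_rep))) h

end LocalModules

/-! ### Isometries attached to sections -/

section SectionIsometries

open ContinuousLinearMap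
open CompactlySupportedContinuousMap hiding comp_assoc comp_id zero_comp
open scoped CompactlySupported

set_option linter.unusedSectionVars false

variable {Γ Y X : Type*} [Group Γ] [TopologicalSpace Y] [TopologicalSpace X] [MulAction Γ Y]
  [T2Space X] [CompactSpace X]
  {H : Type*} [NormedAddCommGroup H] [InnerProductSpace ℂ H] [CompleteSpace H]
  {π : NormalCovering Γ Y X} {ρ : C₀(X, ℂ) →⋆ₙₐ[ℂ] (H →L[ℂ] H)} {U V : Opens X}

theorem inner_adjoint_inclL_rep {a b : C₀(X, ℂ)} (hb : VanishesOff U b) (h h' : H) :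
    inner ℂ (adjoint (inclL ρ U) (ρ a h)) (adjoint (inclL ρ U) (ρ b h')) =
      inner ℂ h (ρ (star a * b) h') := by
  rw [adjoint_inner_left, inclL_comp_adjoint_apply (rep_mem_localSpace hb h'), map_mul_comp,
    comp_apply, ← adjoint_map, adjoint_inner_right]

namespace NormalCovering

/-- The support of f may reach the boundary of π⁻¹(U), so no cutoff equal to 1 on it is at hand. A
factorization f = gk with g vanishing off π⁻¹(U) writes f ⊗ h as g(k ⊗ h). -/
theorem tensor_mem_localSpace {f : C_c(Y, ℂ)} (hf : ∀ y, y ∉ π.preimage U → f y = 0) (h : H) :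
    π.tensor ρ f h ∈ localSpace (π.inducedRep ρ) (π.preimage U) := by
  have := π.t2Space
  obtain ⟨g, k, rfl, h0⟩ := f.exists_eq_mul
  rw [← inducedRep_comp_tensor]
  exact rep_mem_localSpace (fun y hy => h0 y (hf y hy)) _

theorem sectionLift_total {s : C(U, Y)} (hs : ∀ u, π.proj (s u) = u) :
    (Submodule.span ℂ (Set.range
      fun i : {p : C₀(X, ℂ) × C_c(Y, ℂ) // IsSectionLift s p.1 p.2} × H =>
        adjoint (inclL ρ U) (ρ i.1.1.1 i.2))).topologicalClosure = ⊤ := by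
  rw [Submodule.topologicalClosure_eq_top_iff, Submodule.eq_bot_iff]
  intro v hv
  have h1 : innerSL ℂ v = 0 := by
    refine ext_localRep_of_compactSupport (ρ := ρ) (W := U) fun a ha => ?_
    obtain ⟨f, hf, -⟩ := exists_isSectionLift hs ha
    ext1 w
    exact (Submodule.mem_orthogonal' _ _).1 hv _
      (Submodule.subset_span ⟨(⟨(a.toC₀, f), hf⟩, inclL ρ U w), rfl⟩)
  have h2 := DFunLike.congr_fun h1 v
  exact (inner_self_eq_zero (𝕜 := ℂ)).1 h2

/-- If f and g come from a and b through s, then f̄ g comes from ā b, so p(f̄ g) = ā b and the Gram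
matrices of ρ(a)h and f ⊗ h agree. -/
theorem exists_isSectionIsometry (ρ : C₀(X, ℂ) →⋆ₙₐ[ℂ] (H →L[ℂ] H)) {s : C(U, Y)}
    (hs : ∀ u, π.proj (s u) = u) :
    ∃ J : LocalModule ρ U →ₗᵢ[ℂ] π.LocalInduced ρ U, π.IsSectionIsometry s J := by
  have hmem : ∀ {a : C₀(X, ℂ)} {f : C_c(Y, ℂ)}, IsSectionLift s a f → ∀ h,
      π.tensor ρ f h ∈ localSpace (π.inducedRep ρ) (π.preimage U) := fun hf =>
    tensor_mem_localSpace fun y hy => hf.eq_zero_of_proj_notMem hs hy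
  obtain ⟨J, hJ⟩ := exists_isometry_of_gram
    (fun i : {p : C₀(X, ℂ) × C_c(Y, ℂ) // IsSectionLift s p.1 p.2} × H =>
      adjoint (inclL ρ U) (ρ i.1.1.1 i.2))
    (fun i => adjoint (inclL (π.inducedRep ρ) (π.preimage U)) (π.tensor ρ i.1.1.2 i.2))
    (sectionLift_total hs) fun i j => by
      rw [inner_adjoint_inclL_rep j.1.2.vanishesOff, adjoint_inner_left,
        inclL_comp_adjoint_apply (hmem j.1.2 _), π.inner_tensor,
        (i.1.2.star.mul j.1.2).push_eq hs]
  refine ⟨J, fun a f h v ha hf hf0 hv => ?_⟩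
  have hl : IsSectionLift s a f := ⟨ha, hf, hf0⟩
  have e : v = adjoint (inclL ρ U) (ρ a h) := by
    rw [← hv]
    exact (congrArg (fun A : LocalModule ρ U →L[ℂ] LocalModule ρ U => A v)
      (adjoint_inclL_comp ρ U)).symm
  have h1 := hJ (⟨(a, f), hl⟩, h)
  rw [e]
  exact (congrArg _ h1).trans (inclL_comp_adjoint_apply (hmem hl h))

/-- An isometry `P_U H → P_U H̃` as an operator on the whole modules. -/
noncomputable def sectionOp (J : LocalModule ρ U →ₗᵢ[ℂ] π.LocalInduced ρ U) :
    H →L[ℂ] π.InducedModule ρ :=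
  inclL (π.inducedRep ρ) (π.preimage U) ∘L J.toContinuousLinearMap ∘L adjoint (inclL ρ U)

theorem extendOp_compress (J : LocalModule ρ U →ₗᵢ[ℂ] π.LocalInduced ρ U)
    (T : π.LocalInduced ρ U →L[ℂ] π.LocalInduced ρ U) : extendOp ρ U (compress J T) =
      adjoint (sectionOp J) ∘L extendOp (π.inducedRep ρ) (π.preimage U) T ∘L sectionOp J := by
  simp only [extendOp, sectionOp, compress, adjoint_comp, adjoint_adjoint, comp_assoc,
    adjoint_inclL_comp_assoc]

namespace IsSectionIsometry

variable {s : C(U, Y)} {J : LocalModule ρ U →ₗᵢ[ℂ] π.LocalInduced ρ U} {a : C₀(X, ℂ)}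
  {f : C_c(Y, ℂ)}

theorem sectionOp_comp_rep (hJ : π.IsSectionIsometry s J) (hf : IsSectionLift s a f) :
    sectionOp J ∘L ρ a = π.tensor ρ f := by
  ext1 h
  exact hJ a f h _ hf.vanishesOff hf.apply hf.eq_zero
    (inclL_comp_adjoint_apply (rep_mem_localSpace hf.vanishesOff h))

/-- The isometry intertwines a on P_U H with f = a ∘ s⁻¹ on P_U H̃. It is enough to test on vectors
ρ(b)w, where both sides give fg ⊗ w with g = b ∘ s⁻¹. -/
theorem rep_comp_sectionOp (hJ : π.IsSectionIsometry s J) (hs : ∀ u, π.proj (s u) = u)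
    (hf : IsSectionLift s a f) :
    π.inducedRep ρ f.toC₀ ∘L sectionOp J = π.tensor ρ f := by
  have key : π.inducedRep ρ f.toC₀ ∘L inclL (π.inducedRep ρ) (π.preimage U) ∘L
      J.toContinuousLinearMap = π.tensor ρ f ∘L inclL ρ U := by
    refine ext_localRep_of_compactSupport fun b hb => ?_
    obtain ⟨g, hg, -⟩ := exists_isSectionLift hs hb
    have h1 := hJ.sectionOp_comp_rep hg
    -- On the range of s the functions g and b ∘ π agree, and f vanishes elsewhere.
    have h2 : π.pullMul b.toC₀ f = f * g := by
      ext y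
      rw [pullMul_apply, mul_apply]
      by_cases hy : y ∈ Set.range s
      · obtain ⟨u, rfl⟩ := hy
        rw [hs, hg.apply, mul_comm]
      · rw [hf.eq_zero y hy, mul_zero, zero_mul]
    rw [localRep_eq, compressOp]
    simp only [comp_assoc]
    rw [inclL_adjoint_comp_rep_assoc (vanishesOff hb), ← comp_assoc (π.tensor ρ f),
      π.tensor_comp_rep, h2, ← π.inducedRep_comp_tensor, ← h1]
    simp only [sectionOp, comp_assoc]
  rw [sectionOp, ← comp_assoc _ _ (adjoint _), ← comp_assoc, key,
    ← hJ.sectionOp_comp_rep hf, comp_assoc, comp_assoc, rep_comp_inclL_adjoint hf.vanishesOff]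

theorem rep_comp_adjoint_sectionOp (hJ : π.IsSectionIsometry s J) (hf : IsSectionLift s a f) :
    ρ a ∘L adjoint (sectionOp J) = adjoint (π.tensor ρ (star f)) := by
  rw [← hJ.sectionOp_comp_rep hf.star, adjoint_comp, adjoint_map, star_star]

theorem adjoint_sectionOp_comp_rep (hJ : π.IsSectionIsometry s J) (hs : ∀ u, π.proj (s u) = u)
    (hf : IsSectionLift s a f) :
    adjoint (sectionOp J) ∘L π.inducedRep ρ f.toC₀ = adjoint (π.tensor ρ (star f)) := by
  rw [← hJ.rep_comp_sectionOp hs hf.star, adjoint_comp, adjoint_map_toC₀, star_star]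

/-- The intertwining relations carry the commutator with a to the compressed commutator of R with a
∘ s⁻¹. -/
theorem pseudolocalOn (hJ : π.IsSectionIsometry s J) (hs : ∀ u, π.proj (s u) = u)
    {R : π.InducedModule ρ →L[ℂ] π.InducedModule ρ}
    (hR : PseudolocalOn (π.inducedRep ρ) (π.preimage U) R) :
    PseudolocalOn ρ U (adjoint (sectionOp J) ∘L R ∘L sectionOp J) := by
  refine PseudolocalOn.of_compactSupport fun a ha => ?_
  obtain ⟨f, hf, hfU⟩ := exists_isSectionLift hs ha
  have h1 := ((hR _ (vanishesOff hfU)).comp_right (sectionOp J)).comp_left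
    (adjoint (sectionOp J))
  rw [comp_assoc, comp_assoc, hJ.rep_comp_sectionOp hs hf, ← comp_assoc (adjoint _) (π.inducedRep ρ _),
    hJ.adjoint_sectionOp_comp_rep hs hf] at h1
  rw [← comp_assoc (ρ _), hJ.rep_comp_adjoint_sectionOp hf, comp_assoc, comp_assoc,
    hJ.sectionOp_comp_rep hf]
  exact h1

/-- Cut off on both sides, ρ(a) J⋆RJ ρ(b) is t_{f̄}⋆ R t_g, which the lifting relation compares with
ρ(p(fg)) S = ρ(a)ρ(b)S; moving ρ(b) to the right of S finishes the comparison. -/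
theorem locCompactOn_sub (hJ : π.IsSectionIsometry s J) (hs : ∀ u, π.proj (s u) = u)
    {R : π.InducedModule ρ →L[ℂ] π.InducedModule ρ} {S : H →L[ℂ] H}
    (hR : PseudolocalOn (π.inducedRep ρ) (π.preimage U) R) (hS : PseudolocalOn ρ U S)
    (h : π.IsLift U R S) :
    LocCompactOn ρ U (adjoint (sectionOp J) ∘L R ∘L sectionOp J - S) := by
  refine LocCompactOn.of_comp_comp ((hJ.pseudolocalOn hs hR).sub hS) fun a b ha hb => ?_
  obtain ⟨f, hf, hfU⟩ := exists_isSectionLift hs ha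
  obtain ⟨g, hg, hgU⟩ := exists_isSectionLift hs hb
  -- The lifting relation conjugates its first test function, whence f̄ here.
  have h1 := h (star f) g ((CompactlySupportedContinuousMap.tsupport_star f).trans_subset hfU) hgU
  rw [star_star, (hf.mul hg).push_eq hs, map_mul_comp, comp_assoc] at h1
  rw [sub_comp, comp_sub, CompactEq.sub_zero_iff, comp_assoc, comp_assoc,
    hJ.sectionOp_comp_rep hg, ← comp_assoc (ρ _), hJ.rep_comp_adjoint_sectionOp hf]
  exact h1.trans ((hS _ (vanishesOff hb)).symm.comp_left _)

theorem compress_mem_algD (hJ : π.IsSectionIsometry s J) (hs : ∀ u, π.proj (s u) = u)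
    {T : π.LocalInduced ρ U →L[ℂ] π.LocalInduced ρ U}
    (hT : IsPseudolocal (π.inducedRep ρ) (π.preimage U) T) : compress J T ∈ algD ρ U := by
  refine isPseudolocal_iff.2 ?_
  rw [extendOp_compress]
  exact hJ.pseudolocalOn hs (isPseudolocal_iff.1 hT)

theorem isLocallyCompactOp_sub (hJ : π.IsSectionIsometry s J) (hs : ∀ u, π.proj (s u) = u)
    {T : π.LocalInduced ρ U →L[ℂ] π.LocalInduced ρ U}
    {S : LocalModule ρ U →L[ℂ] LocalModule ρ U}
    (hT : IsPseudolocal (π.inducedRep ρ) (π.preimage U) T) (hS : IsPseudolocal ρ U S)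
    (h : π.IsLocalLift T S) : IsLocallyCompactOp ρ U (compress J T - S) := by
  rw [isLocallyCompactOp_iff, extendOp_sub, extendOp_compress]
  exact hJ.locCompactOn_sub hs (isPseudolocal_iff.1 hT) (isPseudolocal_iff.1 hS) h

theorem _root_.CoveringFrame.symbolIso_eq_compress (D : CoveringFrame π)
    (hJ : π.IsSectionIsometry s J) (hs : ∀ u, π.proj (s u) = u) (T : π.𝔇Γ ρ U) :
    ∃ hT : compress J T.1 ∈ algD ρ U,
      (D.symbolIso ρ).toEquiv U ((π.ℭΓ ρ U).toQuot T) = (idealC ρ U).toQuot ⟨_, hT⟩ := by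
  have hT := hJ.compress_mem_algD hs (π.isPseudolocal_of_mem ρ T.2)
  refine ⟨hT, (D.symbolIso_eq ρ (D.isLocalLift_psiLin T)).trans (Eq.symm ?_)⟩
  exact toQuot_idealC_eq_iff.2 (hJ.isLocallyCompactOp_sub hs (π.isPseudolocal_of_mem ρ T.2)
    (D.psiLin ρ U T).2 (D.isLocalLift_psiLin T))

end IsSectionIsometry

end NormalCovering

end SectionIsometries

/-! ### Uniqueness of the isomorphism -/

section Uniqueness

set_option linter.unusedSectionVars false

variable {Γ Y X : Type*} [Group Γ] [TopologicalSpace Y] [TopologicalSpace X] [MulAction Γ Y]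
  [T2Space X] [CompactSpace X]
  {H : Type*} [NormedAddCommGroup H] [InnerProductSpace ℂ H] [CompleteSpace H]
  {π : NormalCovering Γ Y X} {ρ : C₀(X, ℂ) →⋆ₙₐ[ℂ] (H →L[ℂ] H)}

namespace CStarPresheaf

/-- Isomorphisms onto a sheaf agree if they agree locally. -/
theorem Iso.eq_of_locally {A B : Opens X → Type*} [∀ U, CStarAlgebra (A U)]
    [∀ U, CStarAlgebra (B U)] {F : CStarPresheaf A} {G : CStarPresheaf B} (hG : G.IsSheaf)
    {α β : F.Iso G} {p : Opens X → Prop} (hp : ∀ (U : Opens X), ∀ x ∈ U, ∃ W ≤ U, x ∈ W ∧ p W)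
    (h : ∀ U, p U → ∀ a, α.toEquiv U a = β.toEquiv U a) : α = β := by
  refine Iso.ext fun U => ?_
  obtain ⟨𝒰, hU, h𝒰⟩ : ∃ 𝒰 : Set (Opens X), sSup 𝒰 = U ∧ ∀ W ∈ 𝒰, p W := by
    refine ⟨{W | W ≤ U ∧ p W}, le_antisymm (sSup_le fun W hW => hW.1) fun x hx => ?_,
      fun W hW => hW.2⟩
    obtain ⟨W, hWU, hxW, hW⟩ := hp U x hx
    exact Opens.mem_sSup.2 ⟨W, ⟨hWU, hW⟩, hxW⟩
  subst hU
  intro a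
  refine sub_eq_zero.1 (hG.uniqueness 𝒰 _ fun W hW => ?_)
  rw [map_sub, ← α.natural, ← β.natural, h W (h𝒰 W hW), sub_self]

end CStarPresheaf

/-- The formula holds for the constructed isomorphism with every section isometry, in particular
with the one used by β, so uniqueness of the isometry need not be discussed. -/
theorem CoveringFrame.eq_symbolIso_apply (D : CoveringFrame π)
    (β : (π.symbolPresheafΓ ρ).Iso (symbolPresheaf ρ)) {U : Opens X} {s : C(U, Y)}
    {J : LocalModule ρ U →ₗᵢ[ℂ] π.LocalInduced ρ U} (hJ : π.IsSectionIsometry s J)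
    (hs : ∀ u, π.proj (s u) = u)
    (hβ : ∀ T : π.𝔇Γ ρ U, ∃ hT : compress J T.1 ∈ algD ρ U,
      β.toEquiv U ((π.ℭΓ ρ U).toQuot T) = (idealC ρ U).toQuot ⟨_, hT⟩) (a : π.𝔔Γ ρ U) :
    β.toEquiv U a = (D.symbolIso ρ).toEquiv U a := by
  obtain ⟨T, hT⟩ := (π.ℭΓ ρ U).toQuot_surjective a
  rw [← hT]
  exact (hβ T).choose_spec.trans (D.symbolIso_eq_compress hJ hs T).choose_spec.symm

/-- Every point of an open set has a smaller neighbourhood with a section, where both isomorphisms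
are given by compression; separatedness of 𝔔 extends the equality. -/
theorem CoveringFrame.eq_symbolIso [MetrizableSpace X] (D : CoveringFrame π)
    (β : (π.symbolPresheafΓ ρ).Iso (symbolPresheaf ρ))
    (hβ : ∀ (U : Opens X) (s : C(U, Y)), (∀ u, π.proj (s u) = u) →
      ∃ J : LocalModule ρ U →ₗᵢ[ℂ] π.LocalInduced ρ U, π.IsSectionIsometry s J ∧
        ∀ T : π.𝔇Γ ρ U, ∃ hT : compress J T.1 ∈ algD ρ U,
          β.toEquiv U ((π.ℭΓ ρ U).toQuot T) = (idealC ρ U).toQuot ⟨_, hT⟩) :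
    β = D.symbolIso ρ :=
  CStarPresheaf.Iso.eq_of_locally symbolPresheaf_isSheaf
    (p := fun W => ∃ s : C(W, Y), ∀ w, π.proj (s w) = w)
    (fun _ _ hx => by
      obtain ⟨W, hxW, hWU, hW⟩ := π.exists_local_section hx
      exact ⟨W, hWU, hxW, hW⟩)
    fun W ⟨s, hs⟩ => by
      obtain ⟨J, hJ, h⟩ := hβ W s hs
      exact D.eq_symbolIso_apply β hJ hs h

end Uniqueness

theorem mainTheorem7 {Γ Y X H : Type*} [Group Γ] [TopologicalSpace Y] [MulAction Γ Y]
    [MetricSpace X] [CompactSpace X]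
    [NormedAddCommGroup H] [InnerProductSpace ℂ H] [CompleteSpace H]
    (π : NormalCovering Γ Y X) (ρ : C₀(X, ℂ) →⋆ₙₐ[ℂ] (H →L[ℂ] H)) :
    ∃ (F : CStarPresheaf (fun U : Opens X => π.𝔔Γ ρ U))
      (G : CStarPresheaf (fun U : Opens X => algQ ρ U)),
      -- the restriction maps of `F` and `G` are induced by `T ↦ P_U T P_U`
      (∀ (U V : Opens X) (hUV : U ≤ V) (T : π.𝔇Γ ρ V),
        ∃ hT : restrictOp (π.inducedRep ρ) (π.preimage V) (π.preimage U) T ∈ π.𝔇Γ ρ U,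
          F.res hUV ((π.ℭΓ ρ V).toQuot T) = (π.ℭΓ ρ U).toQuot ⟨_, hT⟩) ∧
      (∀ (U V : Opens X) (hUV : U ≤ V) (T : algD ρ V),
        ∃ hT : restrictOp ρ V U T ∈ algD ρ U,
          G.res hUV ((idealC ρ V).toQuot T) = (idealC ρ U).toQuot ⟨_, hT⟩) ∧
      F.IsSheaf ∧ G.IsSheaf ∧
      -- `F` is special, the module structure being given by multiplication operators
      (∃ M : F.ModuleStructure, ∀ (U : Opens X) (f : U →ᵇ ℂ),
        ∃ m : π.𝔇Γ ρ U, π.IsMultiplication (ρ := ρ) f m ∧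
          ∀ q, M.act U f q = (π.ℭΓ ρ U).toQuot m * q) ∧
      -- the isomorphism of sheaves given by `T ↦ T_{γγ}` where the covering is trivial
      ∃! α : F.Iso G, ∀ (U : Opens X) (s : C(U, Y)), (∀ u, π.proj (s u) = u) →
        ∃ V : LocalModule ρ U →ₗᵢ[ℂ] π.LocalInduced ρ U, π.IsSectionIsometry s V ∧
          ∀ T : π.𝔇Γ ρ U, ∃ hT : compress V T ∈ algD ρ U,
            α.toEquiv U ((π.ℭΓ ρ U).toQuot T) = (idealC ρ U).toQuot ⟨_, hT⟩ := by
  have D : CoveringFrame π := Classical.choice (CoveringFrame.nonempty π)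
  refine ⟨π.symbolPresheafΓ ρ, symbolPresheaf ρ,
    fun U V h T => ⟨π.restrictOp_mem_𝔇Γ h T.2, π.symbolPresheafΓ_res ρ h T⟩,
    fun U V h T => ⟨restrictOp_mem_algD h T.2, symbolPresheaf_res h T⟩,
    -- Gluing is carried out only in 𝔔, where no control or invariance has to be preserved, and is
    -- transported to 𝔔_Γ.
    symbolPresheaf_isSheaf.of_iso (D.symbolIso ρ), symbolPresheaf_isSheaf,
    ⟨π.moduleStructure ρ, fun U f => ⟨π.mulD ρ f, π.isMultiplication_mulD ρ f, fun q => rfl⟩⟩,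
    D.symbolIso ρ, fun U s hs => ?_, fun β hβ => D.eq_symbolIso β hβ⟩
  obtain ⟨J, hJ⟩ := NormalCovering.exists_isSectionIsometry ρ hs
  exact ⟨J, hJ, D.symbolIso_eq_compress hJ hs⟩
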